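/- Let $G$ be a compact connected simply connected Lie group with maximal torus $T$, Lie algebras $\mathfrak t\subset\mathfrak g$, integral lattice $\Pi=\ker(\exp\colon\mathfrak t\to T)$ and basic inner product $\cdot$ on $\mathfrak g$, and let $\ell>0$ be a level, acting on $\mathfrak g$ by multiplication by a positive integer on each simple ideal. Let $LG$ be the group of loops $\mathbb R/\mathbb Z\to G$ of a fixed Sobolev class $\varsigma>\frac12$, with based loops $\Omega G\subset LG$; $\eta\in\Pi$ is regarded as the loop $s\mapsto\exp(-s\eta)$, and $LG$ acts on $L\mathfrak g^*=\Omega^1_{\varsigma-1}(S^1,\mathfrak g)$ by $g\cdot a=\mathrm{Ad}_g a-dg\,g^{-1}$. For $\xi\in L\mathfrak g$, $\xi_{\mathcal M}(x)=\partial_u|_{u=0}\exp(-u\xi)\cdot x$. Let $(\mathcal M,\omega_{\mathcal M},\mu_{\mathcal M})$ be a proper Hamiltonian $LG$-space, $\mathrm{hol}\colon\mathcal M\to M=\mathcal M/\Omega G$ the quotient, and fix a $G$-invariant Riemannian metric on the (even-dimensional) manifold $M$. Let $\mathscr S$ be a level $\ell$ spinor bundle for $\mathrm{hol}^*TM$ (a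 spinor bundle with a compatible action of the level $\ell$ central extension of $LG$ by $U(1)$), $\mathscr L=\mathrm{Hom}_{\mathbb Cl}(\mathscr S^*,\mathscr S)$ its anti-canonical line bundle, $\nabla^{\mathscr L}$ an invariant Hermitian connection on $\mathscr L$, and $\phi_{\mathcal M}$ the $\mathrm{Spin}_c$ moment map, $2\pi i\langle\phi_{\mathcal M},\xi\rangle=\frac12(\mathcal L^{\mathscr L}_\xi-\nabla^{\mathscr L}_{\xi_{\mathcal M}})$. Let $\phi$ be its composition with the projection to $\mathfrak t$, i.e. its restriction to constant $\xi\in\mathfrak t$, where $\mathfrak t\cong\mathfrak t^*$ by the inner product. Let $R\subset L\mathfrak g^*$ be the image of an embedding $\mathfrak t\times\overline B_\epsilon(\mathfrak t^\perp)\to L\mathfrak g^*$, $\epsilon>0$, that extends the inclusion of $\mathfrak t$ as constant forms, is $N(T)\ltimes\Pi$-equivariant ($\Pi$ acting by translations on $\mathfrak t$ and trivially on $\mathfrak t^\perp$), has image in the smooth forms and transverse to the $\Omega G$-orbits, and such that each $\Omega G$-orbit that meets $R$ meets it in a single $\Pi$-orbit. Let $X=\mu_{\mathcal M}^{-1}(R)$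 be the corresponding global transversal, with the Riemannian metric pulled back from $M$ by $\mathrm{hol}$. The $\mathrm{Spin}_c$ Kirwan vector field on $X$ is $\kappa(x)=\phi(x)_X(x)$. For $\beta\in\mathfrak t$ let $\mathcal Z_\beta=X^\beta\cap\phi^{-1}(\beta)$, where $X^\beta=\{x\in X:\beta_X(x)=0\}$, and let $\mathcal B=\{\beta\in\mathfrak t:\mathcal Z_\beta\neq\emptyset\}$, so that $\kappa^{-1}(0)=\bigcup_{\beta\in\mathcal B}\mathcal Z_\beta$. Let $\mathcal B_*\subset\mathcal B$ be a minimal subset such that for each $\beta\in\mathcal B$ there are $\beta_*\in\mathcal B_*$, $\eta\in\Pi$ with $\mathcal Z_\beta=\eta\cdot\mathcal Z_{\beta_*}$. For each $\beta_*\in\mathcal B_*$ let $\mathcal U_{\beta_*}$ be any $T$-invariant open neighborhood of $\mathcal Z_{\beta_*}$ in $X$; for $\beta\in\mathcal B$ with $\mathcal Z_\beta=\eta\cdot\mathcal Z_{\beta_*}$ put $\mathcal U_\beta=\eta\cdot\mathcal U_{\beta_*}$, and let $\mathcal U=\bigcup_{\beta\in\mathcal B}\mathcal U_\beta$. Then there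 is a constant $c>0$ such that $|\kappa(x)|\ge c$ for all $x\in X\setminus\mathcal U$. -/

import Mathlib

open Bundle Manifold Set Filter Topology
open scoped ContDiff Pointwise

attribute [local instance] Matrix.normedAddCommGroup Matrix.normedSpace

noncomputable section

namespace LoopKirwan

/-- Complex `n × n` matrices (with the entrywise sup norm, used only for its topology). -/
abbrev Mat (n : ℕ) : Type := Matrix (Fin n) (Fin n) ℂ

/-! ### Groups, Lie algebras, the basic inner product, levels -/

section Groups

variable {G : Type*} [Group G] {n : ℕ}

/-- The Lie algebra of the subgroup `ρ(H)` of the matrix group: the matrices `A` such that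
`exp (t A) ∈ ρ(H)` for all real `t`. (For a closed subgroup this set is its own linear span.) -/
def lieAlgOf (ρ : G →* Matrix.unitaryGroup (Fin n) ℂ) (H : Subgroup G) : Submodule ℝ (Mat n) :=
  Submodule.span ℝ
    {A | ∀ t : ℝ, ∃ g ∈ H, ((ρ g : Matrix.unitaryGroup (Fin n) ℂ) : Mat n) = NormedSpace.exp (t • A)}

lemma lieAlgOf_mono (ρ : G →* Matrix.unitaryGroup (Fin n) ℂ) {H K : Subgroup G} (h : H ≤ K) :
    lieAlgOf ρ H ≤ lieAlgOf ρ K := by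
  refine Submodule.span_mono ?_
  intro A hA t
  obtain ⟨g, hg, e⟩ := hA t
  exact ⟨g, h hg, e⟩

/-- `T` is a maximal torus of the compact group `G`. -/
structure IsMaximalTorus [TopologicalSpace G] (T : Subgroup G) : Prop where
  isClosed : IsClosed (T : Set G)
  isConnected : IsConnected (T : Set G)
  comm : ∀ a ∈ T, ∀ b ∈ T, a * b = b * a
  maximal : ∀ T' : Subgroup G, IsClosed (T' : Set G) → IsConnected (T' : Set G) →
    (∀ a ∈ T', ∀ b ∈ T', a * b = b * a) → T ≤ T' → T' ≤ T

/-- `𝔞` is a simple ideal (a minimal nonzero ideal) of the Lie algebra `𝔤`. -/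
structure IsSimpleIdeal (𝔤 𝔞 : Submodule ℝ (Mat n)) : Prop where
  le : 𝔞 ≤ 𝔤
  ne_bot : 𝔞 ≠ ⊥
  ideal : ∀ A ∈ 𝔤, ∀ X ∈ 𝔞, A * X - X * A ∈ 𝔞
  minimal : ∀ 𝔟 : Submodule ℝ (Mat n), 𝔟 ≤ 𝔞 → 𝔟 ≠ ⊥ →
    (∀ A ∈ 𝔤, ∀ X ∈ 𝔟, A * X - X * A ∈ 𝔟) → 𝔟 = 𝔞

/-- `B` restricts to the basic inner product of `𝔤`: an invariant inner product, integral on the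
integral lattice `Π = ker (exp : 𝔱 → T)`, normalized on each simple ideal so that the shortest
co-roots, i.e. the shortest nonzero elements of `Π` in that ideal, have length `√2`.
(`B` is a bilinear form on all matrices, of which only the values on `𝔤` matter.) -/
structure IsBasicInnerProduct (ρ : G →* Matrix.unitaryGroup (Fin n) ℂ) (T : Subgroup G)
    (B : Mat n →ₗ[ℝ] Mat n →ₗ[ℝ] ℝ) : Prop where
  symm : ∀ X ∈ lieAlgOf ρ ⊤, ∀ Y ∈ lieAlgOf ρ ⊤, B X Y = B Y X
  pos : ∀ X ∈ lieAlgOf ρ ⊤, X ≠ 0 → 0 < B X X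
  invariant : ∀ g : G, ∀ X ∈ lieAlgOf ρ ⊤, ∀ Y ∈ lieAlgOf ρ ⊤,
    B ((ρ g : Mat n) * X * (ρ g⁻¹ : Mat n)) ((ρ g : Mat n) * Y * (ρ g⁻¹ : Mat n)) = B X Y
  integral : ∀ X ∈ lieAlgOf ρ T, ∀ Y ∈ lieAlgOf ρ T, NormedSpace.exp X = 1 →
    NormedSpace.exp Y = 1 → ∃ m : ℤ, B X Y = m
  normalized : ∀ 𝔞 : Submodule ℝ (Mat n), IsSimpleIdeal (lieAlgOf ρ ⊤) 𝔞 →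
    IsLeast {r : ℝ | ∃ X ∈ lieAlgOf ρ T, X ∈ 𝔞 ∧ X ≠ 0 ∧ NormedSpace.exp X = 1 ∧ r = B X X} 2

end Groups

/-! ### The loop group -/

/-- The fixed data: a compact connected simply connected Lie group `G`, presented by a faithful
unitary representation `ρ`, a maximal torus `T`, the basic inner product `B`, a level `ℓ > 0`
(multiplication by a positive integer on each simple ideal of `𝔤`), and a Sobolev exponent
`ς > 1/2`. -/
structure LoopData (G : Type*) [Group G] [TopologicalSpace G] [IsTopologicalGroup G]
    [CompactSpace G] [SimplyConnectedSpace G] (n : ℕ) where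
  ρ : G →* Matrix.unitaryGroup (Fin n) ℂ
  continuous_ρ : Continuous ρ
  injective_ρ : Function.Injective ρ
  T : Subgroup G
  torus : IsMaximalTorus T
  B : Mat n →ₗ[ℝ] Mat n →ₗ[ℝ] ℝ
  basic : IsBasicInnerProduct ρ T B
  ℓ : Mat n →ₗ[ℝ] Mat n
  level : ∀ 𝔞 : Submodule ℝ (Mat n), IsSimpleIdeal (lieAlgOf ρ ⊤) 𝔞 →
    ∃ k : ℕ, 0 < k ∧ ∀ X ∈ 𝔞, ℓ X = (k : ℝ) • X
  ς : ℝ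
  half_lt_ς : 1 / 2 < ς

/-- The square root of the Sobolev weight `(1 + k²)^s`. -/
def weight (s : ℝ) (k : ℤ) : ℝ := (1 + (k : ℝ) ^ 2) ^ (s / 2)

/-- The Hilbertable space of matrix valued distributions of Sobolev class `s` on `S¹ = ℝ/ℤ`. An
element `b` stands for the distribution with Fourier coefficients `coef s b k`, i.e.
`b k = (1 + k²)^(s/2) • (k-th Fourier coefficient)` is square summable. -/
abbrev Sob (n : ℕ) : Type := lp (fun _ : ℤ => Mat n) 2

/-- The Fourier coefficients of the distribution of Sobolev class `s` given by `b`. -/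
def coef {n : ℕ} (s : ℝ) (b : Sob n) (k : ℤ) : Mat n := (weight s k)⁻¹ • b k

/-- The sequence `a` of Fourier coefficients belongs to an `𝔤`-valued distribution: the
coefficients of `cos (2πks)` and `sin (2πks)` lie in `𝔤`. -/
def IsLieValued {n : ℕ} (𝔤 : Submodule ℝ (Mat n)) (a : ℤ → Mat n) : Prop :=
  ∀ k, a k + a (-k) ∈ 𝔤 ∧ Complex.I • (a k - a (-k)) ∈ 𝔤

/-- `𝔤`-valued distributions on the circle of Sobolev class `s`. -/
def sobLie {n : ℕ} (𝔤 : Submodule ℝ (Mat n)) (s : ℝ) : Submodule ℝ (Sob n) where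
  carrier := {b | IsLieValued 𝔤 (coef s b)}
  zero_mem' := by
    intro k
    simp [coef]
  add_mem' := by
    intro a b ha hb k
    have e : ∀ j, coef s (a + b) j = coef s a j + coef s b j := by
      intro j
      simp [coef]
    rw [e, e]
    refine ⟨?_, ?_⟩
    · convert 𝔤.add_mem (ha k).1 (hb k).1 using 1
      abel
    · convert 𝔤.add_mem (ha k).2 (hb k).2 using 1
      rw [← smul_add]
      congr 1
      abel
  smul_mem' := by
    intro c a ha k
    have e : ∀ j, coef s (c • a) j = c • coef s a j := by
      intro j
      simp [coef, smul_comm c]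
    rw [e, e]
    refine ⟨?_, ?_⟩
    · rw [← smul_add]
      exact 𝔤.smul_mem c (ha k).1
    · rw [← smul_sub, smul_comm]
      exact 𝔤.smul_mem c (ha k).2

/-- The distribution as a function, for `s > 1/2`. -/
def evalAt {n : ℕ} (s : ℝ) (b : Sob n) (t : ℝ) : Mat n :=
  ∑' k : ℤ, (fourier k (t : UnitAddCircle) : ℂ) • coef s b k

lemma coef_single {n : ℕ} (s : ℝ) (A : Mat n) (k : ℤ) :
    coef s (lp.single 2 0 A : Sob n) k = if k = 0 then A else 0 := by
  by_cases h : k = 0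
  · subst h
    simp [coef, weight]
  · simp [coef, h]

lemma single_mem {n : ℕ} {𝔤 : Submodule ℝ (Mat n)} (s : ℝ) {A : Mat n} (hA : A ∈ 𝔤) :
    (lp.single 2 0 A : Sob n) ∈ sobLie 𝔤 s := by
  intro k
  rw [coef_single, coef_single]
  by_cases h : k = 0
  · subst h
    simpa using 𝔤.add_mem hA hA
  · simp [h]

/-- The pairing `∫ β(a(s), x(s)) ds` of two `𝔤`-valued distributions, through their Fourier
coefficients in the cosine and sine basis, for a real bilinear form `β`. -/
def pairing {n : ℕ} (β : Mat n →ₗ[ℝ] Mat n →ₗ[ℝ] ℝ) (a x : ℤ → Mat n) : ℝ :=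
  ∑' k : ℤ, (1 / 4 : ℝ) * (β (a k + a (-k)) (x k + x (-k)) +
    β (Complex.I • (a k - a (-k))) (Complex.I • (x k - x (-k))))

/-- The product `∑ⱼ aⱼ x_{k-j}` of Fourier series. -/
def conv {n : ℕ} (a x : ℤ → Mat n) (k : ℤ) : Mat n := ∑' j : ℤ, a j * x (k - j)

/-- The Fourier coefficients of the derivative `d/ds`. -/
def dcoef {n : ℕ} (a : ℤ → Mat n) (k : ℤ) : Mat n :=
  (2 * (Real.pi : ℂ) * Complex.I * (k : ℂ)) • a k

namespace LoopData

variable {G : Type*} [Group G] [TopologicalSpace G] [IsTopologicalGroup G]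
  [CompactSpace G] [SimplyConnectedSpace G] {n : ℕ} (D : LoopData G n)

/-- The matrix of a group element. -/
def mat (g : G) : Mat n := ((D.ρ g : Matrix.unitaryGroup (Fin n) ℂ) : Mat n)

/-- The Lie algebra `𝔤` of `G`. -/
def gAlg : Submodule ℝ (Mat n) := lieAlgOf D.ρ ⊤

/-- The Lie algebra `𝔱` of the maximal torus. -/
def tAlg : Submodule ℝ (Mat n) := lieAlgOf D.ρ D.T

lemma tAlg_le : D.tAlg ≤ D.gAlg := lieAlgOf_mono D.ρ le_top

/-- The orthogonal complement `𝔱^⊥` of `𝔱` in `𝔤`. -/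
def tPerp : Submodule ℝ (Mat n) where
  carrier := {w | w ∈ D.gAlg ∧ ∀ a ∈ D.tAlg, D.B a w = 0}
  zero_mem' := ⟨D.gAlg.zero_mem, fun a _ => by simp⟩
  add_mem' := fun {v w} hv hw =>
    ⟨D.gAlg.add_mem hv.1 hw.1, fun a ha => by simp [hv.2 a ha, hw.2 a ha]⟩
  smul_mem' := fun c v hv => ⟨D.gAlg.smul_mem c hv.1, fun a ha => by simp [hv.2 a ha]⟩

/-- The integral lattice `Π = ker (exp : 𝔱 → T)`. -/
def lattice : Set D.tAlg := {η | NormedSpace.exp (η : Mat n) = 1}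

/-- The Fourier coefficients of a loop in `G`. -/
def loopCoef (γ : C(UnitAddCircle, G)) (k : ℤ) : Mat n := fourierCoeff (fun t => D.mat (γ t)) k

/-- The loop group `LG`: the loops in `G` of Sobolev class `ς`. (As `ς > 1/2`, these are already
closed under products and inverses, so that `closure` adds nothing.) -/
def LG : Subgroup C(UnitAddCircle, G) :=
  Subgroup.closure {γ | Memℓp (fun k => weight D.ς k • D.loopCoef γ k) 2}

/-- The Lie algebra `L𝔤`: `𝔤`-valued functions on the circle of Sobolev class `ς`. -/
abbrev Lg : Type := sobLie D.gAlg D.ς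

/-- The dual `L𝔤^*`: `𝔤`-valued `1`-forms on the circle of Sobolev class `ς - 1`. -/
abbrev LgDual : Type := sobLie D.gAlg (D.ς - 1)

/-- A constant `𝔱`-valued function. -/
def constFun (a : D.tAlg) : D.Lg := ⟨lp.single 2 0 (a : Mat n), single_mem _ (D.tAlg_le a.2)⟩

/-- A constant `𝔱`-valued `1`-form. -/
def constForm (a : D.tAlg) : D.LgDual :=
  ⟨lp.single 2 0 (a : Mat n), single_mem _ (D.tAlg_le a.2)⟩

open Classical in
/-- The element of `LG` with matrix `f s` at `s mod 1` (and `1` if there is none). -/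
def loopOf (f : ℝ → Mat n) : D.LG :=
  if h : ∃ γ : D.LG, ∀ s : ℝ, D.mat (γ.1 (s : UnitAddCircle)) = f s then h.choose else 1

/-- The exponential map `L𝔤 → LG`. -/
def expLoop (ξ : D.Lg) : D.LG := D.loopOf fun s => NormedSpace.exp (evalAt D.ς ξ.1 s)

/-- The constant loop at `g`. -/
def constLoop (g : G) : D.LG := D.loopOf fun _ => D.mat g

/-- The loop `s ↦ exp (-s η)` by which `η ∈ Π` is regarded as an element of `LG`. -/
def latticeLoop (η : D.tAlg) : D.LG := D.loopOf fun s => NormedSpace.exp (-s • (η : Mat n))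

/-- The based loop group `ΩG ⊆ LG`. -/
def OmegaG : Set D.LG := {γ | γ.1 0 = 1}

/-- `b = γ · a = Ad_γ a - dγ γ⁻¹` (gauge action), written as `b γ = γ a - dγ`. -/
def IsGauge (γ : D.LG) (a b : D.LgDual) : Prop :=
  ∀ k, conv (coef (D.ς - 1) b.1) (D.loopCoef γ.1) k =
    conv (D.loopCoef γ.1) (coef (D.ς - 1) a.1) k - dcoef (D.loopCoef γ.1) k

/-- `a = γ⁻¹ dγ`, written as `γ a = dγ`. -/
def IsLogDeriv (γ : D.LG) (a : D.LgDual) : Prop :=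
  ∀ k, conv (D.loopCoef γ.1) (coef (D.ς - 1) a.1) k = dcoef (D.loopCoef γ.1) k

/-- `ζ = Ad_γ ξ`. -/
def IsAd (γ : D.LG) (ξ ζ : D.Lg) : Prop :=
  ∀ s : ℝ, evalAt D.ς ζ.1 s =
    D.mat (γ.1 (s : UnitAddCircle)) * evalAt D.ς ξ.1 s * D.mat (γ.1 (s : UnitAddCircle))⁻¹

end LoopData

variable {G : Type*} [Group G] [TopologicalSpace G] [IsTopologicalGroup G]
  [CompactSpace G] [SimplyConnectedSpace G] {n : ℕ} (D : LoopData G n)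

/-! ### Hamiltonian loop group spaces -/

section Spaces

variable {E : Type*} [NormedAddCommGroup E] [NormedSpace ℝ E]
  {N : Type*} [TopologicalSpace N] [ChartedSpace E N] [MulAction D.LG N]

/-- The action of the Banach Lie group `LG` on the Banach manifold `N` is smooth: each element of
the group acts smoothly, and the action is smooth in the exponential coordinates of `LG`. -/
structure IsSmoothAction (E : Type*) [NormedAddCommGroup E] [NormedSpace ℝ E]
    (N : Type*) [TopologicalSpace N] [ChartedSpace E N] [MulAction D.LG N] : Prop where
  smooth_smul : ∀ γ : D.LG, ContMDiff 𝓘(ℝ, E) 𝓘(ℝ, E) ∞ (fun x : N => γ • x)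
  smooth_exp : ContMDiff (𝓘(ℝ, D.Lg).prod 𝓘(ℝ, E)) 𝓘(ℝ, E) ∞
    (fun p : D.Lg × N => D.expLoop p.1 • p.2)

/-- The vector field `ξ_N(x) = d/du|₀ exp(-u ξ) · x` generated by `ξ ∈ L𝔤`. -/
def generator (ξ : D.Lg) (x : N) : TangentSpace 𝓘(ℝ, E) x :=
  (mfderiv 𝓘(ℝ, ℝ) 𝓘(ℝ, E) (fun u : ℝ => D.expLoop (-(u • ξ)) • x) 0 (1 : ℝ) : E)

/-- The differential of the action of `γ` at `x`. -/
def dAct (γ : D.LG) (x : N) : TangentSpace 𝓘(ℝ, E) x →L[ℝ] TangentSpace 𝓘(ℝ, E) (γ • x) :=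
  mfderiv 𝓘(ℝ, E) 𝓘(ℝ, E) (fun y : N => γ • y) x

/-- The coordinate expression of the two-form `form` in the chart around `x₀`. -/
def inChart (form : ∀ x : N, TangentSpace 𝓘(ℝ, E) x →L[ℝ] TangentSpace 𝓘(ℝ, E) x →L[ℝ] ℝ)
    (x₀ : N) (y v w : E) : ℝ :=
  form ((extChartAt 𝓘(ℝ, E) x₀).symm y)
    (mfderiv 𝓘(ℝ, E) 𝓘(ℝ, E) (extChartAt 𝓘(ℝ, E) x₀).symm y v)
    (mfderiv 𝓘(ℝ, E) 𝓘(ℝ, E) (extChartAt 𝓘(ℝ, E) x₀).symm y w)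

/-- A proper Hamiltonian `LG`-space: a smooth action, an invariant weakly symplectic `form`, and
a proper equivariant moment map `μ : N → L𝔤^*` with `ι(ξ_N) form = -d⟨μ, ξ⟩`. -/
structure HamiltonianSpace (E : Type*) [NormedAddCommGroup E] [NormedSpace ℝ E]
    (N : Type*) [TopologicalSpace N] [ChartedSpace E N] [IsManifold 𝓘(ℝ, E) ∞ N]
    [MulAction D.LG N] where
  smooth_action : IsSmoothAction D E N
  form : ∀ x : N, TangentSpace 𝓘(ℝ, E) x →L[ℝ] TangentSpace 𝓘(ℝ, E) x →L[ℝ] ℝ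
  smooth_form : ContMDiff 𝓘(ℝ, E) (𝓘(ℝ, E).prod 𝓘(ℝ, E →L[ℝ] E →L[ℝ] ℝ)) ∞
    (fun x => TotalSpace.mk' (E →L[ℝ] E →L[ℝ] ℝ) (E := fun x : N =>
      TangentSpace 𝓘(ℝ, E) x →L[ℝ] TangentSpace 𝓘(ℝ, E) x →L[ℝ] ℝ) x (form x))
  alternating : ∀ x v, form x v v = 0
  nondegenerate : ∀ x v, (∀ w, form x v w = 0) → v = 0
  closed : ∀ x₀ : N, ∀ y ∈ (extChartAt 𝓘(ℝ, E) x₀).target, ∀ u v w : E,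
    fderiv ℝ (fun z => inChart form x₀ z v w) y u + fderiv ℝ (fun z => inChart form x₀ z w u) y v +
      fderiv ℝ (fun z => inChart form x₀ z u v) y w = 0
  invariant_form : ∀ (γ : D.LG) (x : N) v w, form (γ • x) (dAct D γ x v) (dAct D γ x w) = form x v w
  μ : N → D.LgDual
  smooth_μ : ContMDiff 𝓘(ℝ, E) 𝓘(ℝ, D.LgDual) ∞ μ
  proper_μ : IsProperMap μ
  equivariant_μ : ∀ (γ : D.LG) (x : N), D.IsGauge γ (μ x) (μ (γ • x))
  moment : ∀ (ξ : D.Lg) (x : N) (v : TangentSpace 𝓘(ℝ, E) x),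
    form x (generator D ξ x) v = -(mfderiv 𝓘(ℝ, E) 𝓘(ℝ, ℝ)
      (fun y => pairing D.B (coef (D.ς - 1) (μ y).1) (coef D.ς ξ.1)) x v : ℝ)

/-- The quotient manifold `M = N/ΩG` of dimension `d`, with its quotient map `hol`, and a
`G`-invariant Riemannian metric on it. -/
structure QuotientSpace (E : Type*) [NormedAddCommGroup E] [NormedSpace ℝ E]
    (N : Type*) [TopologicalSpace N] [ChartedSpace E N] [MulAction D.LG N] (d : ℕ)
    (M : Type*) [TopologicalSpace M] [ChartedSpace (EuclideanSpace ℝ (Fin d)) M]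
    [IsManifold 𝓘(ℝ, EuclideanSpace ℝ (Fin d)) ∞ M] where
  hol : N → M
  surjective : Function.Surjective hol
  submersion : IsSubmersion 𝓘(ℝ, E) 𝓘(ℝ, EuclideanSpace ℝ (Fin d)) ∞ hol
  fibre : ∀ x y : N, hol x = hol y ↔ ∃ γ ∈ D.OmegaG, y = γ • x
  g : ContMDiffRiemannianMetric 𝓘(ℝ, EuclideanSpace ℝ (Fin d)) ∞ (EuclideanSpace ℝ (Fin d))
    (TangentSpace 𝓘(ℝ, EuclideanSpace ℝ (Fin d)) : M → Type _)
  invariant_g : ∀ (c : G) (x : N) (v w : TangentSpace 𝓘(ℝ, E) x),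
    g.inner (hol (D.constLoop c • x))
      (mfderiv 𝓘(ℝ, E) 𝓘(ℝ, EuclideanSpace ℝ (Fin d)) hol (D.constLoop c • x)
        (dAct D (D.constLoop c) x v))
      (mfderiv 𝓘(ℝ, E) 𝓘(ℝ, EuclideanSpace ℝ (Fin d)) hol (D.constLoop c • x)
        (dAct D (D.constLoop c) x w)) =
    g.inner (hol x) (mfderiv 𝓘(ℝ, E) 𝓘(ℝ, EuclideanSpace ℝ (Fin d)) hol x v)
      (mfderiv 𝓘(ℝ, E) 𝓘(ℝ, EuclideanSpace ℝ (Fin d)) hol x w)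

end Spaces

/-! ### Central extensions and bundles at a level -/

/-- The level `ℓ` central extension `U(1) → Γ → LG`. Its Lie algebra is `L𝔤 ⊕ iℝ`; `lift ξ` is the
exponential of `(ξ, 0)`, and the adjoint action is
`Ad_γ (ξ, 0) = (Ad_γ ξ, 2πi ∫ ℓ(γ⁻¹ dγ) · ξ)`, the integrated form of the Lie algebra cocycle
`2πi ∫ ℓ dξ₁ · ξ₂`. The extension is smooth: in exponential coordinates its multiplication is
given near the identity by a smooth `ℝ/ℤ`-valued cocycle `θ`. -/
structure CentralExtension (Γ : Type*) [Group Γ] where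
  proj : Γ →* D.LG
  proj_surjective : Function.Surjective proj
  ι : Circle →* Γ
  ι_injective : Function.Injective ι
  ι_range : ∀ g, proj g = 1 ↔ ∃ z, ι z = g
  central : ∀ z g, ι z * g = g * ι z
  lift : D.Lg → Γ
  proj_lift : ∀ ξ, proj (lift ξ) = D.expLoop ξ
  lift_add : ∀ (ξ : D.Lg) (s t : ℝ), lift ((s + t) • ξ) = lift (s • ξ) * lift (t • ξ)
  adjoint : ∀ (g : Γ) (ξ ζ : D.Lg) (a : D.LgDual), D.IsAd (proj g) ξ ζ →
    D.IsLogDeriv (proj g) a → g * lift ξ * g⁻¹ = lift ζ *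
      ι (Circle.exp (2 * Real.pi *
        pairing (D.B ∘ₗ D.ℓ) (coef (D.ς - 1) a.1) (coef D.ς ξ.1)))
  smooth : ∃ O ∈ 𝓝 (0 : D.Lg), ∃ θ : D.Lg × D.Lg → ℝ, ContDiffOn ℝ ∞ θ (O ×ˢ O) ∧
    ∀ ξ₁ ∈ O, ∀ ξ₂ ∈ O, ∀ ξ₃ ∈ O, D.expLoop ξ₁ * D.expLoop ξ₂ = D.expLoop ξ₃ →
      lift ξ₁ * lift ξ₂ = lift ξ₃ * ι (Circle.exp (2 * Real.pi * θ (ξ₁, ξ₂)))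

section Bundles

variable {D}
variable {E : Type*} [NormedAddCommGroup E] [NormedSpace ℝ E]
  {N : Type*} [TopologicalSpace N] [ChartedSpace E N] [MulAction D.LG N]
  {Γ : Type*} [Group Γ] (Λ : CentralExtension D Γ)

/-- A smooth unitary action of the central extension `Γ` on the Hermitian vector bundle `S` over
`N`, covering the action of `LG` and linear on the fibres, in which the central circle acts by
the `w`-th power of scalar multiplication (so `S` is at level `w ℓ`). -/
structure LevelAction (w : ℕ) (E : Type*) [NormedAddCommGroup E] [NormedSpace ℝ E]
    {N : Type*} [TopologicalSpace N] [ChartedSpace E N] [MulAction D.LG N]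
    (F : Type*) [NormedAddCommGroup F] [NormedSpace ℝ F] (S : N → Type*)
    [TopologicalSpace (TotalSpace F S)] [∀ x, NormedAddCommGroup (S x)]
    [∀ x, InnerProductSpace ℂ (S x)] [FiberBundle F S] where
  act : ∀ (g : Γ) (x : N), S x →ₗ[ℂ] S (Λ.proj g • x)
  act_one : ∀ (x : N) (v : S x), TotalSpace.mk' F (Λ.proj 1 • x) (act 1 x v) = TotalSpace.mk' F x v
  act_mul : ∀ (g h : Γ) (x : N) (v : S x),
    TotalSpace.mk' F (Λ.proj (g * h) • x) (act (g * h) x v) =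
      TotalSpace.mk' F (Λ.proj g • Λ.proj h • x) (act g (Λ.proj h • x) (act h x v))
  act_ι : ∀ (z : Circle) (x : N) (v : S x),
    TotalSpace.mk' F (Λ.proj (Λ.ι z) • x) (act (Λ.ι z) x v) =
      TotalSpace.mk' F x ((z : ℂ) ^ w • v)
  smooth_metric : ContMDiff (𝓘(ℝ, E).prod 𝓘(ℝ, F)) 𝓘(ℝ, ℝ) ∞
    (fun p : TotalSpace F S => ‖p.2‖ ^ 2)
  norm_act : ∀ (g : Γ) (x : N) (v : S x), ‖act g x v‖ = ‖v‖
  smooth_act : ∀ g : Γ, ContMDiff (𝓘(ℝ, E).prod 𝓘(ℝ, F)) (𝓘(ℝ, E).prod 𝓘(ℝ, F)) ∞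
    (fun p : TotalSpace F S => TotalSpace.mk' F (Λ.proj g • p.1) (act g p.1 p.2))
  smooth_exp : ContMDiff (𝓘(ℝ, D.Lg).prod (𝓘(ℝ, E).prod 𝓘(ℝ, F))) (𝓘(ℝ, E).prod 𝓘(ℝ, F)) ∞
    (fun p : D.Lg × TotalSpace F S => TotalSpace.mk' F (Λ.proj (Λ.lift p.1) • p.2.1)
      (act (Λ.lift p.1) p.2.1 p.2.2))

/-- The model fibre of a spinor bundle of a bundle of rank `2k`. -/
abbrev SpinorFibre (k : ℕ) : Type := EuclideanSpace ℂ (Fin (2 ^ k))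

/-- The structure of a level `ℓ` spinor bundle for `hol^* TM` on a Hermitian vector bundle `S` of
rank `2^k`, where `dim M = 2k`: a `ℤ/2`-grading `ε`, an odd, skew-adjoint Clifford multiplication
`c` with `c(v)² = -|v|²` (by the rank this is the same as a `*`-isomorphism of the complex
Clifford algebra bundle with `End S`), and a level `ℓ` action preserving both. -/
structure SpinorBundle {k : ℕ} {M : Type*} [TopologicalSpace M]
    [ChartedSpace (EuclideanSpace ℝ (Fin (2 * k))) M]
    [IsManifold 𝓘(ℝ, EuclideanSpace ℝ (Fin (2 * k))) ∞ M]
    (Q : QuotientSpace D E N (2 * k) M) (S : N → Type*)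
    [TopologicalSpace (TotalSpace (SpinorFibre k) S)] [∀ x, NormedAddCommGroup (S x)]
    [∀ x, InnerProductSpace ℂ (S x)] [FiberBundle (SpinorFibre k) S]
    extends LevelAction Λ 1 E (SpinorFibre k) S where
  ε : ∀ x, S x →ₗ[ℂ] S x
  ε_sq : ∀ x s, ε x (ε x s) = s
  ε_symm : ∀ x s t, inner ℂ (ε x s) t = inner ℂ s (ε x t)
  smooth_ε : ContMDiff (𝓘(ℝ, E).prod 𝓘(ℝ, SpinorFibre k)) (𝓘(ℝ, E).prod 𝓘(ℝ, SpinorFibre k)) ∞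
    (fun p : TotalSpace (SpinorFibre k) S => TotalSpace.mk' (SpinorFibre k) p.1 (ε p.1 p.2))
  c : ∀ x, TangentSpace 𝓘(ℝ, EuclideanSpace ℝ (Fin (2 * k))) (Q.hol x) →ₗ[ℝ] S x →ₗ[ℂ] S x
  c_sq : ∀ x v s, c x v (c x v s) = -((Q.g.inner (Q.hol x) v v : ℝ) : ℂ) • s
  c_skew : ∀ x v s t, inner ℂ (c x v s) t = -inner ℂ s (c x v t)
  c_odd : ∀ x v s, ε x (c x v s) = -c x v (ε x s)
  smooth_c : ∀ (O : Set M) (Y : ∀ y : M, TangentSpace 𝓘(ℝ, EuclideanSpace ℝ (Fin (2 * k))) y),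
    IsOpen O →
    ContMDiffOn 𝓘(ℝ, EuclideanSpace ℝ (Fin (2 * k)))
      (𝓘(ℝ, EuclideanSpace ℝ (Fin (2 * k))).prod 𝓘(ℝ, EuclideanSpace ℝ (Fin (2 * k)))) ∞
      (fun y => TotalSpace.mk' (EuclideanSpace ℝ (Fin (2 * k))) y (Y y)) O →
    ContMDiffOn (𝓘(ℝ, E).prod 𝓘(ℝ, SpinorFibre k)) (𝓘(ℝ, E).prod 𝓘(ℝ, SpinorFibre k)) ∞
      (fun p : TotalSpace (SpinorFibre k) S =>
        TotalSpace.mk' (SpinorFibre k) p.1 (c p.1 (Y (Q.hol p.1)) p.2))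
      {p | Q.hol p.1 ∈ O}
  equivariant_ε : ∀ (g : Γ) x s, act g x (ε x s) = ε (Λ.proj g • x) (act g x s)
  equivariant_c : ∀ (g : Γ) (x : N) (v : TangentSpace 𝓘(ℝ, E) x) (s : S x),
    act g x (c x (mfderiv 𝓘(ℝ, E) 𝓘(ℝ, EuclideanSpace ℝ (Fin (2 * k))) Q.hol x v) s) =
      c (Λ.proj g • x) (mfderiv 𝓘(ℝ, E) 𝓘(ℝ, EuclideanSpace ℝ (Fin (2 * k))) Q.hol (Λ.proj g • x)
        (dAct D (Λ.proj g) x v)) (act g x s)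

/-- The Hermitian line bundle `L` is the anti-canonical line bundle `Hom_{Cl}(S^*, S)` of the
spinor bundle `S`: the fibre of `L` is identified by `Φ`, smoothly, isometrically and
equivariantly, with the linear maps `S_x^* → S_x` that commute with the Clifford action, where
`v` acts on `S_x^*` by `f ↦ -f ∘ c(v)`. In particular `L` is at level `2ℓ`. -/
structure AnticanonicalBundle {k : ℕ} {M : Type*} [TopologicalSpace M]
    [ChartedSpace (EuclideanSpace ℝ (Fin (2 * k))) M]
    [IsManifold 𝓘(ℝ, EuclideanSpace ℝ (Fin (2 * k))) ∞ M]
    {Q : QuotientSpace D E N (2 * k) M} {S : N → Type*}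
    [TopologicalSpace (TotalSpace (SpinorFibre k) S)] [∀ x, NormedAddCommGroup (S x)]
    [∀ x, InnerProductSpace ℂ (S x)] [FiberBundle (SpinorFibre k) S]
    (𝓢 : SpinorBundle Λ Q S) (L : N → Type*)
    [TopologicalSpace (TotalSpace ℂ L)] [∀ x, NormedAddCommGroup (L x)]
    [∀ x, InnerProductSpace ℂ (L x)] [FiberBundle ℂ L]
    extends LevelAction Λ 2 E ℂ L where
  Φ : ∀ x, L x →ₗ[ℂ] (Module.Dual ℂ (S x) →ₗ[ℂ] S x)
  Φ_injective : ∀ x, Function.Injective (Φ x)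
  Φ_range : ∀ x (h : Module.Dual ℂ (S x) →ₗ[ℂ] S x), (∃ l, Φ x l = h) ↔
    ∀ v f, h (-(f ∘ₗ 𝓢.c x v)) = 𝓢.c x v (h f)
  norm_Φ : ∀ x (l : L x) (t : S x), ‖Φ x l (innerₛₗ ℂ t)‖ = ‖l‖ * ‖t‖
  smooth_Φ : ∀ (O : Set N) (σ : ∀ x, L x), IsOpen O →
    ContMDiffOn 𝓘(ℝ, E) (𝓘(ℝ, E).prod 𝓘(ℝ, ℂ)) ∞ (fun x => TotalSpace.mk' ℂ x (σ x)) O →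
    ContMDiffOn (𝓘(ℝ, E).prod 𝓘(ℝ, SpinorFibre k)) (𝓘(ℝ, E).prod 𝓘(ℝ, SpinorFibre k)) ∞
      (fun p : TotalSpace (SpinorFibre k) S =>
        TotalSpace.mk' (SpinorFibre k) p.1 (Φ p.1 (σ p.1) (innerₛₗ ℂ p.2)))
      {p | p.1 ∈ O}
  equivariant_Φ : ∀ (g : Γ) x (l : L x) (f : Module.Dual ℂ (S (Λ.proj g • x))),
    Φ (Λ.proj g • x) (act g x l) f = 𝓢.act g x (Φ x l (f ∘ₗ 𝓢.act g x))

section Connection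

variable {L : N → Type*} [TopologicalSpace (TotalSpace ℂ L)] [∀ x, NormedAddCommGroup (L x)]
    [∀ x, InnerProductSpace ℂ (L x)] [FiberBundle ℂ L]

/-- `∇` is a smooth Hermitian connection on the complex line bundle `L`, invariant under `Γ`. -/
structure IsInvariantHermitianConnection [VectorBundle ℝ ℂ L] [IsManifold 𝓘(ℝ, E) ∞ N]
    (𝓛 : LevelAction Λ 2 E ℂ L) (nabla : CovariantDerivative 𝓘(ℝ, E) ℂ L) : Prop where
  smooth : ∀ O : Set N, IsOpen O → ContMDiffCovariantDerivativeOn ℂ ∞ nabla.toFun O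
  complex_linear : ∀ (σ : ∀ x, L x) (x : N),
    MDifferentiableAt 𝓘(ℝ, E) (𝓘(ℝ, E).prod 𝓘(ℝ, ℂ)) (fun y => TotalSpace.mk' ℂ y (σ y)) x →
    ∀ v, nabla.toFun (fun y => Complex.I • σ y) x v = Complex.I • nabla.toFun σ x v
  hermitian : ∀ (σ τ : ∀ x, L x) (x : N),
    MDifferentiableAt 𝓘(ℝ, E) (𝓘(ℝ, E).prod 𝓘(ℝ, ℂ)) (fun y => TotalSpace.mk' ℂ y (σ y)) x →
    MDifferentiableAt 𝓘(ℝ, E) (𝓘(ℝ, E).prod 𝓘(ℝ, ℂ)) (fun y => TotalSpace.mk' ℂ y (τ y)) x →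
    ∀ v, (mfderiv 𝓘(ℝ, E) 𝓘(ℝ, ℂ) (fun y => (inner ℂ (σ y) (τ y) : ℂ)) x v : ℂ) =
      inner ℂ (nabla.toFun σ x v) (τ x) + inner ℂ (σ x) (nabla.toFun τ x v)
  invariant : ∀ (g : Γ) (σ τ : ∀ x, L x) (x : N),
    MDifferentiableAt 𝓘(ℝ, E) (𝓘(ℝ, E).prod 𝓘(ℝ, ℂ)) (fun y => TotalSpace.mk' ℂ y (σ y)) x →
    (∀ y, τ (Λ.proj g • y) = 𝓛.act g y (σ y)) →
    ∀ v, nabla.toFun τ (Λ.proj g • x) (dAct D (Λ.proj g) x v) = 𝓛.act g x (nabla.toFun σ x v)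

/-- `r` is the value at `x` of the `ξ`-component of the `Spin_c` moment map `φ_N`, i.e.
`2πi ⟨φ_N, ξ⟩ = (1/2) (𝓛_ξ - ∇_{ξ_N})` at `x`, where the Lie derivative of a section `σ` is
`(𝓛_ξ σ)(x) = d/du|₀ exp(u ξ) · σ(exp(-u ξ) x)`. The curve in the fibre over `x` that is
differentiated here is called `w`. -/
def IsMomentValue (𝓛 : LevelAction Λ 2 E ℂ L) (nabla : CovariantDerivative 𝓘(ℝ, E) ℂ L)
    (ξ : D.Lg) (x : N) (r : ℝ) : Prop :=
  ∀ (σ : ∀ y, L y) (w : ℝ → L x),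
    MDifferentiableAt 𝓘(ℝ, E) (𝓘(ℝ, E).prod 𝓘(ℝ, ℂ)) (fun y => TotalSpace.mk' ℂ y (σ y)) x →
    (∀ u : ℝ, TotalSpace.mk' ℂ x (w u) =
      TotalSpace.mk' ℂ (Λ.proj (Λ.lift (u • ξ)) • D.expLoop (-(u • ξ)) • x)
        (𝓛.act (Λ.lift (u • ξ)) _ (σ (D.expLoop (-(u • ξ)) • x)))) →
    HasDerivAt w (nabla.toFun σ x (generator D ξ x) +
      (4 * (Real.pi : ℂ) * Complex.I * (r : ℂ)) • σ x) 0

/-- `φ` is the `Spin_c` moment map followed by the projection `L𝔤^* → 𝔱`, which is dual to the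
inclusion of `𝔱` in `L𝔤` as constant functions. -/
def IsSpincMoment (𝓛 : LevelAction Λ 2 E ℂ L) (nabla : CovariantDerivative 𝓘(ℝ, E) ℂ L)
    (φ : N → D.tAlg) : Prop :=
  ∀ (x : N) (ξ : D.tAlg), IsMomentValue Λ 𝓛 nabla (D.constFun ξ) x (D.B (φ x) ξ)

end Connection

end Bundles

/-! ### Global transversals and the Kirwan vector field -/

/-- A thickening `R` of `𝔱 ⊆ L𝔤^*`: an `N(T) ⋉ Π`-equivariant embedding `j` of
`𝔱 × {w ∈ 𝔱^⊥ : |w| ≤ ε}` in `L𝔤^*`, extending the inclusion of `𝔱`, with image in the smooth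
`1`-forms, transverse to the `ΩG`-orbits, and meeting each `ΩG`-orbit in one `Π`-orbit or not at
all. -/
structure Thickening where
  ε : ℝ
  ε_pos : 0 < ε
  j : D.tAlg × D.tPerp → D.LgDual
  smooth : ContDiffOn ℝ ∞ j {p | D.B p.2 p.2 ≤ ε ^ 2}
  embedding : IsEmbedding (Set.domRestrict {p : D.tAlg × D.tPerp | D.B p.2 p.2 ≤ ε ^ 2} j)
  immersion : ∀ p : D.tAlg × D.tPerp, D.B p.2 p.2 ≤ ε ^ 2 →
    Function.Injective (fderivWithin ℝ j {p | D.B p.2 p.2 ≤ ε ^ 2} p)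
  extends_inclusion : ∀ a : D.tAlg, j (a, 0) = D.constForm a
  equivariant_normalizer : ∀ g ∈ Subgroup.normalizer (D.T : Set G),
    ∀ p q : D.tAlg × D.tPerp, D.B p.2 p.2 ≤ ε ^ 2 →
    (q.1 : Mat n) = D.mat g * p.1 * D.mat g⁻¹ → (q.2 : Mat n) = D.mat g * p.2 * D.mat g⁻¹ →
    D.IsGauge (D.constLoop g) (j p) (j q)
  equivariant_lattice : ∀ η ∈ D.lattice, ∀ (a : D.tAlg) (w : D.tPerp), D.B w w ≤ ε ^ 2 →
    D.IsGauge (D.latticeLoop η) (j (a, w)) (j (a + η, w))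
  smooth_forms : ∀ p : D.tAlg × D.tPerp, D.B p.2 p.2 ≤ ε ^ 2 →
    ∀ s : ℝ, Memℓp (fun k => weight s k • coef (D.ς - 1) (j p).1 k) 2
  transverse : ∀ p : D.tAlg × D.tPerp, D.B p.2 p.2 ≤ ε ^ 2 → ∀ b : D.LgDual,
    ∃ (v : D.tAlg × D.tPerp) (ζ : D.Lg), evalAt D.ς ζ.1 0 = 0 ∧
      ∀ k, coef (D.ς - 1) b.1 k =
        coef (D.ς - 1) (fderivWithin ℝ j {p | D.B p.2 p.2 ≤ ε ^ 2} p v).1 k +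
        (dcoef (coef D.ς ζ.1) k + conv (coef (D.ς - 1) (j p).1) (coef D.ς ζ.1) k -
          conv (coef D.ς ζ.1) (coef (D.ς - 1) (j p).1) k)
  orbit : ∀ p q : D.tAlg × D.tPerp, D.B p.2 p.2 ≤ ε ^ 2 → D.B q.2 q.2 ≤ ε ^ 2 →
    ((∃ γ ∈ D.OmegaG, D.IsGauge γ (j p) (j q)) ↔
      ∃ η ∈ D.lattice, q.1 = p.1 + η ∧ q.2 = p.2)

variable {D}

/-- The image of a thickening. -/
def Thickening.R (t : Thickening D) : Set D.LgDual := t.j '' {p | D.B p.2 p.2 ≤ t.ε ^ 2}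

section Kirwan

variable {E : Type*} [NormedAddCommGroup E] [NormedSpace ℝ E]
  {N : Type*} [TopologicalSpace N] [ChartedSpace E N] [IsManifold 𝓘(ℝ, E) ∞ N]
  [MulAction D.LG N]

/-- The global transversal `X = μ⁻¹(R)`. -/
def transversal (𝓗 : HamiltonianSpace D E N) (t : Thickening D) : Set N := 𝓗.μ ⁻¹' t.R

variable (E) in
/-- The `Spin_c` Kirwan vector field `κ(x) = φ(x)_X(x)`. -/
def kirwan (φ : N → D.tAlg) (x : N) : TangentSpace 𝓘(ℝ, E) x := generator D (D.constFun (φ x)) x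

/-- The length of a tangent vector of the transversal in the pull-back of the Riemannian metric of
`M` by `hol`. -/
def length {d : ℕ} {M : Type*} [TopologicalSpace M] [ChartedSpace (EuclideanSpace ℝ (Fin d)) M]
    [IsManifold 𝓘(ℝ, EuclideanSpace ℝ (Fin d)) ∞ M] (Q : QuotientSpace D E N d M)
    (x : N) (v : TangentSpace 𝓘(ℝ, E) x) : ℝ :=
  √(Q.g.inner (Q.hol x) (mfderiv 𝓘(ℝ, E) 𝓘(ℝ, EuclideanSpace ℝ (Fin d)) Q.hol x v)
    (mfderiv 𝓘(ℝ, E) 𝓘(ℝ, EuclideanSpace ℝ (Fin d)) Q.hol x v))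

variable (E) in
/-- `𝒵_β = X^β ∩ φ⁻¹(β)`, with `X^β` the zero set of the vector field generated by `β`. -/
def ZSet (X : Set N) (φ : N → D.tAlg) (β : D.tAlg) : Set N :=
  {x ∈ X | (generator D (D.constFun β) x : TangentSpace 𝓘(ℝ, E) x) = 0 ∧ φ x = β}

variable (E) in
/-- The set `ℬ` of all `β ∈ 𝔱` with `𝒵_β` non-empty. -/
def BSet (X : Set N) (φ : N → D.tAlg) : Set D.tAlg := {β | (ZSet E X φ β).Nonempty}

variable (E) in
/-- `ℬ_* ⊆ ℬ` is minimal among the subsets of `ℬ` such that each `𝒵_β` is a `Π`-translate of some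
`𝒵_{β_*}`, `β_* ∈ ℬ_*`. -/
def IsRepresentatives (X : Set N) (φ : N → D.tAlg) (Bstar : Set D.tAlg) : Prop :=
  Minimal (fun s : Set D.tAlg => s ⊆ BSet E X φ ∧ ∀ β ∈ BSet E X φ, ∃ β' ∈ s, ∃ η ∈ D.lattice,
    ZSet E X φ β = D.latticeLoop η • ZSet E X φ β') Bstar

/-- `V` is a `T`-invariant open subset of `X`, containing `Z`. -/
structure IsInvariantNhd (X Z V : Set N) : Prop where
  isOpen : ∃ O : Set N, IsOpen O ∧ V = O ∩ X
  invariant : ∀ g ∈ D.T, D.constLoop g • V = V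
  subset : Z ⊆ V

variable (E) in
/-- The neighborhood `𝒰 = ⋃_{β ∈ ℬ} 𝒰_β` of `𝒵`, where `𝒰_β = η · 𝒰_{β_*}` if
`𝒵_β = η · 𝒵_{β_*}`, `η ∈ Π`, `β_* ∈ ℬ_*`. -/
def USet (X : Set N) (φ : N → D.tAlg) (Bstar : Set D.tAlg) (U : D.tAlg → Set N) : Set N :=
  {x | ∃ β ∈ BSet E X φ, ∃ β' ∈ Bstar, ∃ η ∈ D.lattice,
    ZSet E X φ β = D.latticeLoop η • ZSet E X φ β' ∧ x ∈ D.latticeLoop η • U β'}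

end Kirwan

end LoopKirwan

end

/-! ### Closed subgroups of a finite dimensional vector space and their linear parts. -/

noncomputable section

namespace LoopKirwan

section ClosedSubgroups

variable {V : Type*} [NormedAddCommGroup V] [NormedSpace ℝ V]

/-! Suppose that `κ` becomes arbitrarily short along points `x_k` of `X` outside `𝒰`. Properness of
`μ` and cocompactness of `Π` in `𝔱` give a compact `K ⊆ X` whose `Π`-translates cover `X`
(`exists_compact_fundamental_transversal`), so `x_k = η_k · y_k` with `y_k → z` in `K`. As `Π` acts
trivially on `M`, the length of `κ(x_k)` is the length at `hol y_k` of the vector field on `M`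
generated by `φ(x_k)` (`length_kirwan`). The difficulty is that the `φ(x_k)` may be unbounded:
`φ(x_k) = φ(y_k) + v_k`, where `v_k` pairs with `𝔱` as `ℓ η_k` does (`moment_latticeLoop_smul`). Two
facts about torus actions overcome it.

Rationality. Let `𝔱_z` be the stabilizer algebra of `hol z`. If a generated field is short at a
point near `hol z`, its generator is close to `𝔱_z`, however large it is (`exists_nhds_infDist_lt`).
Hence the distance of `φ(z) + v_k` from `𝔱_z` tends to zero. Now `𝔱_z` is spanned by lattice
vectors, and the `v_k` pair integrally with `Π` because the central extension exists
(`exists_int_eq`). Modulo `Π ∩ 𝔱_z` the `v_k` thus range in a discrete set, the limit is attained,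
and `φ(z) + v_k ∈ 𝔱_z` for most `k` (`eventually_add_mem_lineSubmodule`). Stabilizer algebras in `X`
and in `M` agree since `ΩG` acts freely (`stabAlg_hol`), so `η_k · z` lies in `𝒵_β` for `β = φ(z) +
v_k`.

Finiteness. Linearizing the action near fixed points shows that only finitely many stabilizer
algebras occur over `K`, hence over `X` (`finite_stabAlg_image`). For most `k` the vectors `φ(z) +
v_k` therefore lie in exactly the same ones, and the corresponding sets `𝒵_β` are translates of each
other by differences of the `η_k`. All of them are then translates of a single representative
`𝒵_{β'}`. A fixed translate of `z` lies in the open `𝒰_{β'}`, so the same translate of `y_k` does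
for most `k`, which puts `x_k` in `𝒰`, a contradiction.

The continuity of `φ` needed for this comes from the line bundle and its connection
(`continuous_moment`); `exists_le_length_kirwan` assembles the argument. -/

/-- The largest linear subspace contained in an additive subgroup. -/
def lineSubmodule (P : AddSubgroup V) : Submodule ℝ V where
  carrier := {v | ∀ u : ℝ, u • v ∈ P}
  zero_mem' := fun u => by simp [P.zero_mem]
  add_mem' := fun {a b} ha hb u => by
    rw [smul_add]
    exact P.add_mem (ha u) (hb u)
  smul_mem' := fun c v hv u => by
    rw [smul_smul]
    exact hv (u * c)

lemma lineSubmodule_le {P : AddSubgroup V} {v : V} (hv : v ∈ lineSubmodule P) : v ∈ P := by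
  simpa using hv 1

/-- A closed subgroup of a finite dimensional space coincides near `0` with the largest linear
subspace it contains. -/
lemma exists_ball_subset_lineSubmodule [FiniteDimensional ℝ V] {P : AddSubgroup V}
    (hP : IsClosed (P : Set V)) :
    ∃ ε > 0, ∀ v ∈ P, ‖v‖ < ε → v ∈ lineSubmodule P := by
  by_contra! hcon
  have hk : ∀ k : ℕ, ∃ v ∈ P, ‖v‖ < 1 / ((k : ℝ) + 1) ∧ v ∉ lineSubmodule P := fun k =>
    hcon _ (by positivity)
  choose v hvP hvn hvL using hk
  have hv0 : Tendsto v atTop (𝓝 0) :=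
    squeeze_zero_norm (fun k => (hvn k).le) tendsto_one_div_add_atTop_nhds_zero_nat
  obtain ⟨W, hW⟩ := (lineSubmodule P).exists_isCompl
  -- Removing the component in the linear part keeps a point in `P`, since that part lies in `P`,
  -- and does not kill points outside it. The directions of the projected points accumulate in the
  -- complement `W`.
  let pr : V →ₗ[ℝ] V := W.subtype ∘ₗ W.projectionOnto _ hW.symm
  have hprc : Continuous pr := LinearMap.continuous_of_finiteDimensional pr
  have hpr : ∀ x, x - pr x ∈ lineSubmodule P := by
    intro x
    have h1 : W.projectionOnto _ hW.symm (x - pr x) = 0 := by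
      rw [map_sub, sub_eq_zero]
      exact (Submodule.projectionOnto_apply_left hW.symm _).symm
    exact (Submodule.projectionOnto_apply_eq_zero_iff hW.symm).1 h1
  have hprW : ∀ x, pr x ∈ W := fun x => (W.projectionOnto _ hW.symm x).2
  have hwP : ∀ k, pr (v k) ∈ P := fun k => by
    have := P.sub_mem (hvP k) (lineSubmodule_le (hpr (v k)))
    simpa using this
  have hw0 : ∀ k, pr (v k) ≠ 0 := fun k h => hvL k (by simpa [h] using hpr (v k))
  have hwt : Tendsto (fun k => pr (v k)) atTop (𝓝 0) := by
    have h := (hprc.tendsto 0).comp hv0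
    rwa [map_zero] at h
  let e : ℕ → V := fun k => ‖pr (v k)‖⁻¹ • pr (v k)
  have he : ∀ k, e k ∈ Metric.sphere (0 : V) 1 := fun k => by
    simp [e, norm_smul, inv_mul_cancel₀ (norm_ne_zero_iff.2 (hw0 k))]
  have : ProperSpace V := FiniteDimensional.proper ℝ V
  obtain ⟨w, hw, ψ, hψ, hlim⟩ := (isCompact_sphere (0 : V) 1).tendsto_subseq he
  have hwW : w ∈ W := by
    refine (Submodule.closed_of_finiteDimensional W).mem_of_tendsto hlim
      (Eventually.of_forall fun k => W.smul_mem _ (hprW _))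
  -- Each multiple `u • w` is a limit of integer multiples of the small vectors `pr (v k)`: rounding
  -- down costs at most one such vector.
  have hwL : w ∈ lineSubmodule P := by
    intro u
    have ht : Tendsto (fun k => (⌊u / ‖pr (v (ψ k))‖⌋ : ℤ) • pr (v (ψ k))) atTop (𝓝 (u • w)) := by
      have h1 : Tendsto (fun k => u • e (ψ k) - Int.fract (u / ‖pr (v (ψ k))‖) • pr (v (ψ k)))
          atTop (𝓝 (u • w - 0)) := by
        refine (hlim.const_smul u).sub ?_
        refine squeeze_zero_norm (fun k => ?_)
          ((tendsto_zero_iff_norm_tendsto_zero.1 hwt).comp hψ.tendsto_atTop)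
        rw [norm_smul, Real.norm_eq_abs, abs_of_nonneg (Int.fract_nonneg _)]
        exact mul_le_of_le_one_left (norm_nonneg _) (Int.fract_lt_one _).le
      rw [sub_zero] at h1
      refine h1.congr fun k => ?_
      have : u • e (ψ k) = (u / ‖pr (v (ψ k))‖) • pr (v (ψ k)) := by
        simp [e, smul_smul, div_eq_mul_inv]
      rw [this, ← sub_smul, Int.self_sub_fract, Int.cast_smul_eq_zsmul]
    exact hP.mem_of_tendsto ht (Eventually.of_forall fun k => P.zsmul_mem (hwP _) _)
  have : w = 0 := by simpa using hW.disjoint.le_bot ⟨hwL, hwW⟩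
  simp [this] at hw

/-- If lines in the closed subgroup `P` return arbitrarily closely to the subgroup `Λ`, then the
largest subspace of `P` is spanned by its intersection with `Λ`. -/
lemma lineSubmodule_le_span_of_recurrent [FiniteDimensional ℝ V] {P Λ : AddSubgroup V}
    (hP : IsClosed (P : Set V)) (hΛ : Λ ≤ P)
    (hrec : ∀ ξ ∈ lineSubmodule P, ∀ δ > 0, ∃ k : ℕ, 0 < k ∧ ∃ l ∈ Λ, ‖(k : ℝ) • ξ - l‖ < δ) :
    lineSubmodule P ≤ Submodule.span ℝ (Λ ∩ lineSubmodule P : Set V) := by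
  intro ξ hξ
  obtain ⟨ε, hε, hball⟩ := exists_ball_subset_lineSubmodule hP
  have hcl : IsClosed (Submodule.span ℝ (Λ ∩ lineSubmodule P : Set V) : Set V) :=
    Submodule.closed_of_finiteDimensional _
  rw [← SetLike.mem_coe, ← hcl.closure_eq, Metric.mem_closure_iff]
  intro δ hδ
  -- The error `k • ξ - l` is in `P` and shorter than `ε`, so it lies in the linear part. Then `l`
  -- does too, and `l / k` approximates `ξ` within `δ`.
  obtain ⟨k, hk, l, hl, hkl⟩ := hrec ξ hξ (min ε δ) (lt_min hε hδ)
  have hd : (k : ℝ) • ξ - l ∈ lineSubmodule P :=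
    hball _ (P.sub_mem (hξ k) (hΛ hl)) (hkl.trans_le (min_le_left _ _))
  have hl' : l ∈ lineSubmodule P := by
    simpa using (lineSubmodule P).sub_mem ((lineSubmodule P).smul_mem (k : ℝ) hξ) hd
  refine ⟨(k : ℝ)⁻¹ • l, Submodule.smul_mem _ _ (Submodule.subset_span ⟨hl, hl'⟩), ?_⟩
  have hk1 : (1 : ℝ) ≤ k := by exact_mod_cast hk
  have hk0 : (k : ℝ) ≠ 0 := by positivity
  have : ξ - (k : ℝ)⁻¹ • l = (k : ℝ)⁻¹ • ((k : ℝ) • ξ - l) := by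
    rw [smul_sub, smul_smul, inv_mul_cancel₀ hk0, one_smul]
  rw [dist_eq_norm, this, norm_smul, norm_inv, RCLike.norm_natCast]
  calc (k : ℝ)⁻¹ * ‖(k : ℝ) • ξ - l‖ ≤ 1 * ‖(k : ℝ) • ξ - l‖ := by
        gcongr
        exact inv_le_one_of_one_le₀ hk1
    _ < δ := by
        rw [one_mul]
        exact hkl.trans_le (min_le_right _ _)

/-- A set spanning a subspace generates a cocompact subgroup of it. -/
lemma exists_compact_fundamental [FiniteDimensional ℝ V] (S : AddSubgroup V) :
    ∃ F : Set V, IsCompact F ∧ F ⊆ Submodule.span ℝ (S : Set V) ∧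
      ∀ w ∈ Submodule.span ℝ (S : Set V), ∃ s ∈ S, w - s ∈ F := by
  obtain ⟨b, hbS, hspan, hli⟩ := exists_linearIndependent ℝ (S : Set V)
  have : Fintype b := hli.setFinite.fintype
  let f : (b → ℝ) → V := fun c => ∑ i, c i • (i : V)
  have hf : Continuous f := by fun_prop
  refine ⟨f '' Set.Icc 0 1, isCompact_Icc.image hf, ?_, ?_⟩
  · rintro _ ⟨c, -, rfl⟩
    exact Submodule.sum_mem _ fun i _ => Submodule.smul_mem _ _ (Submodule.subset_span (hbS i.2))
  · intro w hw
    rw [← hspan] at hw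
    have hw' : w ∈ Submodule.span ℝ (Set.range (Subtype.val : b → V)) := by simpa using hw
    obtain ⟨c, rfl⟩ := (Submodule.mem_span_range_iff_exists_fun ℝ).1 hw'
    refine ⟨∑ i, ⌊c i⌋ • (i : V), S.sum_mem fun i _ => S.zsmul_mem (hbS i.2) _,
      fun i => Int.fract (c i), ⟨fun i => Int.fract_nonneg _, fun i => (Int.fract_lt_one _).le⟩, ?_⟩
    simp only [f]
    rw [← Finset.sum_sub_distrib]
    refine Finset.sum_congr rfl fun i _ => ?_
    rw [← Int.cast_smul_eq_zsmul ℝ, ← sub_smul, Int.self_sub_floor]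

/-- A sequence in a compact set has two terms, with consecutive distinct indices, as close as one
wishes. -/
lemma exists_lt_dist_lt {Y : Type*} [PseudoMetricSpace Y] {F : Set Y} (hF : IsCompact F)
    {f : ℕ → Y} (hf : ∀ n, f n ∈ F) {δ : ℝ} (hδ : 0 < δ) :
    ∃ n k : ℕ, 0 < k ∧ dist (f (n + k)) (f n) < δ := by
  obtain ⟨a, -, ψ, hψ, hlim⟩ := hF.tendsto_subseq hf
  obtain ⟨N, hN⟩ := Metric.cauchySeq_iff.1 hlim.cauchySeq δ hδ
  have h := hN (N + 1) (by omega) N le_rfl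
  have hlt : ψ N < ψ (N + 1) := hψ (Nat.lt_succ_self N)
  refine ⟨ψ N, ψ (N + 1) - ψ N, by omega, ?_⟩
  rwa [Nat.add_sub_cancel' hlt.le]

/-- If a cocompact subgroup `Λ` is contained in the closed subgroup `P`, then the largest subspace
of `P` is spanned by its intersection with `Λ`. -/
lemma lineSubmodule_le_span_of_cocompact [FiniteDimensional ℝ V] {P Λ : AddSubgroup V}
    (hP : IsClosed (P : Set V)) (hΛ : Λ ≤ P) {F : Set V} (hF : IsCompact F)
    (hFΛ : ∀ w : V, ∃ s ∈ Λ, w - s ∈ F) :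
    lineSubmodule P ≤ Submodule.span ℝ (Λ ∩ lineSubmodule P : Set V) := by
  refine lineSubmodule_le_span_of_recurrent hP hΛ fun ξ _ δ hδ => ?_
  -- Pigeonhole: two multiples of `ξ` have nearly the same reduction in the compact set `F`, so
  -- their difference is nearly in `Λ`.
  choose s hs hsF using fun n : ℕ => hFΛ ((n : ℝ) • ξ)
  obtain ⟨n, k, hk, hd⟩ := exists_lt_dist_lt hF hsF hδ
  refine ⟨k, hk, s (n + k) - s n, Λ.sub_mem (hs _) (hs _), ?_⟩
  rw [dist_eq_norm] at hd
  have : (k : ℝ) • ξ - (s (n + k) - s n) =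
      ((n + k : ℕ) : ℝ) • ξ - s (n + k) - ((n : ℝ) • ξ - s n) := by
    push_cast
    module
  rwa [this]

/-- Compact fundamental domain for the points of `Λ` in the largest subspace of `P`. -/
lemma exists_compact_fundamental_lineSubmodule [FiniteDimensional ℝ V] {P Λ : AddSubgroup V}
    (hP : IsClosed (P : Set V)) (hΛ : Λ ≤ P) {F : Set V} (hF : IsCompact F)
    (hFΛ : ∀ w : V, ∃ s ∈ Λ, w - s ∈ F) :
    ∃ F' : Set V, IsCompact F' ∧ F' ⊆ lineSubmodule P ∧
      ∀ w ∈ lineSubmodule P, ∃ s ∈ Λ, s ∈ lineSubmodule P ∧ w - s ∈ F' := by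
  have hle := lineSubmodule_le_span_of_cocompact hP hΛ hF hFΛ
  obtain ⟨F', hF', hsub, hall⟩ :=
    exists_compact_fundamental (Λ ⊓ (lineSubmodule P).toAddSubgroup)
  have hge : Submodule.span ℝ ((Λ ⊓ (lineSubmodule P).toAddSubgroup : AddSubgroup V) : Set V) ≤
      lineSubmodule P := Submodule.span_le.2 fun x hx => hx.2
  refine ⟨F', hF', fun x hx => hge (hsub hx), fun w hw => ?_⟩
  obtain ⟨s, hs, hsF⟩ := hall w (hle hw)
  exact ⟨s, hs.1, hs.2, hsF⟩

end ClosedSubgroups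

end LoopKirwan

end

/-! ### One-parameter groups in finite dimensional algebras. -/

noncomputable section

namespace LoopKirwan

section BanachAlgebras

variable {𝔸 : Type*} [NormedRing 𝔸] [NormedAlgebra ℝ 𝔸] [FiniteDimensional ℝ 𝔸]

/-- A one-parameter group determines the commutant of its generator. -/
lemma commute_of_commute_exp {X Y : 𝔸}
    (h : ∀ t : ℝ, Commute X (NormedSpace.exp (t • Y))) : Commute X Y := by
  have : CompleteSpace 𝔸 := FiniteDimensional.complete ℝ 𝔸
  have h1 : HasDerivAt (fun u : ℝ => X * NormedSpace.exp (u • Y)) (X * Y) 0 := by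
    simpa using (hasDerivAt_exp_smul_const Y (0 : ℝ)).const_mul X
  have h2 : HasDerivAt (fun u : ℝ => X * NormedSpace.exp (u • Y)) (Y * X) 0 := by
    have := (hasDerivAt_exp_smul_const Y (0 : ℝ)).mul_const X
    simp only [zero_smul, NormedSpace.exp_zero, one_mul] at this
    exact this.congr_of_eventuallyEq (Eventually.of_forall fun u => (h u).eq)
  exact h1.unique h2

/-- The Lie algebra of a compact abelian group in a finite dimensional algebra is spanned by the kernel of the exponential
map. -/
lemma mem_span_exp_eq_one_of_compact {S : Set (𝔸)} (hone : 1 ∈ S) (hmul : ∀ x ∈ S, ∀ y ∈ S, x * y ∈ S)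
    (hinv : ∀ x ∈ S, ∃ y ∈ S, x * y = 1) (hcomm : ∀ x ∈ S, ∀ y ∈ S, x * y = y * x)
    (hS : IsCompact S) {X : 𝔸} (hX : ∀ u : ℝ, NormedSpace.exp (u • X) ∈ S) :
    X ∈ Submodule.span ℝ {Y : 𝔸 | NormedSpace.exp Y = 1 ∧
      ∀ u : ℝ, NormedSpace.exp (u • Y) ∈ S} := by
  let _ : NormedAlgebra ℚ 𝔸 := NormedAlgebra.restrictScalars ℚ ℝ 𝔸
  have : CompleteSpace 𝔸 := FiniteDimensional.complete ℝ 𝔸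
  -- In the commutative algebra generated by `S` the exponential is a homomorphism, so that the
  -- preimages `P` of `S` and `K` of `1` are groups.
  let A : Subalgebra ℝ (𝔸) := Algebra.adjoin ℝ S
  have hA : ∀ a b : A, Commute a b := fun a b => Subtype.ext
    (Algebra.commute_of_mem_adjoin_of_forall_mem_commute b.2 fun y hy =>
      (Algebra.commute_of_mem_adjoin_of_forall_mem_commute a.2 fun z hz => hcomm y hy z hz).symm)
  have hcompl : CompleteSpace A := FiniteDimensional.complete ℝ A
  let _ : NormedAlgebra ℚ A := NormedAlgebra.restrictScalars ℚ ℝ A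
  have hcl : IsClosed (A : Set (𝔸)) :=
    Submodule.closed_of_finiteDimensional (Subalgebra.toSubmodule A)
  have hemb : IsClosedEmbedding (Subtype.val : A → 𝔸) := hcl.isClosedEmbedding_subtypeVal
  have hexp : ∀ a : A, ((NormedSpace.exp a : A) : 𝔸) = NormedSpace.exp (a : 𝔸) := fun a =>
    NormedSpace.map_exp A.val continuous_subtype_val a
  have hexpc : Continuous (NormedSpace.exp : A → A) := NormedSpace.exp_continuous
  have hadd : ∀ a b : A, NormedSpace.exp (a + b) = NormedSpace.exp a * NormedSpace.exp b :=
    fun a b => NormedSpace.exp_add_of_commute (hA a b)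
  let SA : Set A := Subtype.val ⁻¹' S
  have hSA : IsCompact SA := hemb.isCompact_preimage hS
  have hneg : ∀ a : A, NormedSpace.exp a ∈ SA → NormedSpace.exp (-a) ∈ SA := by
    intro a ha
    obtain ⟨y, hy, hxy⟩ := hinv _ ha
    have h1 : (NormedSpace.exp (-a) : A).1 * (NormedSpace.exp a : A).1 = 1 := by
      have := hadd (-a) a
      rw [neg_add_cancel, NormedSpace.exp_zero] at this
      exact congrArg Subtype.val this.symm
    have : (NormedSpace.exp (-a) : A).1 = y := left_inv_eq_right_inv h1 hxy
    show (NormedSpace.exp (-a) : A).1 ∈ S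
    rwa [this]
  let P : AddSubgroup A :=
    { carrier := {a | NormedSpace.exp a ∈ SA}
      zero_mem' := by simpa [SA] using hone
      add_mem' := fun {a b} ha hb => by
        show NormedSpace.exp (a + b) ∈ SA
        rw [hadd]
        exact hmul _ ha _ hb
      neg_mem' := fun {a} ha => hneg a ha }
  let K : AddSubgroup A :=
    { carrier := {a | NormedSpace.exp a = 1}
      zero_mem' := NormedSpace.exp_zero
      add_mem' := fun {a b} ha hb => by
        show NormedSpace.exp (a + b) = 1
        rw [hadd, show NormedSpace.exp a = 1 from ha, show NormedSpace.exp b = 1 from hb, one_mul]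
      neg_mem' := fun {a} ha => by
        have := hadd a (-a)
        rw [add_neg_cancel, NormedSpace.exp_zero, show NormedSpace.exp a = 1 from ha,
          one_mul] at this
        exact this.symm }
  have hP : IsClosed (P : Set A) := hSA.isClosed.preimage hexpc
  have hKP : K ≤ P := fun a ha => by
    show NormedSpace.exp a ∈ SA
    rw [show NormedSpace.exp a = 1 from ha]
    exact hone
  have hrec : ∀ ξ ∈ lineSubmodule P, ∀ δ > 0, ∃ k : ℕ, 0 < k ∧ ∃ l ∈ K, ‖(k : ℝ) • ξ - l‖ < δ := by
    intro ξ hξ δ hδ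
    -- By compactness of `S` some `exp (k • ξ)` returns close to `1`. As `exp` is open at `0`, it
    -- equals `exp f` for a small `f`, and `k • ξ - f` is in the kernel.
    have hloc : NormedSpace.exp '' Metric.ball (0 : A) δ ∈ 𝓝 (1 : A) := by
      have h1 : HasStrictFDerivAt (NormedSpace.exp : A → A)
          ((ContinuousLinearEquiv.refl ℝ A : A ≃L[ℝ] A) : A →L[ℝ] A) 0 :=
        hasStrictFDerivAt_exp_zero
      have h2 := h1.map_nhds_eq_of_equiv
      rw [NormedSpace.exp_zero] at h2
      rw [← h2]
      exact image_mem_map (Metric.ball_mem_nhds _ hδ)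
    obtain ⟨r, hr, hball⟩ := Metric.mem_nhds_iff.1 hloc
    obtain ⟨C, hC⟩ := hSA.isBounded.exists_norm_le
    have hC' : (0 : ℝ) < |C| + 1 := by positivity
    obtain ⟨m, k, hk, hd⟩ := exists_lt_dist_lt hSA (f := fun m : ℕ => NormedSpace.exp ((m : ℝ) • ξ))
      (fun m => hξ m) (div_pos hr hC')
    have hexpk : NormedSpace.exp ((k : ℝ) • ξ) - 1 =
        (NormedSpace.exp (((m + k : ℕ) : ℝ) • ξ) - NormedSpace.exp ((m : ℝ) • ξ)) *
          NormedSpace.exp (-((m : ℝ) • ξ)) := by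
      rw [sub_mul, ← hadd, ← hadd, add_neg_cancel, NormedSpace.exp_zero]
      congr 2
      push_cast
      module
    have hlt : NormedSpace.exp ((k : ℝ) • ξ) ∈ Metric.ball (1 : A) r := by
      rw [mem_ball_iff_norm, hexpk]
      rw [dist_eq_norm] at hd
      refine (norm_mul_le _ _).trans_lt ?_
      have h2 : ‖NormedSpace.exp (-((m : ℝ) • ξ))‖ ≤ |C| + 1 :=
        ((hC _ (hneg _ (hξ m))).trans (le_abs_self C)).trans (by linarith)
      calc _ ≤ ‖NormedSpace.exp (((m + k : ℕ) : ℝ) • ξ) - NormedSpace.exp ((m : ℝ) • ξ)‖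
            * (|C| + 1) := by gcongr
        _ < r / (|C| + 1) * (|C| + 1) := by gcongr
        _ = r := by field_simp
    obtain ⟨f, hf, hfk⟩ := hball hlt
    refine ⟨k, hk, (k : ℝ) • ξ - f, ?_, by simpa using hf⟩
    show NormedSpace.exp ((k : ℝ) • ξ - f) = 1
    rw [sub_eq_add_neg, hadd, ← hfk, ← hadd, add_neg_cancel, NormedSpace.exp_zero]
  have hle := lineSubmodule_le_span_of_recurrent hP hKP hrec
  have hSsub : S ⊆ (A : Set (𝔸)) := Algebra.subset_adjoin
  -- The generator is a limit of difference quotients of elements of `S`, and `A` is closed.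
  have hXA : X ∈ A := by
    have hd : HasDerivAt (fun u : ℝ => NormedSpace.exp (u • X)) X 0 := by
      simpa using hasDerivAt_exp_smul_const X (0 : ℝ)
    have ht := hd.tendsto_slope
    refine hcl.mem_of_tendsto ht (Eventually.of_forall fun u => ?_)
    rw [slope_def_module]
    exact A.smul_mem (A.sub_mem (hSsub (hX u)) (hSsub (hX 0))) _
  have hX' : (⟨X, hXA⟩ : A) ∈ lineSubmodule P := by
    intro u
    show ((NormedSpace.exp (u • (⟨X, hXA⟩ : A)) : A) : 𝔸) ∈ S
    rw [hexp]
    exact hX u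
  have hmem := Submodule.mem_map_of_mem (f := A.val.toLinearMap) (hle hX')
  rw [Submodule.map_span] at hmem
  refine Submodule.span_mono ?_ hmem
  rintro _ ⟨y, ⟨hy1, hy2⟩, rfl⟩
  refine ⟨?_, fun u => ?_⟩
  · rw [show A.val.toLinearMap y = (y : 𝔸) from rfl, ← hexp, show NormedSpace.exp y = 1 from hy1]
    rfl
  · have := hy2 u
    rw [show u • A.val.toLinearMap y = ((u • y : A) : 𝔸) from rfl, ← hexp]
    exact this

lemma continuous_exp_of_finiteDimensional {𝔸 : Type*} [NormedRing 𝔸] [NormedAlgebra ℝ 𝔸]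
    [FiniteDimensional ℝ 𝔸] : Continuous (NormedSpace.exp : 𝔸 → 𝔸) := by
  have : CompleteSpace 𝔸 := FiniteDimensional.complete ℝ 𝔸
  let _ : NormedAlgebra ℚ 𝔸 := NormedAlgebra.restrictScalars ℚ ℝ 𝔸
  exact NormedSpace.exp_continuous

lemma hasDerivAt_exp_smul_of_finiteDimensional {𝔸 : Type*} [NormedRing 𝔸] [NormedAlgebra ℝ 𝔸]
    [FiniteDimensional ℝ 𝔸] (A : 𝔸) (s : ℝ) :
    HasDerivAt (fun u : ℝ => NormedSpace.exp (u • A)) (NormedSpace.exp (s • A) * A) s := by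
  have : CompleteSpace 𝔸 := FiniteDimensional.complete ℝ 𝔸
  exact hasDerivAt_exp_smul_const A s

end BanachAlgebras

section MatrixExponential

attribute [local instance] Matrix.linftyOpNormedRing Matrix.linftyOpNormedAlgebra

variable {n : ℕ}

/-- The entrywise sup norm on matrices is not submultiplicative. The operator norm used here induces
the same topology, and only the topology enters the statements of this section. -/
lemma continuous_matrix_exp : Continuous (NormedSpace.exp : Mat n → Mat n) :=
  continuous_exp_of_finiteDimensional

lemma matrix_hasDerivAt_exp_smul (A : Mat n) (s : ℝ) :
    HasDerivAt (fun u : ℝ => NormedSpace.exp (u • A)) (NormedSpace.exp (s • A) * A) s :=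
  hasDerivAt_exp_smul_of_finiteDimensional A s

lemma matrix_commute_of_commute_exp {X Y : Mat n}
    (h : ∀ t : ℝ, Commute X (NormedSpace.exp (t • Y))) : Commute X Y :=
  commute_of_commute_exp h

lemma matrix_mem_span_exp_eq_one {S : Set (Mat n)} (hone : 1 ∈ S)
    (hmul : ∀ x ∈ S, ∀ y ∈ S, x * y ∈ S)
    (hinv : ∀ x ∈ S, ∃ y ∈ S, x * y = 1) (hcomm : ∀ x ∈ S, ∀ y ∈ S, x * y = y * x)
    (hS : IsCompact S) {X : Mat n} (hX : ∀ u : ℝ, NormedSpace.exp (u • X) ∈ S) :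
    X ∈ Submodule.span ℝ {Y : Mat n | NormedSpace.exp Y = 1 ∧
      ∀ u : ℝ, NormedSpace.exp (u • Y) ∈ S} :=
  mem_span_exp_eq_one_of_compact hone hmul hinv hcomm hS hX

end MatrixExponential

end LoopKirwan

end

/-! ### Exponential loops, the integral lattice and the loops defined by the torus. -/

noncomputable section

namespace LoopKirwan

section TrigonometricLoops

variable {n : ℕ}

/-- Integration by parts: the periodic function `exp (-2πiks) exp (sA)` has the derivative obtained
by right multiplication with `A - 2πik`, whose integral over a period vanishes. -/
lemma fourierCoeff_exp_mul {f : UnitAddCircle → Mat n} {A : Mat n}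
    (hf : ∀ s : ℝ, f (s : UnitAddCircle) = NormedSpace.exp (s • A)) (k : ℤ) :
    fourierCoeff f k * A = (2 * (Real.pi : ℂ) * Complex.I * (k : ℂ)) • fourierCoeff f k := by
  set c : ℂ := 2 * (Real.pi : ℂ) * Complex.I * (k : ℂ) with hc
  have hcont : Continuous fun s : ℝ =>
      (fourier (-k) (s : UnitAddCircle) : ℂ) • NormedSpace.exp (s • A) := by
    have h1 : Continuous fun s : ℝ => (fourier (-k) (s : UnitAddCircle) : ℂ) :=
      (map_continuous _).comp (AddCircle.continuous_mk' (1 : ℝ))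
    have h2 : Continuous fun s : ℝ => NormedSpace.exp (s • A) :=
      continuous_matrix_exp.comp (continuous_id.smul continuous_const)
    exact h1.smul h2
  have hd : ∀ s : ℝ, HasDerivAt
      (fun s : ℝ => (fourier (-k) (s : UnitAddCircle) : ℂ) • NormedSpace.exp (s • A))
      (((fourier (-k) (s : UnitAddCircle) : ℂ) • NormedSpace.exp (s • A)) * (A - c • 1)) s := by
    intro s
    have h1 := hasDerivAt_fourier_neg 1 k s
    have h2 := matrix_hasDerivAt_exp_smul A s
    have h3 := h1.smul h2
    have e : ((fourier (-k) (s : UnitAddCircle) : ℂ) • NormedSpace.exp (s • A)) * (A - c • 1) =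
        (fourier (-k) (s : UnitAddCircle) : ℂ) • (NormedSpace.exp (s • A) * A) +
        (-2 * (Real.pi : ℂ) * Complex.I * k / (1 : ℝ) * fourier (-k) (s : UnitAddCircle)) •
          NormedSpace.exp (s • A) := by
      rw [mul_sub, Matrix.mul_smul, mul_one, smul_smul, Matrix.smul_mul, sub_eq_add_neg, ← neg_smul]
      congr 2
      simp only [hc]
      push_cast
      ring
    exact e ▸ h3
  have hcont' : Continuous fun s : ℝ =>
      ((fourier (-k) (s : UnitAddCircle) : ℂ) • NormedSpace.exp (s • A)) * (A - c • 1) :=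
    hcont.mul continuous_const
  have hint := intervalIntegral.integral_eq_sub_of_hasDerivAt (a := 0) (b := 1)
    (fun s _ => hd s) (hcont'.intervalIntegrable 0 1)
  have hper : (fourier (-k) ((1 : ℝ) : UnitAddCircle) : ℂ) • NormedSpace.exp ((1 : ℝ) • A) -
      (fourier (-k) ((0 : ℝ) : UnitAddCircle) : ℂ) • NormedSpace.exp ((0 : ℝ) • A) = 0 := by
    rw [← hf, ← hf, show ((1 : ℝ) : UnitAddCircle) = ((0 : ℝ) : UnitAddCircle) by
      simp, sub_self]
  rw [hper] at hint
  let R : Mat n →L[ℝ] Mat n := LinearMap.toContinuousLinearMap (LinearMap.mulRight ℝ (A - c • 1))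
  have hR : (∫ s in (0 : ℝ)..1, ((fourier (-k) (s : UnitAddCircle) : ℂ) •
      NormedSpace.exp (s • A)) * (A - c • 1)) = (∫ s in (0 : ℝ)..1,
      (fourier (-k) (s : UnitAddCircle) : ℂ) • NormedSpace.exp (s • A)) * (A - c • 1) :=
    R.intervalIntegral_comp_comm (hcont.intervalIntegrable 0 1 (μ := MeasureTheory.volume))
  rw [hint] at hR
  have hF : fourierCoeff f k = ∫ s in (0 : ℝ)..1,
      (fourier (-k) (s : UnitAddCircle) : ℂ) • NormedSpace.exp (s • A) := by
    rw [fourierCoeff_eq_intervalIntegral f k 0]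
    simp [hf]
  rw [← hF, mul_sub, Matrix.mul_smul, mul_one] at hR
  exact sub_eq_zero.1 hR.symm

/-- The `k`-th coefficient is annihilated by `2πik - A`, so it vanishes unless `2πik` is one of the
finitely many eigenvalues of `A`. -/
lemma finite_support_fourierCoeff_exp {f : UnitAddCircle → Mat n} {A : Mat n}
    (hf : ∀ s : ℝ, f (s : UnitAddCircle) = NormedSpace.exp (s • A)) :
    {k | fourierCoeff f k ≠ 0}.Finite := by
  have hinj : Function.Injective fun k : ℤ => 2 * (Real.pi : ℂ) * Complex.I * (k : ℂ) := by
    intro a b hab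
    simpa [Real.pi_ne_zero] using hab
  refine ((Matrix.finite_spectrum A).preimage hinj.injOn).subset fun k hk => ?_
  rw [mem_preimage, spectrum.mem_iff]
  intro hu
  refine hk ?_
  have h := fourierCoeff_exp_mul hf k
  have h0 : fourierCoeff f k *
      (algebraMap ℂ (Mat n) (2 * (Real.pi : ℂ) * Complex.I * (k : ℂ)) - A) = 0 := by
    rw [mul_sub, h, Algebra.algebraMap_eq_smul_one, Matrix.mul_smul, mul_one, sub_self]
  exact (hu.mul_left_eq_zero).1 h0

lemma fourierCoeff_const {E : Type*} [NormedAddCommGroup E] [NormedSpace ℂ E] [CompleteSpace E]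
    (B : E) (k : ℤ) :
    fourierCoeff (fun _ : UnitAddCircle => B) k = if k = 0 then B else 0 := by
  have h := congrFun (fourierCoeff_fourier (T := (1 : ℝ)) 0) k
  simp only [fourierCoeff, fourier_zero, smul_eq_mul, mul_one] at h
  rw [fourierCoeff, integral_smul_const, h]
  by_cases hk : k = 0 <;> simp [hk]

end TrigonometricLoops

variable {G : Type*} [Group G] [TopologicalSpace G] [IsTopologicalGroup G]
  [CompactSpace G] [SimplyConnectedSpace G] {n : ℕ} (D : LoopData G n)

namespace LoopData

@[simp] lemma mat_one : D.mat 1 = 1 := by simp [mat]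

@[simp] lemma mat_mul (g h : G) : D.mat (g * h) = D.mat g * D.mat h := by simp [mat]

lemma mat_injective : Function.Injective D.mat := fun _ _ h => D.injective_ρ (Subtype.ext h)

lemma continuous_mat : Continuous D.mat := continuous_subtype_val.comp D.continuous_ρ

lemma isClosedEmbedding_mat : IsClosedEmbedding D.mat :=
  D.continuous_mat.isClosedEmbedding D.mat_injective

lemma mat_mul_inv (g : G) : D.mat g * D.mat g⁻¹ = 1 := by rw [← mat_mul, mul_inv_cancel, mat_one]

lemma isUnit_mat (g : G) : IsUnit (D.mat g) :=
  IsUnit.of_mul_eq_one _ (D.mat_mul_inv g)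

lemma mat_comm {g h : G} (hg : g ∈ D.T) (hh : h ∈ D.T) : Commute (D.mat g) (D.mat h) := by
  rw [Commute, SemiconjBy, ← mat_mul, D.torus.comm g hg h hh, mat_mul]

/-- Taking the span in `lieAlgOf` adds nothing for a torus: generators commute with `T`, hence with
each other, so the exponential of a sum is a product of elements of `ρ(T)`. The two assertions are
proved together because sums need both. -/
lemma tAlg_spec {X : Mat n} (hX : X ∈ D.tAlg) :
    (∀ h ∈ D.T, Commute X (D.mat h)) ∧ ∀ t : ℝ, ∃ g ∈ D.T, D.mat g = NormedSpace.exp (t • X) := by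
  refine Submodule.span_induction (p := fun X _ => (∀ h ∈ D.T, Commute X (D.mat h)) ∧
    ∀ t : ℝ, ∃ g ∈ D.T, D.mat g = NormedSpace.exp (t • X)) ?_ ?_ ?_ ?_ hX
  · intro A hA
    refine ⟨fun h hh => ?_, fun t => hA t⟩
    refine (matrix_commute_of_commute_exp fun t => ?_).symm
    obtain ⟨g, hg, e⟩ := hA t
    rw [← e]
    exact D.mat_comm hh hg
  · exact ⟨fun h _ => Commute.zero_left _, fun t => ⟨1, D.T.one_mem, by simp⟩⟩
  · rintro A B - - ⟨hA1, hA2⟩ ⟨hB1, hB2⟩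
    refine ⟨fun h hh => (hA1 h hh).add_left (hB1 h hh), fun t => ?_⟩
    obtain ⟨g, hg, e⟩ := hA2 t
    obtain ⟨g', hg', e'⟩ := hB2 t
    refine ⟨g * g', D.T.mul_mem hg hg', ?_⟩
    have hc : Commute A B := matrix_commute_of_commute_exp fun s => by
      obtain ⟨h, hh, e⟩ := hB2 s
      rw [← e]
      exact hA1 h hh
    rw [smul_add, Matrix.exp_add_of_commute _ _ ((hc.smul_left t).smul_right t), mat_mul, e, e']
  · rintro c A - ⟨hA1, hA2⟩
    refine ⟨fun h hh => (hA1 h hh).smul_left c, fun t => ?_⟩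
    rw [smul_smul]
    exact hA2 _

lemma tAlg_commute_mat (X : D.tAlg) {h : G} (hh : h ∈ D.T) : Commute (X : Mat n) (D.mat h) :=
  (D.tAlg_spec X.2).1 h hh

lemma exists_mat_eq_exp (X : D.tAlg) : ∃ g ∈ D.T, D.mat g = NormedSpace.exp (X : Mat n) := by
  simpa using (D.tAlg_spec X.2).2 1

lemma mem_tAlg_of_exp {X : Mat n}
    (h : ∀ t : ℝ, ∃ g ∈ D.T, D.mat g = NormedSpace.exp (t • X)) : X ∈ D.tAlg :=
  Submodule.subset_span h

lemma tAlg_commute (X Y : D.tAlg) : Commute (X : Mat n) (Y : Mat n) :=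
  matrix_commute_of_commute_exp fun t => by
    obtain ⟨g, hg, e⟩ := (D.tAlg_spec Y.2).2 t
    rw [← e]
    exact D.tAlg_commute_mat X hg

lemma tAlg_exp_add (X Y : D.tAlg) : NormedSpace.exp ((X + Y : D.tAlg) : Mat n) =
    NormedSpace.exp (X : Mat n) * NormedSpace.exp (Y : Mat n) :=
  Matrix.exp_add_of_commute _ _ (D.tAlg_commute X Y)

/-- The integral lattice as a subgroup of `𝔱`. -/
def latticeSubgroup : AddSubgroup D.tAlg where
  carrier := D.lattice
  zero_mem' := by simp [lattice]
  add_mem' := fun {a b} ha hb => by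
    show NormedSpace.exp ((a + b : D.tAlg) : Mat n) = 1
    rw [tAlg_exp_add, show NormedSpace.exp (a : Mat n) = 1 from ha,
      show NormedSpace.exp (b : Mat n) = 1 from hb, one_mul]
  neg_mem' := fun {a} ha => by
    have h := D.tAlg_exp_add a (-a)
    rw [add_neg_cancel, show NormedSpace.exp (a : Mat n) = 1 from ha, one_mul] at h
    exact h.symm.trans (by simp)

lemma mem_latticeSubgroup {η : D.tAlg} : η ∈ D.latticeSubgroup ↔ η ∈ D.lattice := Iff.rfl

/-- `ρ(T)` is a compact abelian matrix group, so its one-parameter groups recur to the identity and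
their generators are combinations of kernel elements of `exp`. This is what makes `Π` cocompact in
`𝔱`. -/
lemma span_lattice : Submodule.span ℝ (D.latticeSubgroup : Set D.tAlg) = ⊤ := by
  refine eq_top_iff.2 fun X _ => ?_
  have hX : (X : Mat n) ∈ Submodule.span ℝ {Y : Mat n | NormedSpace.exp Y = 1 ∧
      ∀ u : ℝ, NormedSpace.exp (u • Y) ∈ D.mat '' (D.T : Set G)} := by
    refine matrix_mem_span_exp_eq_one ?_ ?_ ?_ ?_ ?_ ?_
    · exact ⟨1, D.T.one_mem, D.mat_one⟩
    · rintro _ ⟨g, hg, rfl⟩ _ ⟨h, hh, rfl⟩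
      exact ⟨g * h, D.T.mul_mem hg hh, D.mat_mul g h⟩
    · rintro _ ⟨g, hg, rfl⟩
      exact ⟨_, ⟨g⁻¹, D.T.inv_mem hg, rfl⟩, D.mat_mul_inv g⟩
    · rintro _ ⟨g, hg, rfl⟩ _ ⟨h, hh, rfl⟩
      exact (D.mat_comm hg hh).eq
    · exact D.torus.isClosed.isCompact.image D.continuous_mat
    · exact fun u => (D.tAlg_spec X.2).2 u
  have himg : {Y : Mat n | NormedSpace.exp Y = 1 ∧
      ∀ u : ℝ, NormedSpace.exp (u • Y) ∈ D.mat '' (D.T : Set G)} ⊆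
      D.tAlg.subtype '' (D.latticeSubgroup : Set D.tAlg) := by
    rintro Y ⟨h1, h2⟩
    exact ⟨⟨Y, D.mem_tAlg_of_exp h2⟩, h1, rfl⟩
  have h := Submodule.span_mono himg hX
  rw [← Submodule.map_span] at h
  obtain ⟨Z, hZ, hZX⟩ := h
  rwa [← Subtype.ext (show (Z : Mat n) = X from hZX)]

lemma exists_compact_fundamental_lattice :
    ∃ F : Set D.tAlg, IsCompact F ∧ ∀ w : D.tAlg, ∃ η ∈ D.latticeSubgroup, w - η ∈ F := by
  obtain ⟨F, hF, -, h⟩ := exists_compact_fundamental D.latticeSubgroup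
  exact ⟨F, hF, fun w => h w (by rw [span_lattice]; trivial)⟩

/-- The loop is a trigonometric polynomial, by `finite_support_fourierCoeff_exp`, and hence of every
Sobolev class. -/
lemma exists_loop_exp {A : Mat n} (hA : NormedSpace.exp A = 1)
    (h : ∀ s : ℝ, ∃ g, D.mat g = NormedSpace.exp (s • A)) :
    ∃ γ : D.LG, ∀ s : ℝ, D.mat (γ.1 (s : UnitAddCircle)) = NormedSpace.exp (s • A) := by
  choose f hf using h
  have hfc : Continuous f := by
    refine D.isClosedEmbedding_mat.isInducing.continuous_iff.2 ?_
    have : D.mat ∘ f = fun s : ℝ => NormedSpace.exp (s • A) := funext hf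
    rw [this]
    exact continuous_matrix_exp.comp (continuous_id.smul continuous_const)
  have hper : Function.Periodic f 1 := by
    intro s
    apply D.mat_injective
    rw [hf, hf, add_smul, one_smul, Matrix.exp_add_of_commute _ _
      ((Commute.refl A).smul_left s), hA, mul_one]
  let γ : C(UnitAddCircle, G) := ⟨hper.lift, hfc.quotient_lift _⟩
  have hγ : ∀ s : ℝ, D.mat (γ (s : UnitAddCircle)) = NormedSpace.exp (s • A) := hf
  refine ⟨⟨γ, Subgroup.subset_closure ?_⟩, hγ⟩
  refine Memℓp.of_exponent_ge (memℓp_zero_iff.2 ?_) (zero_le)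
  refine (finite_support_fourierCoeff_exp (f := fun t => D.mat (γ t)) hγ).subset fun k hk hk0 => hk ?_
  show weight D.ς k • fourierCoeff (fun t => D.mat (γ t)) k = 0
  rw [hk0, smul_zero]

lemma LG_ext {γ γ' : D.LG}
    (h : ∀ s : ℝ, D.mat (γ.1 (s : UnitAddCircle)) = D.mat (γ'.1 (s : UnitAddCircle))) : γ = γ' := by
  refine Subtype.ext (ContinuousMap.ext fun t => ?_)
  induction t using QuotientAddGroup.induction_on with
  | H s => exact D.mat_injective (h s)

lemma mat_loopOf {f : ℝ → Mat n}
    (h : ∃ γ : D.LG, ∀ s : ℝ, D.mat (γ.1 (s : UnitAddCircle)) = f s) (s : ℝ) :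
    D.mat ((D.loopOf f).1 (s : UnitAddCircle)) = f s := by
  rw [loopOf, dif_pos h]
  exact h.choose_spec s

lemma mat_latticeLoop {η : D.tAlg} (hη : η ∈ D.lattice) (s : ℝ) :
    D.mat ((D.latticeLoop η).1 (s : UnitAddCircle)) = NormedSpace.exp (-s • (η : Mat n)) := by
  refine D.mat_loopOf ?_ s
  obtain ⟨γ, hγ⟩ := D.exists_loop_exp (A := -(η : Mat n))
    (D.latticeSubgroup.neg_mem (D.mem_latticeSubgroup.2 hη)) fun s => by
      obtain ⟨g, -, hg⟩ := D.exists_mat_eq_exp (s • -η)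
      exact ⟨g, hg⟩
  exact ⟨γ, fun s => by rw [hγ, smul_neg, neg_smul]⟩

lemma mat_constLoop (g : G) (s : ℝ) :
    D.mat ((D.constLoop g).1 (s : UnitAddCircle)) = D.mat g := by
  refine D.mat_loopOf ?_ s
  refine ⟨⟨ContinuousMap.const _ g, Subgroup.subset_closure ?_⟩, fun s => rfl⟩
  refine Memℓp.of_exponent_ge (memℓp_zero_iff.2 ?_) (zero_le)
  refine (Set.finite_singleton (0 : ℤ)).subset fun k hk => ?_
  by_contra hk0
  refine hk ?_
  show weight D.ς k • fourierCoeff (fun _ => D.mat g) k = 0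
  rw [fourierCoeff_const, if_neg (by simpa using hk0), smul_zero]

lemma latticeLoop_mem_OmegaG {η : D.tAlg} (hη : η ∈ D.lattice) : D.latticeLoop η ∈ D.OmegaG := by
  apply D.mat_injective
  have := D.mat_latticeLoop hη 0
  simpa using this

lemma latticeLoop_add {η ζ : D.tAlg} (hη : η ∈ D.lattice) (hζ : ζ ∈ D.lattice) :
    D.latticeLoop (η + ζ) = D.latticeLoop η * D.latticeLoop ζ := by
  refine D.LG_ext fun s => ?_
  show _ = D.mat ((D.latticeLoop η).1 _ * (D.latticeLoop ζ).1 _)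
  rw [mat_mul, mat_latticeLoop D hη, mat_latticeLoop D hζ,
    mat_latticeLoop D (D.latticeSubgroup.add_mem hη hζ)]
  have h := D.tAlg_exp_add (-s • η) (-s • ζ)
  rwa [← smul_add] at h

lemma latticeLoop_zero : D.latticeLoop 0 = 1 := by
  refine D.LG_ext fun s => ?_
  rw [mat_latticeLoop D D.latticeSubgroup.zero_mem]
  simp

lemma evalAt_constFun (β : D.tAlg) (s : ℝ) : evalAt D.ς (D.constFun β).1 s = (β : Mat n) := by
  show ∑' k : ℤ, (fourier k (s : UnitAddCircle) : ℂ) • coef D.ς (lp.single 2 0 (β : Mat n)) k = _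
  rw [tsum_eq_single 0]
  · simp [coef_single]
  · intro k hk
    simp [coef_single, hk]

/-- The one-parameter elements of the maximal torus, as constant loops. -/
def torusLoop (β : D.tAlg) : D.LG := D.expLoop (D.constFun β)

lemma torusLoop_eq_constLoop {β : D.tAlg} {g : G} (hg : D.mat g = NormedSpace.exp (β : Mat n)) :
    D.torusLoop β = D.constLoop g := by
  simp only [torusLoop, expLoop, evalAt_constFun, constLoop, hg]

lemma exists_torusLoop_eq_constLoop (β : D.tAlg) : ∃ g ∈ D.T,
    D.mat g = NormedSpace.exp (β : Mat n) ∧ D.torusLoop β = D.constLoop g := by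
  obtain ⟨g, hg, h⟩ := D.exists_mat_eq_exp β
  exact ⟨g, hg, h, D.torusLoop_eq_constLoop h⟩

lemma mat_torusLoop (β : D.tAlg) (s : ℝ) :
    D.mat ((D.torusLoop β).1 (s : UnitAddCircle)) = NormedSpace.exp (β : Mat n) := by
  obtain ⟨g, -, h1, h2⟩ := D.exists_torusLoop_eq_constLoop β
  rw [h2, mat_constLoop, h1]

lemma torusLoop_add (β β' : D.tAlg) :
    D.torusLoop (β + β') = D.torusLoop β * D.torusLoop β' := by
  refine D.LG_ext fun s => ?_
  show _ = D.mat ((D.torusLoop β).1 _ * (D.torusLoop β').1 _)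
  rw [mat_mul, mat_torusLoop, mat_torusLoop, mat_torusLoop, tAlg_exp_add]

lemma torusLoop_of_mem_lattice {β : D.tAlg} (hβ : β ∈ D.lattice) : D.torusLoop β = 1 := by
  refine D.LG_ext fun s => ?_
  rw [mat_torusLoop, show NormedSpace.exp (β : Mat n) = 1 from hβ]
  exact D.mat_one.symm

lemma torusLoop_zero : D.torusLoop 0 = 1 := D.torusLoop_of_mem_lattice D.latticeSubgroup.zero_mem

lemma torusLoop_comm_latticeLoop (β : D.tAlg) {η : D.tAlg} (hη : η ∈ D.lattice) :
    D.torusLoop β * D.latticeLoop η = D.latticeLoop η * D.torusLoop β := by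
  refine D.LG_ext fun s => ?_
  show D.mat ((D.torusLoop β).1 _ * (D.latticeLoop η).1 _) =
    D.mat ((D.latticeLoop η).1 _ * (D.torusLoop β).1 _)
  rw [mat_mul, mat_mul, mat_torusLoop, mat_latticeLoop D hη]
  have h1 := D.tAlg_exp_add β (-s • η)
  have h2 := D.tAlg_exp_add (-s • η) β
  rw [add_comm] at h2
  exact h1.symm.trans h2

lemma constLoop_conj_mem_OmegaG (g : G) {γ : D.LG} (hγ : γ ∈ D.OmegaG) :
    D.constLoop g * γ * (D.constLoop g)⁻¹ ∈ D.OmegaG := by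
  show (D.constLoop g).1 0 * γ.1 0 * ((D.constLoop g).1 0)⁻¹ = 1
  rw [show γ.1 0 = 1 from hγ]
  simp

lemma expLoop_smul_constFun (u : ℝ) (β : D.tAlg) :
    D.expLoop (u • D.constFun β) = D.torusLoop (u • β) := by
  have : u • D.constFun β = D.constFun (u • β) := by
    refine Subtype.ext ?_
    show u • (lp.single 2 0 (β : Mat n) : Sob n) = lp.single 2 0 ((u • β : D.tAlg) : Mat n)
    rw [← lp.single_smul]
    rfl
  rw [this, torusLoop]

lemma expLoop_neg_smul_constFun (u : ℝ) (β : D.tAlg) :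
    D.expLoop (-(u • D.constFun β)) = D.torusLoop (-(u • β)) := by
  rw [← neg_smul, expLoop_smul_constFun]
  congr 1
  exact neg_smul u β

end LoopData

end LoopKirwan

end

/-! ### Fourier series of continuous vector valued functions. -/

noncomputable section

namespace LoopKirwan

section FourierSeries

variable {E F : Type*} [NormedAddCommGroup E] [NormedSpace ℂ E]
  [NormedAddCommGroup F] [NormedSpace ℂ F] [CompleteSpace F]

lemma continuous_fourier_coe (k : ℤ) :
    Continuous fun s : ℝ => (fourier k (s : UnitAddCircle) : ℂ) :=
  (map_continuous _).comp (AddCircle.continuous_mk' (1 : ℝ))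

lemma integrable_fourier_smul {f : UnitAddCircle → E} (hf : Continuous f) (k : ℤ) :
    MeasureTheory.Integrable (fun t : UnitAddCircle => (fourier k t : ℂ) • f t)
      AddCircle.haarAddCircle :=
  ((map_continuous (fourier k : C(UnitAddCircle, ℂ))).smul hf).integrable_of_hasCompactSupport
    (HasCompactSupport.of_compactSpace _)

variable [CompleteSpace E]

lemma fourierCoeff_clm {f : UnitAddCircle → E} (hf : Continuous f) (T : E →L[ℂ] F)
    (k : ℤ) : fourierCoeff (fun t => T (f t)) k = T (fourierCoeff f k) := by
  refine Eq.trans ?_ (T.integral_comp_comm (integrable_fourier_smul hf (-k)))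
  refine MeasureTheory.integral_congr_ae (Eventually.of_forall fun t => ?_)
  exact (T.map_smul _ _).symm

/-- A continuous function with vanishing Fourier coefficients is zero. -/
lemma eq_zero_of_fourierCoeff_eq_zero {f : UnitAddCircle → E} (hf : Continuous f)
    (h : ∀ k, fourierCoeff f k = 0) (t : UnitAddCircle) : f t = 0 := by
  -- Testing against functionals reduces to scalar functions, which are the sum of their Fourier
  -- series when its coefficients are summable.
  refine (SeparatingDual.eq_zero_iff_forall_dual_eq_zero (R := ℂ) (f t)).2 fun T => ?_
  let g : C(UnitAddCircle, ℂ) := ⟨fun t => T (f t), T.continuous.comp hf⟩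
  have hg : ∀ k, fourierCoeff g k = 0 := fun k => by
    refine (fourierCoeff_clm hf T k).trans ?_
    rw [h, map_zero]
  have hs := has_pointwise_sum_fourier_series_of_summable (f := g)
    (by rw [show fourierCoeff g = fun _ => 0 from funext hg]; exact summable_zero) t
  simp only [hg, zero_smul] at hs
  exact hs.unique hasSum_zero

lemma fourierCoeff_sub {f g : UnitAddCircle → E} (hf : Continuous f) (hg : Continuous g) (k : ℤ) :
    fourierCoeff (fun t => f t - g t) k = fourierCoeff f k - fourierCoeff g k := by
  refine Eq.trans ?_ (MeasureTheory.integral_sub (integrable_fourier_smul hf (-k))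
    (integrable_fourier_smul hg (-k)))
  refine MeasureTheory.integral_congr_ae (Eventually.of_forall fun t => ?_)
  exact smul_sub _ _ _

lemma fourierCoeff_fourier_smul (f : UnitAddCircle → E) (j k : ℤ) :
    fourierCoeff (fun t => (fourier j t : ℂ) • f t) k = fourierCoeff f (k - j) := by
  refine MeasureTheory.integral_congr_ae (Eventually.of_forall fun t => ?_)
  show (fourier (-k) t : ℂ) • (fourier j t : ℂ) • f t = (fourier (-(k - j)) t : ℂ) • f t
  rw [smul_smul, ← fourier_add, show -k + j = -(k - j) by ring]

/-- The Fourier coefficients of the sum of a normally convergent series. -/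
lemma hasSum_fourierCoeff {F : ℤ → UnitAddCircle → E} (hF : ∀ j, Continuous (F j)) {u : ℤ → ℝ}
    (hu : Summable u) (hFu : ∀ j t, ‖F j t‖ ≤ u j) (k : ℤ) :
    HasSum (fun j => fourierCoeff (F j) k) (fourierCoeff (fun t => ∑' j, F j t) k) := by
  have hn : ∀ j t, ‖(fourier (-k) t : ℂ) • F j t‖ ≤ u j := fun j t => by
    rw [norm_smul, show ‖(fourier (-k) t : ℂ)‖ = 1 from Circle.norm_coe _, one_mul]
    exact hFu j t
  have h := MeasureTheory.hasSum_integral_of_summable_integral_norm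
    (μ := (AddCircle.haarAddCircle : MeasureTheory.Measure UnitAddCircle))
    (F := fun j t => (fourier (-k) t : ℂ) • F j t)
    (fun j => integrable_fourier_smul (hF j) (-k)) ?_
  · have e : (∫ t, ∑' j, (fourier (-k) t : ℂ) • F j t ∂AddCircle.haarAddCircle) =
        fourierCoeff (fun t => ∑' j, F j t) k := by
      refine MeasureTheory.integral_congr_ae (Eventually.of_forall fun t => ?_)
      exact (Summable.of_norm_bounded hu fun j => hFu j t).tsum_const_smul _
    rw [← e]
    exact h
  · refine Summable.of_nonneg_of_le (fun j => MeasureTheory.integral_nonneg fun t => norm_nonneg _)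
      (fun j => ?_) hu
    refine (MeasureTheory.integral_mono_of_nonneg (Eventually.of_forall fun t => norm_nonneg _)
      (MeasureTheory.integrable_const (u j)) (Eventually.of_forall fun t => hn j t)).trans ?_
    simp

/-- A continuous function whose Fourier coefficients are those of the derivative of another one
is its derivative. -/
lemma hasDerivAt_of_fourierCoeff {g h : UnitAddCircle → E} (hg : Continuous g) (hh : Continuous h)
    (hc : ∀ k : ℤ, fourierCoeff h k =
      (2 * (Real.pi : ℂ) * Complex.I * (k : ℂ)) • fourierCoeff g k) (t : ℝ) :
    HasDerivAt (fun s : ℝ => g (s : UnitAddCircle)) (h (t : UnitAddCircle)) t := by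
  have hh' : Continuous fun s : ℝ => h (s : UnitAddCircle) :=
    hh.comp (AddCircle.continuous_mk' (1 : ℝ))
  -- The primitive of `h` is periodic because the zeroth coefficient of `h` vanishes. Its other
  -- coefficients agree with those of `g`, so the two differ by a constant.
  let Φ : ℝ → E := fun u => ∫ s in (0 : ℝ)..u, h (s : UnitAddCircle)
  have hΦ : ∀ u : ℝ, HasDerivAt Φ (h (u : UnitAddCircle)) u := fun u =>
    (hh'.integral_hasStrictDerivAt 0 u).hasDerivAt
  have hper : Function.Periodic (fun s : ℝ => h (s : UnitAddCircle)) 1 := fun s => by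
    simp
  have hΦper : Function.Periodic Φ 1 := by
    intro u
    have h1 : (∫ s in (0 : ℝ)..(0 + 1), h (s : UnitAddCircle)) = 0 := by
      have := fourierCoeff_eq_intervalIntegral h 0 0
      rw [hc 0] at this
      simpa using this.symm
    have h2 := hper.intervalIntegral_add_eq u 0
    rw [h1] at h2
    have h3 := intervalIntegral.integral_add_adjacent_intervals
      (hh'.intervalIntegrable (μ := MeasureTheory.volume) 0 u)
      (hh'.intervalIntegrable (μ := MeasureTheory.volume) u (u + 1))
    rw [h2, add_zero] at h3
    exact h3.symm
  have hΦc : Continuous Φ := continuous_iff_continuousAt.2 fun u => (hΦ u).continuousAt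
  let f : UnitAddCircle → E := hΦper.lift
  have hf : ∀ s : ℝ, f (s : UnitAddCircle) = Φ s := fun s => rfl
  have hfc : Continuous f := hΦc.quotient_lift _
  have hfk : ∀ k : ℤ, fourierCoeff h k =
      (2 * (Real.pi : ℂ) * Complex.I * (k : ℂ)) • fourierCoeff f k := by
    intro k
    have hd : ∀ s : ℝ, HasDerivAt (fun s : ℝ => (fourier (-k) (s : UnitAddCircle) : ℂ) • Φ s)
        ((fourier (-k) (s : UnitAddCircle) : ℂ) • h (s : UnitAddCircle) -
          (2 * (Real.pi : ℂ) * Complex.I * (k : ℂ)) •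
            (fourier (-k) (s : UnitAddCircle) : ℂ) • Φ s) s := by
      intro s
      refine ((hasDerivAt_fourier_neg 1 k s).smul (hΦ s)).congr_deriv ?_
      rw [sub_eq_add_neg, smul_smul, ← neg_smul]
      congr 2
      push_cast
      ring
    have hc1 : Continuous fun s : ℝ =>
        (fourier (-k) (s : UnitAddCircle) : ℂ) • h (s : UnitAddCircle) :=
      (continuous_fourier_coe _).smul hh'
    have hc2 : Continuous fun s : ℝ => (2 * (Real.pi : ℂ) * Complex.I * (k : ℂ)) •
        (fourier (-k) (s : UnitAddCircle) : ℂ) • Φ s :=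
      ((continuous_fourier_coe _).smul hΦc).const_smul _
    have hint := intervalIntegral.integral_eq_sub_of_hasDerivAt (a := 0) (b := 1)
      (fun s _ => hd s) ((hc1.sub hc2).intervalIntegrable 0 1)
    have h01 : (fourier (-k) ((1 : ℝ) : UnitAddCircle) : ℂ) • Φ 1 -
        (fourier (-k) ((0 : ℝ) : UnitAddCircle) : ℂ) • Φ 0 = 0 := by
      rw [← hf, ← hf, show ((1 : ℝ) : UnitAddCircle) = ((0 : ℝ) : UnitAddCircle) by simp, sub_self]
    rw [h01, intervalIntegral.integral_sub (hc1.intervalIntegrable 0 1)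
      (hc2.intervalIntegrable 0 1), intervalIntegral.integral_smul] at hint
    rw [fourierCoeff_eq_intervalIntegral h k 0, fourierCoeff_eq_intervalIntegral f k 0]
    simp only [hf]
    simpa using sub_eq_zero.1 hint
  have hconst : ∀ t, (g t - f t) - (fourierCoeff g 0 - fourierCoeff f 0) = 0 := by
    refine eq_zero_of_fourierCoeff_eq_zero ((hg.sub hfc).sub continuous_const) fun k => ?_
    have hgf : Continuous fun t => g t - f t := hg.sub hfc
    rw [fourierCoeff_sub hgf continuous_const, fourierCoeff_sub hg hfc,
      fourierCoeff_const]
    by_cases hk : k = 0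
    · subst hk
      simp
    · have := (hc k).symm.trans (hfk k)
      have h2 := smul_right_injective E (r := 2 * (Real.pi : ℂ) * Complex.I * (k : ℂ))
        (by simp [Real.pi_ne_zero, hk]) this
      simp [hk, h2]
  have : (fun s : ℝ => g (s : UnitAddCircle)) =
      fun s : ℝ => Φ s + (fourierCoeff g 0 - fourierCoeff f 0) := by
    funext s
    have := hconst (s : UnitAddCircle)
    rw [hf] at this
    rw [← sub_eq_zero, ← this]
    abel
  rw [this]
  exact (hΦ t).add_const _

end FourierSeries

end LoopKirwan

end

/-! ### Gauge transformations of forms: freeness and uniqueness. -/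

noncomputable section

namespace LoopKirwan

section MatrixFourier

variable {n : ℕ}

/-- The factor `n` makes up for the failure of the sup norm to be submultiplicative. -/
lemma norm_matrix_mul_le (X Y : Mat n) : ‖X * Y‖ ≤ n * ‖X‖ * ‖Y‖ := by
  refine (Matrix.norm_le_iff (by positivity)).2 fun i j => ?_
  rw [Matrix.mul_apply]
  refine (norm_sum_le _ _).trans ?_
  calc ∑ k, ‖X i k * Y k j‖ ≤ ∑ _k : Fin n, ‖X‖ * ‖Y‖ := by
        refine Finset.sum_le_sum fun k _ => ?_
        rw [norm_mul]
        gcongr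
        · exact Matrix.norm_entry_le_entrywise_sup_norm X
        · exact Matrix.norm_entry_le_entrywise_sup_norm Y
    _ = n * ‖X‖ * ‖Y‖ := by simp [mul_assoc]

lemma fourierCoeff_mul_left {f : UnitAddCircle → Mat n} (hf : Continuous f) (A : Mat n) (k : ℤ) :
    fourierCoeff (fun t => A * f t) k = A * fourierCoeff f k :=
  fourierCoeff_clm hf (LinearMap.toContinuousLinearMap (LinearMap.mulLeft ℂ A)) k

lemma fourierCoeff_mul_right {f : UnitAddCircle → Mat n} (hf : Continuous f) (A : Mat n) (k : ℤ) :
    fourierCoeff (fun t => f t * A) k = fourierCoeff f k * A :=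
  fourierCoeff_clm hf (LinearMap.toContinuousLinearMap (LinearMap.mulRight ℂ A)) k

/-- The matrix valued function with an absolutely summable family of Fourier coefficients. -/
def fourierSum (a : ℤ → Mat n) (t : UnitAddCircle) : Mat n := ∑' k : ℤ, (fourier k t : ℂ) • a k

lemma norm_fourier_smul (a : Mat n) (k : ℤ) (t : UnitAddCircle) :
    ‖(fourier k t : ℂ) • a‖ = ‖a‖ := by
  rw [norm_smul, show ‖(fourier k t : ℂ)‖ = 1 from Circle.norm_coe _, one_mul]

lemma continuous_fourierSum {a : ℤ → Mat n} (ha : Summable fun k => ‖a k‖) :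
    Continuous (fourierSum a) :=
  continuous_tsum (fun k => (map_continuous (fourier k : C(UnitAddCircle, ℂ))).smul
    continuous_const) ha fun _ _ => (norm_fourier_smul _ _ _).le

lemma hasSum_fourierSum {a : ℤ → Mat n} (ha : Summable fun k => ‖a k‖) (t : UnitAddCircle) :
    HasSum (fun k : ℤ => (fourier k t : ℂ) • a k) (fourierSum a t) :=
  (Summable.of_norm_bounded ha fun _ => (norm_fourier_smul _ _ _).le).hasSum

lemma norm_fourierSum_le {a : ℤ → Mat n} (ha : Summable fun k => ‖a k‖) (t : UnitAddCircle) :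
    ‖fourierSum a t‖ ≤ ∑' k, ‖a k‖ :=
  tsum_of_norm_bounded ha.hasSum fun _ => (norm_fourier_smul _ _ _).le

/-- The convolution theorem for a continuous function and an absolutely convergent series. -/
lemma fourierCoeff_mul_fourierSum {g : UnitAddCircle → Mat n} (hg : Continuous g) {a : ℤ → Mat n}
    (ha : Summable fun k => ‖a k‖) (k : ℤ) :
    fourierCoeff (fun t => g t * fourierSum a t) k = conv (fourierCoeff g) a k := by
  obtain ⟨C, hC⟩ := (isCompact_range hg).isBounded.exists_norm_le
  have hC' : ∀ t, ‖g t‖ ≤ C := fun t => hC _ (mem_range_self t)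
  have h := hasSum_fourierCoeff (F := fun j t => (fourier j t : ℂ) • (g t * a j))
    (fun j => (map_continuous (fourier j : C(UnitAddCircle, ℂ))).smul (hg.mul continuous_const))
    (ha.mul_left (n * C)) (fun j t => by
      rw [norm_fourier_smul]
      refine (norm_matrix_mul_le _ _).trans ?_
      gcongr
      exact hC' t) k
  have e : (fun t => ∑' j : ℤ, (fourier j t : ℂ) • (g t * a j)) =
      fun t => g t * fourierSum a t := by
    funext t
    have h1 := (hasSum_fourierSum ha t).mul_left (g t)
    simp only [Matrix.mul_smul] at h1
    exact h1.tsum_eq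
  refine (congrArg (fun f => fourierCoeff f k) e.symm).trans (h.tsum_eq.symm.trans ?_)
  show (∑' j : ℤ, fourierCoeff (fun t => (fourier j t : ℂ) • (g t * a j)) k) =
    ∑' j : ℤ, fourierCoeff g j * a (k - j)
  rw [← (Equiv.subLeft k).tsum_eq fun j => fourierCoeff g j * a (k - j)]
  refine tsum_congr fun j => ?_
  rw [Equiv.subLeft_apply, sub_sub_cancel, fourierCoeff_fourier_smul]
  exact fourierCoeff_mul_right hg (a j) (k - j)

lemma fourierCoeff_fourierSum_mul {g : UnitAddCircle → Mat n} (hg : Continuous g) {a : ℤ → Mat n}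
    (ha : Summable fun k => ‖a k‖) (k : ℤ) :
    fourierCoeff (fun t => fourierSum a t * g t) k = conv a (fourierCoeff g) k := by
  obtain ⟨C, hC⟩ := (isCompact_range hg).isBounded.exists_norm_le
  have hC' : ∀ t, ‖g t‖ ≤ C := fun t => hC _ (mem_range_self t)
  have hag : ∀ j, Continuous fun t => a j * g t := fun j => continuous_const.mul hg
  have h := hasSum_fourierCoeff (F := fun j t => (fourier j t : ℂ) • (a j * g t))
    (fun j => (map_continuous (fourier j : C(UnitAddCircle, ℂ))).smul (hag j))
    (ha.mul_left (n * C)) (fun j t => by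
      rw [norm_fourier_smul]
      refine (norm_matrix_mul_le _ _).trans ?_
      rw [mul_assoc, mul_assoc, mul_comm ‖a j‖]
      gcongr
      exact hC' t) k
  have e : (fun t => ∑' j : ℤ, (fourier j t : ℂ) • (a j * g t)) =
      fun t => fourierSum a t * g t := by
    funext t
    have h1 := (hasSum_fourierSum ha t).mul_right (g t)
    simp only [Matrix.smul_mul] at h1
    exact h1.tsum_eq
  refine (congrArg (fun f => fourierCoeff f k) e.symm).trans (h.tsum_eq.symm.trans ?_)
  show (∑' j : ℤ, fourierCoeff (fun t => (fourier j t : ℂ) • (a j * g t)) k) =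
    ∑' j : ℤ, a j * fourierCoeff g (k - j)
  refine tsum_congr fun j => ?_
  rw [fourierCoeff_fourier_smul]
  exact fourierCoeff_mul_left hg (a j) (k - j)

/-- A solution of `g' = g A - A g` on the circle with `g 0 = 1` is constant. -/
lemma eq_one_of_hasDerivAt_commutator {g A : UnitAddCircle → Mat n} {C : ℝ}
    (hA : ∀ t, ‖A t‖ ≤ C) (h0 : g 0 = 1)
    (hd : ∀ s : ℝ, HasDerivAt (fun s : ℝ => g (s : UnitAddCircle))
      (g (s : UnitAddCircle) * A s - A s * g (s : UnitAddCircle)) s) (t : ℝ) :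
    g (t : UnitAddCircle) = 1 := by
  have hC : 0 ≤ C := (norm_nonneg _).trans (hA 0)
  -- The constant function `1` solves the same linear equation. Each of the two terms of the
  -- commutator contributes `n * C` to the Lipschitz constant.
  have := ODE_solution_unique_univ (s := fun _ => univ) (t₀ := 0) (K := ⟨2 * n * C, by positivity⟩)
    (v := fun s y => y * A (s : UnitAddCircle) - A (s : UnitAddCircle) * y)
    (f := fun s : ℝ => g (s : UnitAddCircle)) (g := fun _ => (1 : Mat n))
    (fun s => (LipschitzWith.of_dist_le_mul fun x y => ?_).lipschitzOnWith)
    (fun s => ⟨hd s, mem_univ _⟩) (fun s => ⟨?_, mem_univ _⟩) (by simpa using h0)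
  · exact congrFun this t
  · rw [dist_eq_norm, dist_eq_norm]
    have : x * A s - A s * x - (y * A s - A s * y) = (x - y) * A s - A s * (x - y) := by
      noncomm_ring
    rw [this]
    refine (norm_sub_le _ _).trans ?_
    have h1 := norm_matrix_mul_le (x - y) (A s)
    have h2 := norm_matrix_mul_le (A s) (x - y)
    have h3 : n * ‖x - y‖ * ‖A s‖ ≤ n * ‖x - y‖ * C := by gcongr; exact hA _
    show _ ≤ 2 * n * C * ‖x - y‖
    nlinarith
  · simpa using hasDerivAt_const s (1 : Mat n)

lemma summable_norm_of_weight {a : ℤ → Mat n} (ha : Memℓp (fun k => weight 2 k • a k) 2) :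
    Summable fun k => ‖a k‖ := by
  obtain ⟨C, hC⟩ := (ha.of_exponent_ge (p := ⊤) le_top).bddAbove
  have hC' : ∀ k : ℤ, (1 + (k : ℝ) ^ 2) * ‖a k‖ ≤ C := fun k => by
    have := hC (mem_range_self k)
    have hw : weight 2 k = 1 + (k : ℝ) ^ 2 := by simp [weight]
    rwa [norm_smul, hw, Real.norm_of_nonneg (by positivity)] at this
  -- The shift by `1 / 2` keeps the denominators of the comparison series away from zero.
  have hs := (Real.summable_one_div_int_add_rpow (1 / 2) 2).2 (by norm_num)
  refine Summable.of_nonneg_of_le (fun k => norm_nonneg _) (fun k => ?_) (hs.mul_left (2 * C))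
  have hk : ((k : ℝ) + 1 / 2) ≠ 0 := by
    intro h
    have : ((2 * k + 1 : ℤ) : ℝ) = 0 := by push_cast; linarith
    have := Int.cast_eq_zero.1 this
    omega
  have hpos : 0 < ((k : ℝ) + 1 / 2) ^ 2 := by positivity
  have h1 : |(k : ℝ) + 1 / 2| ^ (2 : ℝ) = ((k : ℝ) + 1 / 2) ^ 2 := by
    rw [show (2 : ℝ) = ((2 : ℕ) : ℝ) by norm_num, Real.rpow_natCast, sq_abs]
  rw [h1, mul_one_div, le_div_iff₀ hpos]
  have h2 : ((k : ℝ) + 1 / 2) ^ 2 ≤ 2 * (1 + (k : ℝ) ^ 2) := by nlinarith [sq_nonneg ((k : ℝ) - 1 / 2)]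
  nlinarith [hC' k, norm_nonneg (a k), mul_le_mul_of_nonneg_left h2 (norm_nonneg (a k))]

end MatrixFourier

lemma coef_injective {n : ℕ} {s : ℝ} {b b' : Sob n} (h : ∀ k, coef s b k = coef s b' k) :
    b = b' := by
  refine lp.ext (funext fun k => ?_)
  have hw : (weight s k)⁻¹ ≠ 0 := by
    have : 0 < weight s k := Real.rpow_pos_of_pos (by positivity) _
    positivity
  exact smul_right_injective _ hw (h k)

variable {G : Type*} [Group G] [TopologicalSpace G] [IsTopologicalGroup G]
  [CompactSpace G] [SimplyConnectedSpace G] {n : ℕ} (D : LoopData G n)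

namespace LoopData

lemma continuous_mat_loop (γ : C(UnitAddCircle, G)) : Continuous fun t => D.mat (γ t) :=
  D.continuous_mat.comp γ.continuous

/-- The based gauge transformations act freely on smooth forms. -/
lemma eq_one_of_isGauge_self {γ : D.LG} (hγ : γ ∈ D.OmegaG) {a : D.LgDual}
    (ha : Memℓp (fun k => weight 2 k • coef (D.ς - 1) a.1 k) 2) (h : D.IsGauge γ a a) :
    γ = 1 := by
  have hs := summable_norm_of_weight ha
  set α := coef (D.ς - 1) a.1 with hα
  have hg : Continuous fun t => D.mat (γ.1 t) := D.continuous_mat_loop γ.1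
  have hA := continuous_fourierSum hs
  -- For a form with summable coefficients, the identity of Fourier coefficients expressing `γ · a =
  -- a` is the equation `γ' = γ a - a γ` between functions.
  have hd := hasDerivAt_of_fourierCoeff (g := fun t => D.mat (γ.1 t))
    (h := fun t => D.mat (γ.1 t) * fourierSum α t - fourierSum α t * D.mat (γ.1 t)) hg
    ((hg.mul hA).sub (hA.mul hg)) fun k => by
      have h1 := fourierCoeff_sub (f := fun t => D.mat (γ.1 t) * fourierSum α t)
        (g := fun t => fourierSum α t * D.mat (γ.1 t)) (hg.mul hA) (hA.mul hg) k
      have hk : conv α (fourierCoeff fun t => D.mat (γ.1 t)) k =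
        conv (fourierCoeff fun t => D.mat (γ.1 t)) α k -
          dcoef (fourierCoeff fun t => D.mat (γ.1 t)) k := h k
      rw [h1, fourierCoeff_mul_fourierSum hg hs, fourierCoeff_fourierSum_mul hg hs, hk,
        sub_sub_cancel]
      rfl
  have h0 : D.mat (γ.1 0) = 1 := by
    rw [show γ.1 0 = 1 from hγ, mat_one]
  refine D.LG_ext fun s => ?_
  rw [eq_one_of_hasDerivAt_commutator (g := fun t => D.mat (γ.1 t)) (A := fourierSum α)
    (norm_fourierSum_le hs) h0 hd s]
  exact D.mat_one.symm

lemma loopCoef_constLoop (g : G) (k : ℤ) :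
    D.loopCoef (D.constLoop g).1 k = if k = 0 then D.mat g else 0 := by
  rw [← fourierCoeff_const]
  have : (fun t => D.mat ((D.constLoop g).1 t)) = fun _ => D.mat g := by
    funext t
    induction t using QuotientAddGroup.induction_on with
    | H s => exact D.mat_constLoop g s
  rw [loopCoef, this]

/-- A gauge transformation by a constant loop is unique. -/
lemma isGauge_constLoop_unique {g : G} {a b b' : D.LgDual} (h : D.IsGauge (D.constLoop g) a b)
    (h' : D.IsGauge (D.constLoop g) a b') : b = b' := by
  refine Subtype.ext (coef_injective (s := D.ς - 1) fun k => ?_)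
  have hk : ∀ b : D.LgDual, conv (coef (D.ς - 1) b.1) (D.loopCoef (D.constLoop g).1) k =
      coef (D.ς - 1) b.1 k * D.mat g := by
    intro b
    rw [conv, tsum_eq_single k]
    · simp [loopCoef_constLoop]
    · intro j hj
      rw [loopCoef_constLoop, if_neg (sub_ne_zero.2 hj.symm), mul_zero]
  have := (h k).trans (h' k).symm
  rw [hk, hk] at this
  exact (D.isUnit_mat g).mul_right_cancel this

lemma loopCoef_latticeLoop_mul {η : D.tAlg} (hη : η ∈ D.lattice) (k : ℤ) :
    D.loopCoef (D.latticeLoop η).1 k * -(η : Mat n) =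
      (2 * (Real.pi : ℂ) * Complex.I * (k : ℂ)) • D.loopCoef (D.latticeLoop η).1 k :=
  fourierCoeff_exp_mul (f := fun t => D.mat ((D.latticeLoop η).1 t))
    (fun s => by rw [D.mat_latticeLoop hη, smul_neg, neg_smul]) k

lemma loopCoef_latticeLoop_commute {η : D.tAlg} (hη : η ∈ D.lattice) (k : ℤ) :
    Commute (η : Mat n) (D.loopCoef (D.latticeLoop η).1 k) := by
  have hc := D.continuous_mat_loop (D.latticeLoop η).1
  have h1 := fourierCoeff_mul_left hc (η : Mat n) k
  have h2 := fourierCoeff_mul_right hc (η : Mat n) k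
  refine h1.symm.trans (Eq.trans ?_ h2)
  congr 1
  funext t
  induction t using QuotientAddGroup.induction_on with
  | H s =>
    show (η : Mat n) * D.mat ((D.latticeLoop η).1 (s : UnitAddCircle)) =
      D.mat ((D.latticeLoop η).1 (s : UnitAddCircle)) * (η : Mat n)
    rw [D.mat_latticeLoop hη]
    exact (((Commute.refl (η : Mat n)).smul_right (-s)).exp_right).eq

/-- The coefficients commute with `η` and belong to the eigenvalues `2πik` of `-η`. Moving `-η`
across the product gives two different multiples of it. -/
lemma loopCoef_latticeLoop_mul_of_ne {η : D.tAlg} (hη : η ∈ D.lattice) {k l : ℤ} (hkl : k ≠ l) :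
    D.loopCoef (D.latticeLoop η).1 k * D.loopCoef (D.latticeLoop η).1 l = 0 := by
  set x := D.loopCoef (D.latticeLoop η).1 with hx
  have h1 : x k * -(η : Mat n) * x l = (2 * (Real.pi : ℂ) * Complex.I * (k : ℂ)) • (x k * x l) := by
    rw [D.loopCoef_latticeLoop_mul hη k, Matrix.smul_mul]
  have h2 : x k * -(η : Mat n) * x l = (2 * (Real.pi : ℂ) * Complex.I * (l : ℂ)) • (x k * x l) := by
    rw [mul_assoc, (D.loopCoef_latticeLoop_commute hη l).neg_left.eq,
      D.loopCoef_latticeLoop_mul hη l, Matrix.mul_smul]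
  have h3 := h1.symm.trans h2
  rw [← sub_eq_zero, ← sub_smul] at h3
  refine (smul_eq_zero.1 h3).resolve_left fun h => hkl ?_
  have : (2 * (Real.pi : ℂ) * Complex.I) * ((k : ℂ) - l) = 0 := by
    rw [← h]
    ring
  simpa [Real.pi_ne_zero, sub_eq_zero] using this

/-- The product of `M` with the loop has no Fourier coefficients, so it vanishes at `0`, where the
loop is invertible. -/
lemma eq_zero_of_mul_loopCoef_latticeLoop {η : D.tAlg} {M : Mat n}
    (h : ∀ k, M * D.loopCoef (D.latticeLoop η).1 k = 0) : M = 0 := by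
  have hc := D.continuous_mat_loop (D.latticeLoop η).1
  have hMc : Continuous fun t => M * D.mat ((D.latticeLoop η).1 t) := continuous_const.mul hc
  have h0 := eq_zero_of_fourierCoeff_eq_zero hMc (fun k => (fourierCoeff_mul_left hc M k).trans (h k)) 0
  exact ((D.isUnit_mat _).mul_left_eq_zero).1 h0

/-- A gauge transformation by a lattice loop is unique. -/
lemma isGauge_latticeLoop_unique {η : D.tAlg} (hη : η ∈ D.lattice) {a b b' : D.LgDual}
    (h : D.IsGauge (D.latticeLoop η) a b) (h' : D.IsGauge (D.latticeLoop η) a b') : b = b' := by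
  set x := D.loopCoef (D.latticeLoop η).1 with hx
  have hfin : {k | x k ≠ 0}.Finite :=
    finite_support_fourierCoeff_exp (f := fun t => D.mat ((D.latticeLoop η).1 t))
      (A := -(η : Mat n)) (fun s => by rw [D.mat_latticeLoop hη, smul_neg, neg_smul])
  -- A form here may only be a distribution, so one cannot multiply by the inverse loop pointwise.
  -- Multiplying by one coefficient of the loop instead isolates a single term of the convolution,
  -- by orthogonality.
  have hconv : ∀ (c : ℤ → Mat n) (k m : ℤ), conv c x k * x m = c (k - m) * (x m * x m) := by
    intro c k m
    have hsum : Summable fun j => c j * x (k - j) := by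
      refine summable_of_hasFiniteSupport ((hfin.preimage (f := fun j => k - j)
        (fun a _ b _ hab => by simpa using hab)).subset fun j hj => ?_)
      intro h0
      exact hj (by simp only [h0, mul_zero])
    have h1 := hsum.hasSum.mul_right (x m)
    have h2 : HasSum (fun j => c j * x (k - j) * x m) (c (k - m) * x (k - (k - m)) * x m) := by
      refine hasSum_single (k - m) fun j hj => ?_
      rw [mul_assoc, D.loopCoef_latticeLoop_mul_of_ne hη (fun e => hj (by omega)), mul_zero]
    have h3 := h1.unique h2
    rw [sub_sub_cancel, mul_assoc] at h3
    exact h3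
  refine Subtype.ext (coef_injective (s := D.ς - 1) fun j => ?_)
  rw [← sub_eq_zero]
  set d := coef (D.ς - 1) b.1 j - coef (D.ς - 1) b'.1 j with hd
  have hsq : ∀ m, d * (x m * x m) = 0 := by
    intro m
    have e := (h (j + m)).trans (h' (j + m)).symm
    have e1 := hconv (coef (D.ς - 1) b.1) (j + m) m
    have e2 := hconv (coef (D.ς - 1) b'.1) (j + m) m
    rw [add_sub_cancel_right] at e1 e2
    rw [hd, sub_mul, ← e1, ← e2, e, sub_self]
  refine D.eq_zero_of_mul_loopCoef_latticeLoop (η := η) fun k => ?_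
  refine D.eq_zero_of_mul_loopCoef_latticeLoop (η := η) fun l => ?_
  rw [mul_assoc]
  by_cases hkl : k = l
  · subst hkl
    exact hsq k
  · rw [D.loopCoef_latticeLoop_mul_of_ne hη hkl, mul_zero]

lemma isLogDeriv_latticeLoop {η : D.tAlg} (hη : η ∈ D.lattice) :
    D.IsLogDeriv (D.latticeLoop η) (D.constForm (-η)) := by
  intro k
  rw [conv, tsum_eq_single k]
  · rw [sub_self]
    show _ * coef _ (lp.single 2 0 ((-η : D.tAlg) : Mat n)) 0 = _
    rw [coef_single, if_pos rfl]
    exact D.loopCoef_latticeLoop_mul hη k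
  · intro j hj
    show _ * coef _ (lp.single 2 0 ((-η : D.tAlg) : Mat n)) _ = _
    rw [coef_single, if_neg (sub_ne_zero.2 hj.symm), mul_zero]

lemma isAd_latticeLoop {η : D.tAlg} (hη : η ∈ D.lattice) (ξ : D.tAlg) :
    D.IsAd (D.latticeLoop η) (D.constFun ξ) (D.constFun ξ) := by
  intro s
  rw [evalAt_constFun]
  have hc : Commute (ξ : Mat n) (D.mat ((D.latticeLoop η).1 (s : UnitAddCircle))) := by
    rw [D.mat_latticeLoop hη]
    exact ((D.tAlg_commute ξ η).smul_right (-s)).exp_right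
  rw [← hc.eq, mul_assoc, mat_mul_inv, mul_one]

end LoopData

end LoopKirwan

end

/-! ### Smooth actions of a vector space, their generators and stabilizers. -/

noncomputable section

namespace LoopKirwan

/-- In a chart the curve has zero derivative on an interval, so it is locally constant; the line is
connected. -/
lemma eq_of_forall_hasMFDerivAt_zero {E : Type*} [NormedAddCommGroup E] [NormedSpace ℝ E]
    {N : Type*} [TopologicalSpace N] [ChartedSpace E N] [IsManifold 𝓘(ℝ, E) 1 N] {c : ℝ → N}
    (h : ∀ u, HasMFDerivAt 𝓘(ℝ, ℝ) 𝓘(ℝ, E) c u 0) (u v : ℝ) : c u = c v := by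
  have hcont : Continuous c := continuous_iff_continuousAt.2 fun u => (h u).continuousAt
  have hloc : IsLocallyConstant c := by
    rw [IsLocallyConstant.iff_eventually_eq]
    intro u₀
    have hsrc : c ⁻¹' (extChartAt 𝓘(ℝ, E) (c u₀)).source ∈ 𝓝 u₀ :=
      hcont.continuousAt.preimage_mem_nhds (extChartAt_source_mem_nhds _)
    obtain ⟨r, hr, hball⟩ := Metric.mem_nhds_iff.1 hsrc
    have hd : ∀ u ∈ Metric.ball u₀ r, HasFDerivAt (extChartAt 𝓘(ℝ, E) (c u₀) ∘ c) (0 : ℝ →L[ℝ] E) u := by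
      intro u hu
      have hmem : c u ∈ (chartAt E (c u₀)).source := by
        have := hball hu
        rwa [mem_preimage, extChartAt_source] at this
      have h1 := (mdifferentiableAt_extChartAt (I := 𝓘(ℝ, E)) hmem).hasMFDerivAt
      have h2 := h1.comp u (h u)
      rw [ContinuousLinearMap.comp_zero] at h2
      exact hasMFDerivAt_iff_hasFDerivAt.1 h2
    filter_upwards [Metric.ball_mem_nhds u₀ hr] with u hu
    have hconst := (convex_ball u₀ r).is_const_of_fderivWithin_eq_zero (𝕜 := ℝ)
      (f := extChartAt 𝓘(ℝ, E) (c u₀) ∘ c)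
      (fun u hu => (hd u hu).differentiableAt.differentiableWithinAt)
      (fun u hu => ((hd u hu).hasFDerivWithinAt.fderivWithin
        (Metric.isOpen_ball.uniqueDiffWithinAt hu)))
      hu (Metric.mem_ball_self hr)
    exact (extChartAt 𝓘(ℝ, E) (c u₀)).injOn (hball hu) (hball (Metric.mem_ball_self hr)) hconst
  exact hloc.apply_eq_of_isPreconnected isPreconnected_univ (mem_univ _) (mem_univ _)

/-- A smooth action of a vector space `V` on a manifold `N`. -/
structure VectorAction (V : Type*) [NormedAddCommGroup V] [NormedSpace ℝ V]
    (E : Type*) [NormedAddCommGroup E] [NormedSpace ℝ E]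
    (N : Type*) [TopologicalSpace N] [ChartedSpace E N] where
  act : V → N → N
  zero_act : ∀ x, act 0 x = x
  add_act : ∀ a b x, act (a + b) x = act a (act b x)
  smooth : ContMDiff (𝓘(ℝ, V).prod 𝓘(ℝ, E)) 𝓘(ℝ, E) ∞ (fun p : V × N => act p.1 p.2)

namespace VectorAction

variable {V : Type*} [NormedAddCommGroup V] [NormedSpace ℝ V]
  {E : Type*} [NormedAddCommGroup E] [NormedSpace ℝ E]
  {N : Type*} [TopologicalSpace N] [ChartedSpace E N] (A : VectorAction V E N)

lemma neg_act_act (b : V) (x : N) : A.act (-b) (A.act b x) = x := by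
  rw [← A.add_act, neg_add_cancel, A.zero_act]

/-- The stabilizer of a point. -/
def stab (x : N) : AddSubgroup V where
  carrier := {b | A.act b x = x}
  zero_mem' := A.zero_act x
  add_mem' := fun {a b} ha hb => by
    show A.act (a + b) x = x
    rw [A.add_act, show A.act b x = x from hb, show A.act a x = x from ha]
  neg_mem' := fun {a} ha => by
    show A.act (-a) x = x
    conv_lhs => rw [← show A.act a x = x from ha]
    exact A.neg_act_act a x

lemma mem_stab {x : N} {b : V} : b ∈ A.stab x ↔ A.act b x = x := Iff.rfl

/-- The Lie algebra of the stabilizer of a point. -/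
def stabAlg (x : N) : Submodule ℝ V := lineSubmodule (A.stab x)

/-- The vector field generated by `ξ`. -/
def gen (ξ : V) (x : N) : TangentSpace 𝓘(ℝ, E) x :=
  (mfderiv 𝓘(ℝ, ℝ) 𝓘(ℝ, E) (fun u : ℝ => A.act (-(u • ξ)) x) 0 (1 : ℝ) : E)

lemma continuous : Continuous (fun p : V × N => A.act p.1 p.2) := A.smooth.continuous

lemma isClosed_stab [T2Space N] (x : N) : IsClosed (A.stab x : Set V) :=
  isClosed_eq (A.continuous.comp (continuous_id.prodMk continuous_const)) continuous_const

lemma smooth_act (b : V) : ContMDiff 𝓘(ℝ, E) 𝓘(ℝ, E) ∞ (A.act b) :=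
  have h : ContMDiff 𝓘(ℝ, E) (𝓘(ℝ, V).prod 𝓘(ℝ, E)) ∞ (fun x : N => (b, x)) :=
    contMDiff_const.prodMk contMDiff_id
  A.smooth.comp h

lemma smooth_curve (ξ : V) (x : N) :
    ContMDiff 𝓘(ℝ, ℝ) 𝓘(ℝ, E) ∞ (fun u : ℝ => A.act (-(u • ξ)) x) := by
  have h1 : ContMDiff 𝓘(ℝ, ℝ) 𝓘(ℝ, V) ∞ (fun u : ℝ => -(u • ξ)) :=
    (contDiff_id.smul contDiff_const).neg.contMDiff
  exact A.smooth.comp (h1.prodMk contMDiff_const)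

lemma hasMFDerivAt_curve_zero (ξ : V) (x : N) :
    HasMFDerivAt 𝓘(ℝ, ℝ) 𝓘(ℝ, E) (fun u : ℝ => A.act (-(u • ξ)) x) 0
      (ContinuousLinearMap.toSpanSingleton ℝ (A.gen ξ x : E)) := by
  have h := ((A.smooth_curve ξ x).mdifferentiable (by simp) 0).hasMFDerivAt
  exact h.congr_mfderiv (ContinuousLinearMap.ext_ring (one_smul ℝ (A.gen ξ x : E)).symm)

lemma hasMFDerivAt_act (b : V) (x : N) :
    HasMFDerivAt 𝓘(ℝ, E) 𝓘(ℝ, E) (A.act b) x (mfderiv 𝓘(ℝ, E) 𝓘(ℝ, E) (A.act b) x) :=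
  ((A.smooth_act b).mdifferentiable (by simp) x).hasMFDerivAt

/-- By the group law, near time `u` the curve is the image under `A.act (-(u • ξ))` of the curve
near time `0`. -/
lemma hasMFDerivAt_curve (ξ : V) (x : N) (u : ℝ) :
    HasMFDerivAt 𝓘(ℝ, ℝ) 𝓘(ℝ, E) (fun u : ℝ => A.act (-(u • ξ)) x) u
      (ContinuousLinearMap.toSpanSingleton ℝ
        (mfderiv 𝓘(ℝ, E) 𝓘(ℝ, E) (A.act (-(u • ξ))) x (A.gen ξ x) : E)) := by
  have h0 := A.hasMFDerivAt_curve_zero ξ x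
  have hx : A.act (-((0 : ℝ) • ξ)) x = x := by rw [zero_smul, neg_zero, A.zero_act]
  have h1 := A.hasMFDerivAt_act (-(u • ξ)) x
  have hsub : HasMFDerivAt 𝓘(ℝ, ℝ) 𝓘(ℝ, ℝ) (fun v : ℝ => v - u) u (ContinuousLinearMap.id ℝ ℝ) :=
    ((hasFDerivAt_id u).sub_const u).hasMFDerivAt
  have h0' : HasMFDerivAt 𝓘(ℝ, ℝ) 𝓘(ℝ, E) (fun u : ℝ => A.act (-(u • ξ)) x) (u - u)
      (ContinuousLinearMap.toSpanSingleton ℝ (A.gen ξ x : E)) := by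
    rw [sub_self]
    exact h0
  have h2 := HasMFDerivAt.comp (f := fun v : ℝ => v - u) u h0' hsub
  have h1' : HasMFDerivAt 𝓘(ℝ, E) 𝓘(ℝ, E) (A.act (-(u • ξ)))
      (((fun u : ℝ => A.act (-(u • ξ)) x) ∘ fun v => v - u) u)
      (mfderiv 𝓘(ℝ, E) 𝓘(ℝ, E) (A.act (-(u • ξ))) x : E →L[ℝ] E) := by
    rw [show ((fun u : ℝ => A.act (-(u • ξ)) x) ∘ fun v => v - u) u = x by
      simp only [Function.comp, sub_self]; exact hx]
    exact h1
  have h3 := HasMFDerivAt.comp u h1' h2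
  have hfun : (A.act (-(u • ξ)) ∘ (fun u : ℝ => A.act (-(u • ξ)) x) ∘ fun v => v - u) =
      fun u : ℝ => A.act (-(u • ξ)) x := by
    funext v
    simp only [Function.comp]
    rw [← A.add_act]
    congr 1
    module
  rw [hfun] at h3
  refine h3.congr_mfderiv (ContinuousLinearMap.ext_ring ?_)
  refine Eq.trans ?_ (one_smul ℝ _).symm
  exact congrArg (mfderiv 𝓘(ℝ, E) 𝓘(ℝ, E) (A.act (-(u • ξ))) x : E →L[ℝ] E)
      (one_smul ℝ (A.gen ξ x : E))

/-- A vector field generated by the action vanishes exactly at the points fixed by the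
one-parameter group. -/
lemma gen_eq_zero_iff [IsManifold 𝓘(ℝ, E) ∞ N] (ξ : V) (x : N) :
    A.gen ξ x = 0 ↔ ξ ∈ A.stabAlg x := by
  constructor
  · intro h u
    have hM : IsManifold 𝓘(ℝ, E) 1 N := IsManifold.of_le (n := ∞) (by simp)
    -- At each time the velocity is the image of the generator at `x` under a differential, so it
    -- vanishes throughout.
    have hz : ∀ v, HasMFDerivAt 𝓘(ℝ, ℝ) 𝓘(ℝ, E) (fun u : ℝ => A.act (-(u • ξ)) x) v 0 := by
      intro v
      have h1 := A.hasMFDerivAt_curve ξ x v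
      rw [h, map_zero] at h1
      exact h1.congr_mfderiv (ContinuousLinearMap.ext_ring (smul_zero (1 : ℝ)))
    have := eq_of_forall_hasMFDerivAt_zero hz (-u) 0
    simp only [neg_smul, neg_neg, zero_smul, neg_zero, A.zero_act] at this
    exact this
  · intro h
    have hconst : (fun u : ℝ => A.act (-(u • ξ)) x) = fun _ => x := by
      funext u
      rw [← neg_smul]
      exact h (-u)
    rw [gen, hconst, mfderiv_const]
    rfl

end VectorAction

end LoopKirwan

end

/-! ### Isometric torus actions: short generators and semicontinuity of stabilizers. -/

noncomputable section

namespace LoopKirwan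

/-- A slow curve which starts near `m` stays near `m` for unit time. -/
lemma exists_nhds_slow_curve {W : Type*} [NormedAddCommGroup W] [NormedSpace ℝ W] [FiniteDimensional ℝ W]
    {M : Type*} [TopologicalSpace M] [T2Space M] [ChartedSpace W M] [IsManifold 𝓘(ℝ, W) ∞ M]
    (g : ContMDiffRiemannianMetric 𝓘(ℝ, W) ∞ W (TangentSpace 𝓘(ℝ, W) : M → Type _))
    {m : M} {P : Set M} (hP : P ∈ 𝓝 m) :
    ∃ O ∈ 𝓝 m, ∃ η > 0, ∀ c : ℝ → M, ContMDiff 𝓘(ℝ, ℝ) 𝓘(ℝ, W) ∞ c → c 0 ∈ O →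
      (∀ u, g.inner (c u) (mfderiv 𝓘(ℝ, ℝ) 𝓘(ℝ, W) c u (1 : ℝ))
        (mfderiv 𝓘(ℝ, ℝ) 𝓘(ℝ, W) c u (1 : ℝ)) < η) → ∀ u ∈ Icc (0 : ℝ) 1, c u ∈ P := by
  have : IsManifold 𝓘(ℝ, W) 1 M := IsManifold.of_le (n := ∞) (by simp)
  have : LocallyCompactSpace M := ChartedSpace.locallyCompactSpace W M
  let : RiemannianBundle (TangentSpace 𝓘(ℝ, W) : M → Type _) := ⟨g.toRiemannianMetric⟩
  have : IsContinuousRiemannianBundle W (TangentSpace 𝓘(ℝ, W) : M → Type _) :=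
    ⟨⟨g.inner, g.contMDiff.continuous, fun _ _ _ => rfl⟩⟩
  obtain ⟨c, hc, hsub⟩ := setOfPred_riemannianEDist_lt_subset_nhds 𝓘(ℝ, W) hP
  have hc2 : (0 : ENNReal) < c / 2 := by simpa using hc.ne'
  -- Half of the radius `c` is spent on the starting point, the other half on the length travelled;
  -- the speed enters squared.
  refine ⟨_, eventually_riemannianEDist_lt 𝓘(ℝ, W) m hc2, ((c : ℝ) / 2) ^ 2, by positivity, ?_⟩
  intro γ hγ h0 hspeed u hu
  apply hsub
  have h1 : riemannianEDist 𝓘(ℝ, W) (γ 0) (γ u) ≤ pathELength 𝓘(ℝ, W) γ 0 u :=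
    riemannianEDist_le_pathELength ((hγ.of_le (by simp)).contMDiffOn) rfl rfl hu.1
  have h2 : pathELength 𝓘(ℝ, W) γ 0 u ≤ c / 2 := by
    rw [pathELength_eq_lintegral_mfderiv_Icc]
    calc _ ≤ ∫⁻ t in Icc 0 u, ((c : ENNReal) / 2) := by
          refine MeasureTheory.lintegral_mono fun v => ?_
          have := hspeed v
          have e : ‖mfderiv 𝓘(ℝ, ℝ) 𝓘(ℝ, W) γ v (1 : ℝ)‖ ≤ (c : ℝ) / 2 := by
            refine le_of_sq_le_sq ?_ (by positivity)
            rw [← real_inner_self_eq_norm_sq]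
            exact this.le
          rw [← ofReal_norm]
          refine (ENNReal.ofReal_le_ofReal e).trans ?_
          rw [ENNReal.ofReal_div_of_pos (by norm_num), ENNReal.ofReal_coe_nnreal]
          simp
      _ ≤ _ := by
          rw [MeasureTheory.setLIntegral_const, Real.volume_Icc]
          refine mul_le_of_le_one_right' ?_
          simpa using hu.2
  calc _ ≤ _ := riemannianEDist_triangle (y := γ 0)
    _ < c / 2 + c / 2 := ENNReal.add_lt_add_of_lt_of_le (ne_top_of_le_ne_top (by finiteness) (h1.trans h2)) h0 (h1.trans h2)
    _ = c := ENNReal.add_halves _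

namespace VectorAction

variable {V : Type*} [NormedAddCommGroup V] [NormedSpace ℝ V] [FiniteDimensional ℝ V]
  {W : Type*} [NormedAddCommGroup W] [NormedSpace ℝ W] [FiniteDimensional ℝ W]
  {M : Type*} [TopologicalSpace M] [T2Space M] [ChartedSpace W M] [IsManifold 𝓘(ℝ, W) ∞ M]
  (A : VectorAction V W M)
  (g : ContMDiffRiemannianMetric 𝓘(ℝ, W) ∞ W (TangentSpace 𝓘(ℝ, W) : M → Type _))

/-- The action preserves the Riemannian metric. -/
def IsIsometric : Prop := ∀ (b : V) (m : M) (v w : TangentSpace 𝓘(ℝ, W) m),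
  g.inner (A.act b m) (mfderiv 𝓘(ℝ, W) 𝓘(ℝ, W) (A.act b) m v)
    (mfderiv 𝓘(ℝ, W) 𝓘(ℝ, W) (A.act b) m w) = g.inner m v w

variable {A g} {Λ : AddSubgroup V} {F : Set V}

/-- Orbits of one-parameter groups of isometries have constant speed. A bound on the generator at
one point thus controls the whole curve. -/
lemma IsIsometric.inner_curve (h : A.IsIsometric g) (ξ : V) (m : M) (u : ℝ) :
    g.inner (A.act (-(u • ξ)) m)
      (mfderiv 𝓘(ℝ, ℝ) 𝓘(ℝ, W) (fun u : ℝ => A.act (-(u • ξ)) m) u (1 : ℝ))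
      (mfderiv 𝓘(ℝ, ℝ) 𝓘(ℝ, W) (fun u : ℝ => A.act (-(u • ξ)) m) u (1 : ℝ)) =
    g.inner m (A.gen ξ m) (A.gen ξ m) := by
  rw [← h (-(u • ξ)) m, (A.hasMFDerivAt_curve ξ m u).mfderiv]
  have e : (ContinuousLinearMap.toSpanSingleton ℝ
      (mfderiv 𝓘(ℝ, W) 𝓘(ℝ, W) (A.act (-(u • ξ))) m (A.gen ξ m) : W)) (1 : ℝ) =
      mfderiv 𝓘(ℝ, W) 𝓘(ℝ, W) (A.act (-(u • ξ))) m (A.gen ξ m) := one_smul ℝ _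
  exact congrArg₂ (fun v w => g.inner (A.act (-(u • ξ)) m) v w) e e

lemma exists_infDist_eq_norm {k : Submodule ℝ V} (v : V) :
    ∃ s ∈ k, ‖v - s‖ = Metric.infDist v k := by
  obtain ⟨s, hs, h⟩ := (Submodule.closed_of_finiteDimensional k).exists_infDist_eq_dist
    ⟨0, k.zero_mem⟩ v
  exact ⟨s, hs, by rw [h, dist_eq_norm]⟩

lemma infDist_sub_mem {k : Submodule ℝ V} (v : V) {s : V} (hs : s ∈ k) :
    Metric.infDist (v - s) k = Metric.infDist v k := by
  have key : ∀ (v : V) {s : V}, s ∈ k → Metric.infDist (v - s) k ≤ Metric.infDist v k := by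
    intro v s hs
    obtain ⟨r, hr, e⟩ := exists_infDist_eq_norm (k := k) v
    rw [← e]
    refine (Metric.infDist_le_dist_of_mem (k.sub_mem hr hs)).trans_eq ?_
    rw [dist_eq_norm]
    congr 1
    abel
  refine le_antisymm (key v hs) ?_
  have := key (v - s) (k.neg_mem hs)
  rwa [sub_neg_eq_add, sub_add_cancel] at this

lemma infDist_smul {k : Submodule ℝ V} (v : V) {u : ℝ} (hu : u ≠ 0) :
    Metric.infDist (u • v) k = |u| * Metric.infDist v k := by
  have key : ∀ (v : V) (u : ℝ), Metric.infDist (u • v) k ≤ |u| * Metric.infDist v k := by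
    intro v u
    obtain ⟨r, hr, e⟩ := exists_infDist_eq_norm (k := k) v
    rw [← e]
    refine (Metric.infDist_le_dist_of_mem (k.smul_mem u hr)).trans_eq ?_
    rw [dist_eq_norm, ← smul_sub, norm_smul, Real.norm_eq_abs]
  refine le_antisymm (key v u) ?_
  have := key (u • v) u⁻¹
  rwa [inv_smul_smul₀ hu, abs_inv, le_inv_mul_iff₀ (abs_pos.2 hu)] at this

/-- Where a generating vector field of a torus action is short, its generator is close to the
stabilizer algebra of a nearby point. -/
lemma IsIsometric.exists_nhds_infDist_lt (h : A.IsIsometric g) (hΛ : ∀ m, Λ ≤ A.stab m)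
    (hF : IsCompact F) (hFΛ : ∀ w : V, ∃ s ∈ Λ, w - s ∈ F) (m : M) {δ : ℝ} (hδ : 0 < δ) :
    ∃ O ∈ 𝓝 m, ∃ η > 0, ∀ m' ∈ O, ∀ ξ : V, g.inner m' (A.gen ξ m') (A.gen ξ m') < η →
      Metric.infDist ξ (A.stabAlg m) < δ := by
  obtain ⟨ε, hε, hball⟩ := exists_ball_subset_lineSubmodule (A.isClosed_stab m)
  obtain ⟨F', hF', hF'k, hred⟩ :=
    exists_compact_fundamental_lineSubmodule (A.isClosed_stab m) (hΛ m) hF hFΛ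
  -- With `r < ε`, a vector of norm `r` at distance `r` from the stabilizer algebra cannot stabilize
  -- `m`. With `r ≤ δ`, a ray whose generator has distance at least `δ` reaches distance `r` within
  -- unit time.
  obtain ⟨r, hr, hrε, hrδ⟩ : ∃ r : ℝ, 0 < r ∧ r < ε ∧ r ≤ δ :=
    ⟨min (ε / 2) δ, by positivity, (min_le_left _ _).trans_lt (by linarith), min_le_right _ _⟩
  -- Modulo `Λ`, vectors at distance `r` from the stabilizer algebra reduce to the compact set `C +
  -- F'`. All elements of that set displace `m`, and by compactness they displace nearby points out
  -- of a neighborhood.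
  let C : Set V := Metric.sphere 0 r ∩ {v | Metric.infDist v (A.stabAlg m) = r}
  have hC : IsCompact C := (isCompact_sphere 0 r).inter_right
    (isClosed_eq (Metric.continuous_infDist_pt _) continuous_const)
  have hCF : IsCompact (C + F') := hC.add hF'
  have hne : ∀ b ∈ C + F', A.act b m ≠ m := by
    rintro _ ⟨v, hv, f, hf, rfl⟩ heq
    have hvs : v ∈ A.stab m := by
      have := (A.stab m).sub_mem (show v + f ∈ A.stab m from heq) (lineSubmodule_le (hF'k hf))
      rwa [add_sub_cancel_right] at this
    have hvn : ‖v‖ = r := by simpa using hv.1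
    have hv0 := Metric.infDist_zero_of_mem (hball v hvs (by rw [hvn]; exact hrε))
    have : Metric.infDist v (A.stabAlg m) = r := hv.2
    rw [stabAlg, hv0] at this
    exact hr.ne this
  have hopen : IsOpen {p : V × (M × M) | A.act p.1 p.2.1 ≠ p.2.2} :=
    isOpen_ne_fun (A.continuous.comp (continuous_fst.prodMk (continuous_fst.comp continuous_snd)))
      (continuous_snd.comp continuous_snd)
  obtain ⟨S, O, hSo, hOo, hCS, hmO, hSO⟩ := generalized_tube_lemma hCF
    (isCompact_singleton (x := (m, m))) hopen (by
      rintro ⟨b, p⟩ ⟨hb, hp⟩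
      obtain rfl : p = (m, m) := hp
      exact hne b hb)
  have hO : O ∈ 𝓝 (m, m) := hOo.mem_nhds (hmO rfl)
  rw [nhds_prod_eq, mem_prod_iff] at hO
  obtain ⟨O₁, hO₁, P, hP, hOP⟩ := hO
  obtain ⟨O₂, hO₂, η, hη, hcurve⟩ := exists_nhds_slow_curve g hP
  refine ⟨O₁ ∩ O₂, inter_mem hO₁ hO₂, η, hη, fun m' hm' ξ hξ => ?_⟩
  by_contra! hcon
  have hd : 0 < Metric.infDist ξ (A.stabAlg m) := hδ.trans_le hcon
  have hu0 : 0 < r / Metric.infDist ξ (A.stabAlg m) := by positivity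
  -- At this time the curve has exactly distance `r` from the stabilizer algebra in `V`, while being
  -- slow it has not left `P`. Subtracting a lattice vector `l`, which acts trivially, puts the
  -- group element in `C + F'`, which contradicts the choice of the tube.
  set u : ℝ := r / Metric.infDist ξ (A.stabAlg m) with hu
  have hu1 : u ≤ 1 := (div_le_one hd).2 (hrδ.trans hcon)
  have hmem := hcurve (fun u : ℝ => A.act (-(u • ξ)) m') (A.smooth_curve ξ m')
    (by simpa [A.zero_act] using hm'.2) (fun v => by rwa [h.inner_curve ξ m' v]) u ⟨hu0.le, hu1⟩
  obtain ⟨s, hs, hsn⟩ := exists_infDist_eq_norm (k := A.stabAlg m) (-(u • ξ))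
  have hdist : Metric.infDist (-(u • ξ)) (A.stabAlg m) = r := by
    rw [← neg_smul, infDist_smul ξ (neg_ne_zero.2 hu0.ne'), abs_neg, abs_of_pos hu0, hu,
      div_mul_cancel₀ _ hd.ne']
  obtain ⟨l, hl, hlk, hlF⟩ := hred s hs
  have hb : -(u • ξ) - s + (s - l) ∈ C + F' := by
    refine Set.add_mem_add ⟨?_, ?_⟩ hlF
    · rw [mem_sphere_zero_iff_norm, hsn, hdist]
    · rw [mem_ofPred_eq, infDist_sub_mem _ hs, hdist]
  have hcontra := @hSO (-(u • ξ) - s + (s - l), (m', A.act (-(u • ξ)) m'))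
    ⟨hCS hb, hOP ⟨hm'.1, hmem⟩⟩
  apply hcontra
  show A.act (-(u • ξ) - s + (s - l)) m' = A.act (-(u • ξ)) m'
  have hl' : A.act (-l) m' = m' := (A.stab m').neg_mem (hΛ m' hl)
  rw [show -(u • ξ) - s + (s - l) = -(u • ξ) + -l by abel, A.add_act, hl']

/-- The stabilizer algebras at nearby points are contained in that of the given point. -/
lemma IsIsometric.eventually_stabAlg_le (h : A.IsIsometric g) (hΛ : ∀ m, Λ ≤ A.stab m)
    (hF : IsCompact F) (hFΛ : ∀ w : V, ∃ s ∈ Λ, w - s ∈ F) (m : M) :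
    ∀ᶠ m' in 𝓝 m, A.stabAlg m' ≤ A.stabAlg m := by
  obtain ⟨O, hO, η, hη, hall⟩ := h.exists_nhds_infDist_lt hΛ hF hFΛ m one_pos
  filter_upwards [hO] with m' hm' ξ hξ
  by_contra hcon
  have hd : 0 < Metric.infDist ξ (A.stabAlg m) :=
    ((Submodule.closed_of_finiteDimensional (A.stabAlg m)).notMem_iff_infDist_pos
      ⟨0, (A.stabAlg m).zero_mem⟩).1 hcon
  have hu : 0 < (Metric.infDist ξ (A.stabAlg m))⁻¹ := inv_pos.2 hd
  -- All multiples of `ξ` generate zero at `m'`; the one at distance exactly `1` violates the bound.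
  have h1 := hall m' hm' ((Metric.infDist ξ (A.stabAlg m))⁻¹ • ξ) (by
    rw [(A.gen_eq_zero_iff _ m').2 ((A.stabAlg m').smul_mem _ hξ)]
    simpa using hη)
  rw [infDist_smul ξ hu.ne', abs_of_pos hu, inv_mul_cancel₀ hd.ne'] at h1
  exact lt_irrefl _ h1

end VectorAction

end LoopKirwan

end

/-! ### Stabilizers in orthogonal representations, and invariant means. -/

noncomputable section

namespace LoopKirwan

/-- An orthogonal representation of an abelian group on a finite dimensional space has only
finitely many stabilizers of vectors. -/
lemma finite_range_fixed {V : Type*} [AddCommGroup V] {W : Type*} [AddCommGroup W] [Module ℝ W]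
    [FiniteDimensional ℝ W] (B : W →ₗ[ℝ] W →ₗ[ℝ] ℝ) (hsymm : ∀ v w, B v w = B w v)
    (hpos : ∀ v, v ≠ 0 → 0 < B v v) (L : V → W →ₗ[ℝ] W) (h0 : L 0 = LinearMap.id)
    (hadd : ∀ a b, L (a + b) = L a ∘ₗ L b) (hiso : ∀ a v w, B (L a v) (L a w) = B v w) :
    (Set.range fun w : W => {a : V | L a w = w}).Finite := by
  let core : InnerProductSpace.Core ℝ W :=
    { inner := fun v w => B v w
      conj_inner_symm := fun v w => hsymm w v
      re_inner_nonneg := fun v => by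
        by_cases hv : v = 0
        · simp [hv]
        · exact (hpos v hv).le
      add_left := fun u v w => by simp
      smul_left := fun u v r => by simp
      definite := fun v hv => by
        by_contra hne
        exact (hpos v hne).ne' hv }
  let _ : NormedAddCommGroup W := core.toNormedAddCommGroup
  let _ : InnerProductSpace ℝ W := InnerProductSpace.ofCore core.toCore
  have hinner : ∀ v w : W, inner ℝ v w = B v w := fun v w => rfl
  have hneg : ∀ a w, L a (L (-a) w) = w := fun a w => by
    rw [← LinearMap.comp_apply, ← hadd, add_neg_cancel, h0, LinearMap.id_apply]
  have hadj : ∀ a v w, B (L a v) w = B v (L (-a) w) := fun a v w => by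
    rw [← hiso a v, hneg]
  -- `L a` is orthogonal with adjoint `L (-a)`. The operators `S a` are symmetric and commute, so
  -- they can be diagonalized simultaneously over the reals.
  let S : V → W →ₗ[ℝ] W := fun a => L a + L (-a)
  have hS : ∀ a, (S a).IsSymmetric := fun a v w => by
    rw [hinner, hinner]
    have h1 := hadj (-a) v w
    rw [neg_neg] at h1
    simp only [S, LinearMap.add_apply, map_add, hadj a v w, h1]
    ring
  have hLc : ∀ a b, L a * L b = L b * L a := fun a b => by
    rw [Module.End.mul_eq_comp, Module.End.mul_eq_comp, ← hadd, ← hadd, add_comm]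
  have hC : Pairwise (Function.onFun Commute S) := fun a b _ => by
    show (L a + L (-a)) * (L b + L (-b)) = (L b + L (-b)) * (L a + L (-a))
    rw [add_mul, mul_add, mul_add, mul_add, add_mul, add_mul, hLc a b, hLc a (-b), hLc (-a) b,
      hLc (-a) (-b)]
  -- The converse follows from `|L a w - w|² = 2 |w|² - ⟨S a w, w⟩`.
  have hfix : ∀ a w, L a w = w ↔ S a w = (2 : ℝ) • w := fun a w => by
    constructor
    · intro h
      have h' : L (-a) w = w := by
        conv_lhs => rw [← h]
        simpa using hneg (-a) w
      simp only [S, LinearMap.add_apply, h, h', two_smul]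
    · intro h
      have h1 : B (L a w - w) (L a w - w) = 2 * B w w - B (S a w) w := by
        have e : B (L (-a) w) w = B w (L a w) := by simpa using hadj (-a) w w
        simp only [S, LinearMap.add_apply, map_sub, LinearMap.sub_apply, hiso, map_add, e,
          hsymm (L a w) w]
        ring
      rw [h, map_smul, LinearMap.smul_apply, smul_eq_mul, sub_self] at h1
      by_contra hne
      exact (hpos _ (sub_ne_zero.2 hne)).ne' h1
  let Eig : (V → ℝ) → Submodule ℝ W := fun χ => ⨅ a, Module.End.eigenspace (S a) (χ a)
  have htop : ⨆ χ, Eig χ = ⊤ := LinearMap.IsSymmetric.iSup_iInf_eq_top_of_commute hS hC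
  have hfin : {χ | Eig χ ≠ ⊥}.Finite := WellFoundedGT.finite_ne_bot_of_iSupIndep
    (LinearMap.IsSymmetric.orthogonalFamily_iInf_eigenspaces hS).independent
  have hSe : ∀ χ a, ∀ e ∈ Eig χ, ∀ w, B e (S a w) = χ a * B e w := fun χ a e he w => by
    have h1 : S a e = χ a • e := Module.End.mem_eigenspace_iff.1 ((Submodule.mem_iInf _).1 he a)
    have h2 : B (S a e) w = B e (S a w) := hS a e w
    rw [← h2, h1, map_smul, LinearMap.smul_apply, smul_eq_mul]
  -- The stabilizer of `w` depends only on the set of joint eigenspaces to which `w` is not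
  -- orthogonal, and there are finitely many such sets.
  refine (hfin.finite_subsets.image fun T => {a | ∀ χ ∈ T, χ a = 2}).subset ?_
  rintro _ ⟨w, rfl⟩
  refine ⟨{χ | ∃ e ∈ Eig χ, B e w ≠ 0}, ?_, ?_⟩
  · rintro χ ⟨e, he, hne⟩ hbot
    rw [hbot, Submodule.mem_bot] at he
    simp [he] at hne
  · ext a
    simp only [mem_ofPred_eq]
    rw [hfix]
    constructor
    · intro h
      have hz : ∀ u ∈ (⨆ χ, Eig χ), B u (S a w - (2 : ℝ) • w) = 0 := fun u hu => by
        refine Submodule.iSup_induction Eig (motive := fun u => B u (S a w - (2 : ℝ) • w) = 0)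
          hu ?_ (by simp) (fun u v h1 h2 => by simp only [map_add, LinearMap.add_apply, h1, h2, add_zero])
        intro χ e he
        rw [map_sub, hSe χ a e he, map_smul, smul_eq_mul]
        by_cases hne : B e w = 0
        · rw [hne, mul_zero, mul_zero, sub_zero]
        · rw [h χ ⟨e, he, hne⟩, sub_self]
      by_contra hne
      exact (hpos _ (sub_ne_zero.2 hne)).ne' (hz _ (by rw [htop]; trivial))
    · rintro h χ ⟨e, he, hne⟩
      have h1 := hSe χ a e he w
      rw [h, map_smul, smul_eq_mul] at h1
      exact (mul_right_cancel₀ hne h1).symm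

/-- Continuous functions on a finite dimensional space which are periodic under a closed cocompact
subgroup have an invariant mean. -/
lemma exists_mean {V : Type*} [NormedAddCommGroup V] {Λ : AddSubgroup V}
    (hΛ : IsClosed (Λ : Set V)) {F : Set V} (hF : IsCompact F) (hFΛ : ∀ w : V, ∃ s ∈ Λ, w - s ∈ F)
    {W : Type*} [NormedAddCommGroup W] [NormedSpace ℝ W] [CompleteSpace W] :
    ∃ I : (V → W) → W,
      (∀ f, Continuous f → (∀ b, ∀ l ∈ Λ, f (b + l) = f b) →
        (∀ a, I (fun b => f (b + a)) = I f) ∧ (∀ T : W →L[ℝ] W, I (fun b => T (f b)) = T (I f)) ∧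
        (∀ h, Continuous h → (∀ b, ∀ l ∈ Λ, h (b + l) = h b) →
          I (fun b => f b - h b) = I f - I h) ∧
        ∀ C, (∀ b, ‖f b‖ ≤ C) → ‖I f‖ ≤ C) ∧ ∀ c, I (fun _ => c) = c := by
  let _ : MeasurableSpace (V ⧸ Λ) := borel _
  have : BorelSpace (V ⧸ Λ) := ⟨rfl⟩
  have : T2Space (V ⧸ Λ) := inferInstance
  have hmkc : Continuous (QuotientAddGroup.mk : V → V ⧸ Λ) := QuotientAddGroup.continuous_mk
  have hcov : (univ : Set (V ⧸ Λ)) = QuotientAddGroup.mk '' F := by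
    refine (eq_univ_of_forall fun q => ?_).symm
    obtain ⟨w, rfl⟩ := QuotientAddGroup.mk_surjective q
    obtain ⟨s, hs, hw⟩ := hFΛ w
    refine ⟨w - s, hw, ?_⟩
    rw [QuotientAddGroup.eq]
    simpa using hs
  have : CompactSpace (V ⧸ Λ) := ⟨by rw [hcov]; exact hF.image hmkc⟩
  -- The mean is the integral over the compact quotient for its normalized Haar measure. For a
  -- periodic function the choice of representatives in `V` does not matter.
  let μ : MeasureTheory.Measure (V ⧸ Λ) := MeasureTheory.Measure.addHaarMeasure ⊤
  have hμ : μ univ = 1 := MeasureTheory.Measure.addHaarMeasure_self (K₀ := ⊤)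
  have : MeasureTheory.IsProbabilityMeasure μ := ⟨hμ⟩
  have hout : ∀ {f : V → W}, (∀ b, ∀ l ∈ Λ, f (b + l) = f b) →
      ∀ b : V, f (Quotient.out (b : V ⧸ Λ)) = f b := fun {f} hf b => by
    have h1 : ((Quotient.out (b : V ⧸ Λ) : V) : V ⧸ Λ) = b := Quotient.out_eq _
    have h2 := QuotientAddGroup.eq.1 h1.symm
    have h3 := hf b _ h2
    rwa [add_neg_cancel_left] at h3
  have hcont : ∀ {f : V → W}, Continuous f → (∀ b, ∀ l ∈ Λ, f (b + l) = f b) →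
      Continuous fun q : V ⧸ Λ => f (Quotient.out q) := fun {f} hc hf => by
    rw [(QuotientAddGroup.isQuotientMap_mk Λ).continuous_iff]
    exact hc.congr fun b => (hout hf b).symm
  have hint : ∀ {f : V → W}, Continuous f → (∀ b, ∀ l ∈ Λ, f (b + l) = f b) →
      MeasureTheory.Integrable (fun q : V ⧸ Λ => f (Quotient.out q)) μ := fun hc hf =>
    (hcont hc hf).integrable_of_hasCompactSupport (HasCompactSupport.of_compactSpace _)
  refine ⟨fun f => ∫ q : V ⧸ Λ, f (Quotient.out q) ∂μ, fun f hc hf => ⟨fun a => ?_, fun T => ?_,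
    fun h hhc hh => ?_, fun C hC => ?_⟩, fun c => ?_⟩
  · refine Eq.trans ?_ (MeasureTheory.integral_add_right_eq_self (μ := μ)
      (fun q => f (Quotient.out q)) (a : V ⧸ Λ))
    refine congrArg (fun h : V ⧸ Λ → W => ∫ q, h q ∂μ) (funext fun q => ?_)
    obtain ⟨b, rfl⟩ := QuotientAddGroup.mk_surjective q
    refine (hout (f := fun b => f (b + a)) (fun b l hl => ?_) b).trans (hout hf (b + a)).symm
    show f (b + l + a) = f (b + a)
    rw [add_right_comm]
    exact hf _ l hl
  · exact T.integral_comp_comm (hint hc hf)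
  · exact MeasureTheory.integral_sub (hint hc hf) (hint hhc hh)
  · refine (MeasureTheory.norm_integral_le_of_norm_le_const
      (MeasureTheory.ae_of_all _ fun q => hC _)).trans_eq ?_
    simp
  · simp

end LoopKirwan

end

/-! ### Linearization of a torus action near a fixed point. -/

noncomputable section

namespace LoopKirwan

section Linearization

variable {V : Type*} [NormedAddCommGroup V] [NormedSpace ℝ V]
  {W : Type*} [NormedAddCommGroup W] [NormedSpace ℝ W]
  {Λ : AddSubgroup V} {F : Set V} {Φ : V → W → W} {w₀ : W} {L : V → W →L[ℝ] W}

/-- Joint strict differentiability controls `Φ b` by `L b₀` for `b` near `b₀`. It also bounds `L b -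
L b₀`, and each of the two contributes half of `ε`. Covering a compact set of `b` by such
neighborhoods then gives a uniform estimate. -/
lemma norm_sub_sub_le_of_strict
    (hL : ∀ b, HasFDerivAt (Φ b) (L b) w₀) {b₀ : V} {D : V × W →L[ℝ] W}
    (hD : HasStrictFDerivAt (fun p : V × W => Φ p.1 p.2) D (b₀, w₀)) {ε : ℝ} (hε : 0 < ε) :
    ∃ U ∈ 𝓝 b₀, (∃ ρ > 0, ∀ b ∈ U, ∀ w ∈ Metric.ball w₀ ρ, ∀ w' ∈ Metric.ball w₀ ρ,
      ‖Φ b w - Φ b w' - L b (w - w')‖ ≤ ε * ‖w - w'‖) ∧ ∀ b ∈ U, ‖L b - L b₀‖ ≤ ε := by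
  have hb₀ : L b₀ = D ∘L ContinuousLinearMap.inr ℝ V W := by
    refine (hL b₀).unique ?_
    exact HasFDerivAt.comp w₀ hD.hasFDerivAt (hasFDerivAt_prodMk_right b₀ w₀)
  have h1 := (hD.isLittleO.def (half_pos hε))
  obtain ⟨S, hS, hSS⟩ := mem_prod_same_iff.1 (by rw [nhds_prod_eq] at h1; exact h1)
  rw [nhds_prod_eq, mem_prod_iff] at hS
  obtain ⟨U, hU, Z, hZ, hUZ⟩ := hS
  obtain ⟨ρ, hρ, hball⟩ := Metric.mem_nhds_iff.1 hZ
  have key : ∀ b ∈ U, ∀ w ∈ Metric.ball w₀ ρ, ∀ w' ∈ Metric.ball w₀ ρ,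
      ‖Φ b w - Φ b w' - L b₀ (w - w')‖ ≤ ε / 2 * ‖w - w'‖ := by
    intro b hb w hw w' hw'
    have h2 := @hSS ((b, w), (b, w')) ⟨hUZ ⟨hb, hball hw⟩, hUZ ⟨hb, hball hw'⟩⟩
    simp only [mem_ofPred_eq, Prod.mk_sub_mk, sub_self, Prod.norm_mk, norm_zero,
      norm_nonneg, sup_of_le_right] at h2
    rw [hb₀]
    simpa using h2
  have hLb : ∀ b ∈ U, ‖L b - L b₀‖ ≤ ε / 2 := by
    intro b hb
    refine ((hL b).sub (L b₀).hasFDerivAt).le_of_lip' (half_pos hε).le ?_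
    filter_upwards [Metric.ball_mem_nhds w₀ hρ] with w hw
    have h3 := key b hb w hw w₀ (Metric.mem_ball_self hρ)
    rw [map_sub] at h3
    convert h3 using 2
    simp only [Pi.sub_apply]
    abel
  refine ⟨U, hU, ⟨ρ, hρ, fun b hb w hw w' hw' => ?_⟩, fun b hb => (hLb b hb).trans (by linarith)⟩
  calc ‖Φ b w - Φ b w' - L b (w - w')‖
      = ‖(Φ b w - Φ b w' - L b₀ (w - w')) - (L b - L b₀) (w - w')‖ := by
        congr 1
        simp only [sub_apply]
        abel
    _ ≤ ε / 2 * ‖w - w'‖ + ε / 2 * ‖w - w'‖ :=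
        (norm_sub_le _ _).trans (add_le_add (key b hb w hw w' hw')
          ((ContinuousLinearMap.le_opNorm _ _).trans
            (mul_le_mul_of_nonneg_right (hLb b hb) (norm_nonneg _))))
    _ = ε * ‖w - w'‖ := by ring

variable [CompleteSpace W]

/-- Near a fixed point, a torus action can be linearized by averaging. -/
lemma exists_linearization (hΛ : IsClosed (Λ : Set V)) (hF : IsCompact F)
    (hFΛ : ∀ w : V, ∃ s ∈ Λ, w - s ∈ F)
    (hstrict : ∀ b, ∃ D : V × W →L[ℝ] W,
      HasStrictFDerivAt (fun p : V × W => Φ p.1 p.2) D (b, w₀))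
    (hL : ∀ b, HasFDerivAt (Φ b) (L b) w₀) (hfix : ∀ b, Φ b w₀ = w₀)
    (hper : ∀ b, ∀ l ∈ Λ, Φ (b + l) = Φ b)
    (hcont : ∀ᶠ w in 𝓝 w₀, Continuous fun b => Φ b w)
    (hadd : ∀ᶠ w in 𝓝 w₀, ∀ a b, Φ (a + b) w = Φ a (Φ b w))
    (hzero : ∀ᶠ w in 𝓝 w₀, Φ 0 w = w) :
    L 0 = ContinuousLinearMap.id ℝ W ∧ (∀ a b, L (a + b) = L a ∘L L b) ∧
      ∃ θ : W → W, ∀ᶠ w in 𝓝 w₀, ∀ b, Φ b w = w ↔ L b (θ w) = θ w := by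
  have hL0 : L 0 = ContinuousLinearMap.id ℝ W :=
    (hL 0).unique ((hasFDerivAt_id w₀).congr_of_eventuallyEq hzero)
  have hLadd : ∀ a b, L (a + b) = L a ∘L L b := fun a b => by
    refine (hL (a + b)).unique ?_
    have h1 : HasFDerivAt (Φ a) (L a) (Φ b w₀) := by
      rw [hfix]
      exact hL a
    refine (h1.comp w₀ (hL b)).congr_of_eventuallyEq ?_
    filter_upwards [hadd] with w hw using hw a b
  have hLper : ∀ b, ∀ l ∈ Λ, L (b + l) = L b := fun b l hl => by
    refine (hL (b + l)).unique ?_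
    rw [hper b l hl]
    exact hL b
  have hred : ∀ b, ∃ f ∈ F, Φ b = Φ f ∧ L b = L f := fun b => by
    obtain ⟨s, hs, hb⟩ := hFΛ b
    refine ⟨b - s, hb, ?_, ?_⟩
    · rw [← hper (b - s) s hs, sub_add_cancel]
    · rw [← hLper (b - s) s hs, sub_add_cancel]
  have hLcont : Continuous L := by
    refine continuous_iff_continuousAt.2 fun b₀ => ?_
    obtain ⟨D, hD⟩ := hstrict b₀
    refine Metric.tendsto_nhds.2 fun ε hε => ?_
    obtain ⟨U, hU, -, hUL⟩ := norm_sub_sub_le_of_strict hL hD (half_pos hε)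
    filter_upwards [hU] with b hb
    rw [dist_eq_norm]
    exact (hUL b hb).trans_lt (by linarith)
  obtain ⟨C, hC, hLC⟩ : ∃ C > 0, ∀ b, ‖L b‖ ≤ C := by
    obtain ⟨C, hC⟩ := hF.exists_bound_of_continuousOn hLcont.continuousOn
    refine ⟨max C 1, by positivity, fun b => ?_⟩
    obtain ⟨f, hf, -, e⟩ := hred b
    rw [e]
    exact (hC f hf).trans (le_max_left _ _)
  have hunif : ∀ ε > 0, ∃ ρ > 0, ∀ b, ∀ w ∈ Metric.ball w₀ ρ, ∀ w' ∈ Metric.ball w₀ ρ,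
      ‖Φ b w - Φ b w' - L b (w - w')‖ ≤ ε * ‖w - w'‖ := by
    intro ε hε
    have h1 : ∃ ρ > 0, ∀ b ∈ F, ∀ w ∈ Metric.ball w₀ ρ, ∀ w' ∈ Metric.ball w₀ ρ,
        ‖Φ b w - Φ b w' - L b (w - w')‖ ≤ ε * ‖w - w'‖ := by
      refine hF.induction_on (p := fun s => ∃ ρ > 0, ∀ b ∈ s, ∀ w ∈ Metric.ball w₀ ρ,
        ∀ w' ∈ Metric.ball w₀ ρ, ‖Φ b w - Φ b w' - L b (w - w')‖ ≤ ε * ‖w - w'‖)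
        ⟨1, one_pos, by simp⟩ ?_ ?_ ?_
      · rintro s t hst ⟨ρ, hρ, h⟩
        exact ⟨ρ, hρ, fun b hb => h b (hst hb)⟩
      · rintro s t ⟨ρ, hρ, h⟩ ⟨ρ', hρ', h'⟩
        refine ⟨min ρ ρ', lt_min hρ hρ', ?_⟩
        rintro b (hb | hb) w hw w' hw'
        · exact h b hb w (Metric.ball_subset_ball (min_le_left _ _) hw) w'
            (Metric.ball_subset_ball (min_le_left _ _) hw')
        · exact h' b hb w (Metric.ball_subset_ball (min_le_right _ _) hw) w'
            (Metric.ball_subset_ball (min_le_right _ _) hw')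
      · intro b _
        obtain ⟨D, hD⟩ := hstrict b
        obtain ⟨U, hU, h, -⟩ := norm_sub_sub_le_of_strict hL hD hε
        exact ⟨U, mem_nhdsWithin_of_mem_nhds hU, h⟩
    obtain ⟨ρ, hρ, h⟩ := h1
    refine ⟨ρ, hρ, fun b => ?_⟩
    obtain ⟨f, hf, e, e'⟩ := hred b
    rw [e, e']
    exact h f hf
  -- After applying `L (-b)`, of norm at most `C`, the remaining error is at most half of `‖w -
  -- w'‖`, which is enough for injectivity of the average.
  obtain ⟨ρ, hρ, hest⟩ := hunif (1 / (2 * C)) (by positivity)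
  obtain ⟨I, hI, hIc⟩ := exists_mean hΛ hF hFΛ (W := W)
  -- The average of this over `b` intertwines `Φ` with its linearization `L`, by invariance of the
  -- mean.
  let f : W → V → W := fun w b => L (-b) (Φ b w - w₀)
  have hLneg : ∀ b v, L (-b) (L b v) = v := fun b v => by
    rw [← ContinuousLinearMap.comp_apply, ← hLadd, neg_add_cancel, hL0]
    rfl
  have hfper : ∀ w b, ∀ l ∈ Λ, f w (b + l) = f w b := fun w b l hl => by
    simp only [f]
    rw [hper b l hl, neg_add, hLper _ _ (Λ.neg_mem hl)]
  have hfcont : ∀ᶠ w in 𝓝 w₀, Continuous (f w) := by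
    filter_upwards [hcont] with w hw
    exact (hLcont.comp continuous_neg).clm_apply (hw.sub continuous_const)
  let θ : W → W := fun w => I (f w)
  have hθ : ∀ᶠ w in 𝓝 w₀, ∀ b, θ (Φ b w) = L b (θ w) := by
    filter_upwards [hfcont, hadd] with w hw hw' b
    obtain ⟨h1, -, -, -⟩ := hI (f w) hw (hfper w)
    have hwb : Continuous fun a => f w (a + b) := hw.comp (continuous_id.add continuous_const)
    obtain ⟨-, h2, -, -⟩ := hI (fun a => f w (a + b)) hwb (fun a l hl => by
      rw [add_right_comm]
      exact hfper w _ l hl)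
    show I (f (Φ b w)) = L b (I (f w))
    rw [← h1 b, ← h2 (L b)]
    congr 1
    funext a
    simp only [f]
    rw [hw', ← ContinuousLinearMap.comp_apply, ← hLadd]
    congr 2
    abel
  have hinj : ∃ U ∈ 𝓝 w₀, InjOn θ U := by
    refine ⟨_, inter_mem (Metric.ball_mem_nhds w₀ hρ) hfcont, ?_⟩
    rintro w ⟨hw, hwc⟩ w' ⟨hw', hwc'⟩ heq
    obtain ⟨-, -, h3, -⟩ := hI (f w) hwc (hfper w)
    have hdc : Continuous fun b => f w b - f w' b := hwc.sub hwc'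
    have hdp : ∀ b, ∀ l ∈ Λ, f w (b + l) - f w' (b + l) = f w b - f w' b := fun b l hl => by
      rw [hfper w b l hl, hfper w' b l hl]
    obtain ⟨-, -, h4, -⟩ := hI (fun b => f w b - f w' b) hdc hdp
    have h5 := h4 (fun _ => w - w') continuous_const (fun _ _ _ => rfl)
    rw [hIc, h3 (f w') hwc' (hfper w'), show I (f w) = I (f w') from heq, sub_self, zero_sub] at h5
    obtain ⟨-, -, -, h6⟩ := hI (fun b => f w b - f w' b - (w - w')) (hdc.sub continuous_const)
      (fun b l hl => by rw [hdp b l hl])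
    have h7 := h6 (1 / 2 * ‖w - w'‖) fun b => by
      have e : f w b - f w' b - (w - w') = L (-b) (Φ b w - Φ b w' - L b (w - w')) := by
        rw [map_sub (L (-b)) (Φ b w - Φ b w'), hLneg]
        simp only [f, map_sub]
        abel
      rw [e]
      calc _ ≤ ‖L (-b)‖ * ‖Φ b w - Φ b w' - L b (w - w')‖ := ContinuousLinearMap.le_opNorm _ _
        _ ≤ C * (1 / (2 * C) * ‖w - w'‖) :=
          mul_le_mul (hLC _) (hest b w hw w' hw') (norm_nonneg _) hC.le
        _ = 1 / 2 * ‖w - w'‖ := by field_simp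
    rw [h5, norm_neg] at h7
    have : ‖w - w'‖ = 0 := by linarith [norm_nonneg (w - w')]
    exact sub_eq_zero.1 (norm_eq_zero.1 this)
  -- Injectivity of `θ` is applied to `w` and `Φ b w`, so whole orbits have to stay in the
  -- neighborhood where it holds.
  have hsmall : ∀ U ∈ 𝓝 w₀, ∀ᶠ w in 𝓝 w₀, ∀ b, Φ b w ∈ U := by
    intro U hU
    obtain ⟨r, hr, hrU⟩ := Metric.mem_nhds_iff.1 hU
    have hK : 0 < C + 1 / (2 * C) := by positivity
    filter_upwards [Metric.ball_mem_nhds w₀ hρ,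
      Metric.ball_mem_nhds w₀ (show 0 < r / (C + 1 / (2 * C)) by positivity)] with w hw hwr b
    apply hrU
    have h1 := hest b w hw w₀ (Metric.mem_ball_self hρ)
    rw [hfix] at h1
    rw [mem_ball_iff_norm] at hwr ⊢
    calc ‖Φ b w - w₀‖ = ‖(Φ b w - w₀ - L b (w - w₀)) + L b (w - w₀)‖ := by rw [sub_add_cancel]
      _ ≤ 1 / (2 * C) * ‖w - w₀‖ + C * ‖w - w₀‖ := (norm_add_le _ _).trans (add_le_add h1
          (((L b).le_opNorm _).trans (mul_le_mul_of_nonneg_right (hLC b) (norm_nonneg _))))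
      _ = (C + 1 / (2 * C)) * ‖w - w₀‖ := by ring
      _ < r := by rwa [lt_div_iff₀ hK, mul_comm] at hwr
  obtain ⟨U, hU, hUinj⟩ := hinj
  refine ⟨hL0, hLadd, θ, ?_⟩
  filter_upwards [hθ, hU, hsmall U hU] with w hw hwU hwb b
  rw [← hw b]
  exact ⟨fun h => by rw [h], fun h => hUinj (hwb b) hwU h⟩

end Linearization

end LoopKirwan

end

/-! ### Local finiteness of stabilizer algebras. -/

noncomputable section

namespace LoopKirwan

namespace VectorAction

variable {V : Type*} [NormedAddCommGroup V] [NormedSpace ℝ V]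
  {W : Type*} [NormedAddCommGroup W] [NormedSpace ℝ W] [FiniteDimensional ℝ W]
  {M : Type*} [TopologicalSpace M] [ChartedSpace W M] [IsManifold 𝓘(ℝ, W) ∞ M]
  {A : VectorAction V W M}
  {g : ContMDiffRiemannianMetric 𝓘(ℝ, W) ∞ W (TangentSpace 𝓘(ℝ, W) : M → Type _)}
  {Λ : AddSubgroup V} {F : Set V}

/-- Near a fixed point of an isometric torus action there are finitely many stabilizers. -/
lemma IsIsometric.exists_nhds_finite_stab (h : A.IsIsometric g) (hΛc : IsClosed (Λ : Set V))
    (hΛ : ∀ m, Λ ≤ A.stab m) (hF : IsCompact F) (hFΛ : ∀ w : V, ∃ s ∈ Λ, w - s ∈ F) {m : M}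
    (hm : ∀ b, A.act b m = m) : ∃ O ∈ 𝓝 m, (A.stab '' O).Finite := by
  have : CompleteSpace W := FiniteDimensional.complete ℝ W
  let Ψ := extChartAt 𝓘(ℝ, W) m
  let w₀ : W := Ψ m
  let Φ : V → W → W := fun b w => Ψ (A.act b (Ψ.symm w))
  let L : V → W →L[ℝ] W := fun b => mfderiv 𝓘(ℝ, W) 𝓘(ℝ, W) (A.act b) m
  have hΨm : Ψ.symm w₀ = m := extChartAt_to_inv m
  have hL : ∀ b, HasFDerivAt (Φ b) (L b) w₀ := fun b => by
    have h1 := (A.hasMFDerivAt_act b m).2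
    rw [writtenInExtChartAt, hm b] at h1
    rw [ModelWithCorners.range_eq_univ] at h1
    have h2 : HasFDerivWithinAt (Φ b) (L b) univ w₀ := h1
    exact hasFDerivWithinAt_univ.1 h2
  have hsm : ∀ b, ContDiffAt ℝ ∞ (fun p : V × W => Φ p.1 p.2) (b, w₀) := fun b => by
    have h1 : ContMDiffAt 𝓘(ℝ, W) 𝓘(ℝ, W) ∞ Ψ.symm w₀ :=
      (contMDiffOn_extChartAt_symm m).contMDiffAt (extChartAt_target_mem_nhds m)
    have hf : ContMDiffAt 𝓘(ℝ, V × W) 𝓘(ℝ, V) ∞ (Prod.fst : V × W → V) (b, w₀) :=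
      contDiffAt_fst.contMDiffAt
    have hs : ContMDiffAt 𝓘(ℝ, V × W) 𝓘(ℝ, W) ∞ (Prod.snd : V × W → W) (b, w₀) :=
      contDiffAt_snd.contMDiffAt
    have h2 : ContMDiffAt 𝓘(ℝ, V × W) (𝓘(ℝ, V).prod 𝓘(ℝ, W)) ∞
        (fun p : V × W => (p.1, Ψ.symm p.2)) (b, w₀) :=
      hf.prodMk (ContMDiffAt.comp (b, w₀) h1 hs)
    have h3 : ContMDiffAt 𝓘(ℝ, V × W) 𝓘(ℝ, W) ∞
        (fun p : V × W => A.act p.1 (Ψ.symm p.2)) (b, w₀) :=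
      ContMDiffAt.comp (b, w₀) (A.smooth _) h2
    have h4 : ContMDiffAt 𝓘(ℝ, W) 𝓘(ℝ, W) ∞ Ψ (A.act b (Ψ.symm w₀)) := by
      rw [hΨm, hm b]
      exact contMDiffAt_extChartAt
    exact (ContMDiffAt.comp (b, w₀) h4 h3).contDiffAt
  have hper : ∀ b, ∀ l ∈ Λ, A.act (b + l) = A.act b := fun b l hl => by
    funext x
    rw [A.add_act, show A.act l x = x from hΛ x hl]
  -- By the tube lemma over the compact set `F`; periodicity extends it to all `b`.
  have hsrc : ∀ᶠ w in 𝓝 w₀, ∀ b, A.act b (Ψ.symm w) ∈ Ψ.source := by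
    have h1 : ∀ᶠ x in 𝓝 m, ∀ b ∈ F, A.act b x ∈ Ψ.source := by
      have hopen : IsOpen {p : V × M | A.act p.1 p.2 ∈ Ψ.source} :=
        (isOpen_extChartAt_source m).preimage A.continuous
      obtain ⟨S, O, hSo, hOo, hFS, hmO, hSO⟩ := generalized_tube_lemma hF
        (isCompact_singleton (x := m)) hopen (by
          rintro ⟨b, x⟩ ⟨hb, hx⟩
          obtain rfl : x = m := hx
          show A.act b x ∈ Ψ.source
          rw [hm b]
          exact mem_extChartAt_source x)
      filter_upwards [hOo.mem_nhds (hmO rfl)] with x hx b hb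
      exact @hSO (b, x) ⟨hFS hb, hx⟩
    have h2 : Tendsto Ψ.symm (𝓝 w₀) (𝓝 m) := by
      have := continuousAt_extChartAt_symm (I := 𝓘(ℝ, W)) m
      rwa [ContinuousAt, extChartAt_to_inv] at this
    filter_upwards [h2.eventually h1] with w hw b
    obtain ⟨s, hs, hb⟩ := hFΛ b
    rw [← sub_add_cancel b s, hper _ s hs]
    exact hw _ hb
  have hinv : ∀ᶠ w in 𝓝 w₀, ∀ b, Ψ.symm (Φ b w) = A.act b (Ψ.symm w) := by
    filter_upwards [hsrc] with w hw b using Ψ.left_inv (hw b)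
  have htar : ∀ᶠ w in 𝓝 w₀, w ∈ Ψ.target := extChartAt_target_mem_nhds m
  obtain ⟨hL0, hLadd, θ, hθ⟩ := exists_linearization (Φ := Φ) (w₀ := w₀) (L := L) hΛc hF hFΛ
    (fun b => ⟨_, (hsm b).hasStrictFDerivAt (by simp)⟩) hL
    (fun b => by simp only [Φ, hΨm, hm b]; rfl)
    (fun b l hl => by simp only [Φ, hper b l hl])
    (by
      filter_upwards [hsrc] with w hw
      refine (continuousOn_extChartAt m).comp_continuous ?_ hw
      exact A.continuous.comp (continuous_id.prodMk continuous_const))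
    (by
      filter_upwards [hinv] with w hw a b
      show Ψ (A.act (a + b) (Ψ.symm w)) = Ψ (A.act a (Ψ.symm (Φ b w)))
      rw [hw b, A.add_act])
    (by
      filter_upwards [htar] with w hw
      show Ψ (A.act 0 (Ψ.symm w)) = w
      rw [A.zero_act, Ψ.right_inv hw])
  -- As `m` is fixed, the differentials act on the tangent space at `m` and preserve the metric
  -- there.
  have hfin := finite_range_fixed (V := V) (W := W)
    (LinearMap.mk₂ ℝ (fun v w : W => (g.inner m (v : TangentSpace 𝓘(ℝ, W) m) w : ℝ))
      (fun v v' w => by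
        have := congrArg (fun T => T w) ((g.inner m).map_add v v')
        exact this)
      (fun c v w => by
        have := congrArg (fun T => T w) ((g.inner m).map_smul c v)
        exact this)
      (fun v w w' => (g.inner m v).map_add w w') (fun c v w => (g.inner m v).map_smul c w))
    (fun v w => g.symm m v w) (fun v hv => g.pos m v hv)
    (fun b => (L b : W →ₗ[ℝ] W)) (by rw [hL0]; rfl) (fun a b => by rw [hLadd]; rfl)
    (fun b v w => by
      let G : M → W → W → ℝ := fun p x y => g.inner p x y
      have h1 : G (A.act b m) (L b v) (L b w) = G m v w := h b m v w
      rw [hm b] at h1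
      exact h1)
  have hev : ∀ᶠ x in 𝓝 m, x ∈ Ψ.source ∧ (∀ b, Φ b (Ψ x) = Ψ x ↔ L b (θ (Ψ x)) = θ (Ψ x)) ∧
      ∀ b, A.act b (Ψ.symm (Ψ x)) ∈ Ψ.source := by
    have h1 : Tendsto Ψ (𝓝 m) (𝓝 w₀) := continuousAt_extChartAt m
    filter_upwards [extChartAt_source_mem_nhds (I := 𝓘(ℝ, W)) m, h1.eventually hθ,
      h1.eventually hsrc] with x h1 h2 h3 using ⟨h1, h2, h3⟩
  refine ⟨_, hev, ?_⟩
  have hset : (fun P : AddSubgroup V => (P : Set V)) '' (A.stab '' {x | x ∈ Ψ.source ∧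
      (∀ b, Φ b (Ψ x) = Ψ x ↔ L b (θ (Ψ x)) = θ (Ψ x)) ∧
      ∀ b, A.act b (Ψ.symm (Ψ x)) ∈ Ψ.source}) ⊆
      Set.range fun w : W => {a : V | (L a : W →ₗ[ℝ] W) w = w} := by
    rintro _ ⟨_, ⟨x, ⟨hx, h1, h2⟩, rfl⟩, rfl⟩
    refine ⟨θ (Ψ x), ?_⟩
    ext b
    refine (h1 b).symm.trans ?_
    have h3 := h2 b
    show Ψ (A.act b (Ψ.symm (Ψ x))) = Ψ x ↔ A.act b x = x
    rw [Ψ.left_inv hx] at h3 ⊢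
    exact Ψ.injOn.eq_iff h3 hx
  exact (hfin.subset hset).of_finite_image SetLike.coe_injective.injOn

/-- The action of a subspace. -/
def restrict (A : VectorAction V W M) (k : Submodule ℝ V) : VectorAction k W M where
  act b := A.act b
  zero_act := A.zero_act
  add_act a b := A.add_act a b
  smooth := A.smooth.comp ((k.subtypeL.contDiff.contMDiff.comp contMDiff_fst).prodMk contMDiff_snd)

variable [FiniteDimensional ℝ V] [T2Space M]

/-- Locally, an isometric torus action has finitely many stabilizer algebras. -/
lemma IsIsometric.exists_nhds_finite_stabAlg (h : A.IsIsometric g) (hΛc : IsClosed (Λ : Set V))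
    (hΛ : ∀ m, Λ ≤ A.stab m) (hF : IsCompact F) (hFΛ : ∀ w : V, ∃ s ∈ Λ, w - s ∈ F) (m : M) :
    ∃ O ∈ 𝓝 m, (A.stabAlg '' O).Finite := by
  -- This subspace fixes `m`, and its lattice points are cocompact in it, so the fixed point case
  -- applies to its action. No information is lost: stabilizer algebras of nearby points are
  -- contained in `k` and can be read off from the stabilizers in `k`.
  let k := A.stabAlg m
  obtain ⟨F', hF', hF'k, hred⟩ :=
    exists_compact_fundamental_lineSubmodule (A.isClosed_stab m) (hΛ m) hF hFΛ
  have hr : (A.restrict k).IsIsometric g := fun b m v w => h b m v w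
  have hemb : IsClosedEmbedding (Subtype.val : k → V) :=
    (Submodule.closed_of_finiteDimensional k).isClosedEmbedding_subtypeVal
  obtain ⟨O, hO, hfin⟩ := hr.exists_nhds_finite_stab
    (Λ := Λ.comap k.subtype.toAddMonoidHom) (F := Subtype.val ⁻¹' F')
    (hΛc.preimage continuous_subtype_val) (fun m b hb => hΛ m hb)
    (hemb.isCompact_preimage hF') (fun w => by
      obtain ⟨s, hs, hsk, hw⟩ := hred w w.2
      exact ⟨⟨s, hsk⟩, hs, hw⟩) (m := m) (fun b => lineSubmodule_le b.2)
  refine ⟨O ∩ {m' | A.stabAlg m' ≤ k},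
    inter_mem hO (h.eventually_stabAlg_le hΛ hF hFΛ m), ?_⟩
  refine (hfin.image fun P => (lineSubmodule P).map k.subtype).subset ?_
  rintro _ ⟨m', ⟨hm', hle⟩, rfl⟩
  refine ⟨_, ⟨m', hm', rfl⟩, ?_⟩
  ext v
  constructor
  · rintro ⟨b, hb, rfl⟩
    exact fun u => hb u
  · intro hv
    exact ⟨⟨v, hle hv⟩, fun u => hv u, rfl⟩

end VectorAction

end LoopKirwan

end

/-! ### Actions on the base of a surjective submersion. -/

noncomputable section

namespace LoopKirwan

/-- Submersions have smooth local sections. -/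
lemma exists_local_section {E : Type*} [NormedAddCommGroup E] [NormedSpace ℝ E]
    {N : Type*} [TopologicalSpace N] [ChartedSpace E N] [IsManifold 𝓘(ℝ, E) ∞ N]
    {W : Type*} [NormedAddCommGroup W] [NormedSpace ℝ W]
    {M : Type*} [TopologicalSpace M] [ChartedSpace W M] [IsManifold 𝓘(ℝ, W) ∞ M] {f : N → M} {x : N}
    (h : IsSubmersionAt 𝓘(ℝ, E) 𝓘(ℝ, W) ∞ f x) :
    ∃ s : M → N, s (f x) = x ∧ ContMDiffAt 𝓘(ℝ, W) 𝓘(ℝ, E) ∞ s (f x) ∧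
      ∀ᶠ y in 𝓝 (f x), f (s y) = y := by
  obtain ⟨K, _, _, a, b, hxa, hxb, ha, hb, hsrc, e, hw⟩ := h
  -- In the normal form of a submersion as a projection, the section keeps the fibre coordinate of
  -- `x` fixed.
  let c : K := (e (a x)).2
  replace hw : ∀ z ∈ a.target, b (f (a.symm z)) = (e z).1 := fun z hz => by
    have h1 : z ∈ (a.extend 𝓘(ℝ, E)).target := by simpa using hz
    exact hw h1
  have hx0 : e.symm (b (f x), c) = a x := by
    rw [ContinuousLinearEquiv.symm_apply_eq]
    refine Prod.ext ?_ rfl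
    rw [← hw (a x) (a.map_source hxa), a.left_inv hxa]
  have hsm : ContMDiffAt 𝓘(ℝ, W) 𝓘(ℝ, E) ∞ (fun y => e.symm (b y, c)) (f x) := by
    have h1 : ContMDiffAt 𝓘(ℝ, W) 𝓘(ℝ, W) ∞ b (f x) :=
      (contMDiffOn_of_mem_maximalAtlas hb).contMDiffAt
        (b.open_source.mem_nhds hxb)
    have h2 : ContMDiff 𝓘(ℝ, W) 𝓘(ℝ, E) ∞ (fun w : W => e.symm (w, c)) := by
      have : ContDiff ℝ ∞ (fun w : W => e.symm (w, c)) := by fun_prop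
      exact this.contMDiff
    exact ContMDiffAt.comp (g := fun w : W => e.symm (w, c)) (f x) (h2 _) h1
  refine ⟨fun y => a.symm (e.symm (b y, c)), ?_, ?_, ?_⟩
  · show a.symm (e.symm (b (f x), c)) = x
    rw [hx0, a.left_inv hxa]
  · refine ContMDiffAt.comp (f x) ?_ hsm
    show ContMDiffAt _ _ _ _ (e.symm (b (f x), c))
    rw [hx0]
    exact (contMDiffOn_symm_of_mem_maximalAtlas ha).contMDiffAt
      (a.open_target.mem_nhds (a.map_source hxa))
  · have h1 : ∀ᶠ y in 𝓝 (f x), e.symm (b y, c) ∈ a.target := by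
      refine hsm.continuousAt.preimage_mem_nhds ?_
      show a.target ∈ 𝓝 (e.symm (b (f x), c))
      rw [hx0]
      exact a.open_target.mem_nhds (a.map_source hxa)
    filter_upwards [h1, b.open_source.mem_nhds hxb] with y hy hyb
    refine b.injOn (hsrc (a.map_target hy)) hyb ?_
    rw [hw _ hy, ContinuousLinearEquiv.apply_symm_apply]

namespace VectorAction

variable {V : Type*} [NormedAddCommGroup V] [NormedSpace ℝ V]
  {E : Type*} [NormedAddCommGroup E] [NormedSpace ℝ E]
  {N : Type*} [TopologicalSpace N] [ChartedSpace E N] [IsManifold 𝓘(ℝ, E) ∞ N]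
  {W : Type*} [NormedAddCommGroup W] [NormedSpace ℝ W]
  {M : Type*} [TopologicalSpace M] [ChartedSpace W M] [IsManifold 𝓘(ℝ, W) ∞ M]

/-- The action induced on the base of a surjective submersion. -/
def descend (A : VectorAction V E N) (f : N → M) (hf : Function.Surjective f)
    (hsub : IsSubmersion 𝓘(ℝ, E) 𝓘(ℝ, W) ∞ f)
    (hcomp : ∀ b x y, f x = f y → f (A.act b x) = f (A.act b y)) : VectorAction V W M where
  act b m := f (A.act b (Function.surjInv hf m))
  zero_act m := by rw [A.zero_act, Function.surjInv_eq hf]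
  add_act a b m := by
    rw [A.add_act]
    exact hcomp _ _ _ (Function.surjInv_eq hf _).symm
  smooth := by
    rintro ⟨b, m⟩
    obtain ⟨x, rfl⟩ := hf m
    -- The set-theoretic section in the formula may be replaced by a smooth local one, since the
    -- image depends only on the point of the base.
    obtain ⟨s, hsx, hs, hfs⟩ := exists_local_section (hsub.isSubmersionAt x)
    have h1 : ContMDiffAt (𝓘(ℝ, V).prod 𝓘(ℝ, W)) (𝓘(ℝ, V).prod 𝓘(ℝ, E)) ∞
        (fun p : V × M => (p.1, s p.2)) (b, f x) :=
      contMDiffAt_fst.prodMk (ContMDiffAt.comp (b, f x) hs contMDiffAt_snd)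
    have h2 : ContMDiffAt (𝓘(ℝ, V).prod 𝓘(ℝ, W)) 𝓘(ℝ, W) ∞
        (fun p : V × M => f (A.act p.1 (s p.2))) (b, f x) :=
      ContMDiffAt.comp (b, f x) (hsub.contMDiff _) (ContMDiffAt.comp (b, f x) (A.smooth _) h1)
    refine h2.congr_of_eventuallyEq ?_
    have h3 : ∀ᶠ p : V × M in 𝓝 (b, f x), f (s p.2) = p.2 :=
      (continuous_snd.tendsto (b, f x)).eventually hfs
    filter_upwards [h3] with p hp
    refine hcomp _ _ _ ?_
    rw [hp, Function.surjInv_eq hf]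

variable {A : VectorAction V E N} {f : N → M} {hf : Function.Surjective f}
  {hsub : IsSubmersion 𝓘(ℝ, E) 𝓘(ℝ, W) ∞ f}
  {hcomp : ∀ b x y, f x = f y → f (A.act b x) = f (A.act b y)}

lemma descend_act (b : V) (x : N) :
    (A.descend f hf hsub hcomp).act b (f x) = f (A.act b x) :=
  hcomp _ _ _ (Function.surjInv_eq hf _)

lemma descend_gen (ξ : V) (x : N) : ((A.descend f hf hsub hcomp).gen ξ (f x) : W) =
    mfderiv 𝓘(ℝ, E) 𝓘(ℝ, W) f x (A.gen ξ x) := by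
  have h1 := A.hasMFDerivAt_curve_zero ξ x
  have hx : A.act (-((0 : ℝ) • ξ)) x = x := by rw [zero_smul, neg_zero, A.zero_act]
  have h2 : HasMFDerivAt 𝓘(ℝ, E) 𝓘(ℝ, W) f (A.act (-((0 : ℝ) • ξ)) x)
      (mfderiv 𝓘(ℝ, E) 𝓘(ℝ, W) f x : E →L[ℝ] W) := by
    rw [hx]
    exact (hsub.contMDiff.mdifferentiable (by simp) x).hasMFDerivAt
  have h3 := HasMFDerivAt.comp (0 : ℝ) h2 h1
  have h4 : (f ∘ fun u : ℝ => A.act (-(u • ξ)) x) =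
      fun u : ℝ => (A.descend f hf hsub hcomp).act (-(u • ξ)) (f x) := by
    funext u
    exact (descend_act _ _).symm
  rw [h4] at h3
  have h5 := hasMFDerivAt_unique ((A.descend f hf hsub hcomp).hasMFDerivAt_curve_zero ξ (f x)) h3
  have h6 := congrArg (fun T : ℝ →L[ℝ] W => T 1) h5
  refine ((one_smul ℝ _).symm.trans h6).trans ?_
  exact congrArg (mfderiv 𝓘(ℝ, E) 𝓘(ℝ, W) f x : E →L[ℝ] W) (one_smul ℝ (A.gen ξ x : E))

/-- The differential of a local section is a right inverse of the differential of `f`, so every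
tangent vector of the base is the image of one upstairs, where the hypothesis applies. -/
lemma descend_isIsometric
    {g : ContMDiffRiemannianMetric 𝓘(ℝ, W) ∞ W (TangentSpace 𝓘(ℝ, W) : M → Type _)}
    (h : ∀ b x (v w : TangentSpace 𝓘(ℝ, E) x), g.inner (f (A.act b x))
      (mfderiv 𝓘(ℝ, E) 𝓘(ℝ, W) f (A.act b x) (mfderiv 𝓘(ℝ, E) 𝓘(ℝ, E) (A.act b) x v))
      (mfderiv 𝓘(ℝ, E) 𝓘(ℝ, W) f (A.act b x) (mfderiv 𝓘(ℝ, E) 𝓘(ℝ, E) (A.act b) x w)) =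
      g.inner (f x) (mfderiv 𝓘(ℝ, E) 𝓘(ℝ, W) f x v) (mfderiv 𝓘(ℝ, E) 𝓘(ℝ, W) f x w)) :
    (A.descend f hf hsub hcomp).IsIsometric g := by
  intro b m v w
  obtain ⟨x, rfl⟩ := hf m
  obtain ⟨s, hsx, hs, hfs⟩ := exists_local_section (hsub.isSubmersionAt x)
  let A' := A.descend f hf hsub hcomp
  have hfd := fun y => (hsub.contMDiff.mdifferentiable (by simp) y).hasMFDerivAt
  let S : W →L[ℝ] E := mfderiv 𝓘(ℝ, W) 𝓘(ℝ, E) s (f x)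
  have hS : ∀ u : W, (mfderiv 𝓘(ℝ, E) 𝓘(ℝ, W) f x : E →L[ℝ] W) (S u) = u := by
    have h1 : HasMFDerivAt 𝓘(ℝ, W) 𝓘(ℝ, E) s (f x) S :=
      (hs.mdifferentiableAt (by simp)).hasMFDerivAt
    have h2 : HasMFDerivAt 𝓘(ℝ, E) 𝓘(ℝ, W) f (s (f x))
        (mfderiv 𝓘(ℝ, E) 𝓘(ℝ, W) f x : E →L[ℝ] W) := by
      rw [hsx]
      exact hfd x
    have h3 := HasMFDerivAt.comp (f x) h2 h1
    have h4 : HasMFDerivAt 𝓘(ℝ, W) 𝓘(ℝ, W) (f ∘ s) (f x) (ContinuousLinearMap.id ℝ W) :=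
      (hasMFDerivAt_id (f x)).congr_of_eventuallyEq hfs
    intro u
    exact congrArg (fun T : W →L[ℝ] W => T u) (hasMFDerivAt_unique h3 h4)
  have hchain : ∀ e : E, (mfderiv 𝓘(ℝ, W) 𝓘(ℝ, W) (A'.act b) (f x) : W →L[ℝ] W)
      ((mfderiv 𝓘(ℝ, E) 𝓘(ℝ, W) f x : E →L[ℝ] W) e) =
      (mfderiv 𝓘(ℝ, E) 𝓘(ℝ, W) f (A.act b x) : E →L[ℝ] W)
        ((mfderiv 𝓘(ℝ, E) 𝓘(ℝ, E) (A.act b) x : E →L[ℝ] E) e) := by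
    have h1 := HasMFDerivAt.comp x (A'.hasMFDerivAt_act b (f x)) (hfd x)
    have h2 := HasMFDerivAt.comp x (hfd (A.act b x)) (A.hasMFDerivAt_act b x)
    have h3 : A'.act b ∘ f = f ∘ A.act b := funext fun y => descend_act b y
    rw [h3] at h1
    intro e
    exact congrArg (fun T : E →L[ℝ] W => T e) (hasMFDerivAt_unique h1 h2)
  let G : M → W → W → ℝ := fun p y z => g.inner p y z
  have h1 : G (f (A.act b x)) _ _ = G (f x) _ _ := h b x (S v) (S w)
  have h2 : ∀ u : W, (mfderiv 𝓘(ℝ, W) 𝓘(ℝ, W) (A'.act b) (f x) : W →L[ℝ] W) u =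
      (mfderiv 𝓘(ℝ, E) 𝓘(ℝ, W) f (A.act b x) : E →L[ℝ] W)
        ((mfderiv 𝓘(ℝ, E) 𝓘(ℝ, E) (A.act b) x : E →L[ℝ] E) (S u)) := fun u => by
    rw [← hchain, hS]
  have h3 : G (A'.act b (f x)) = G (f (A.act b x)) := congrArg G (descend_act b x)
  exact (congrFun₂ h3 _ _).trans ((congrArg₂ (G (f (A.act b x))) (h2 v) (h2 w)).trans
    (h1.trans (congrArg₂ (G (f x)) (hS v) (hS w))))

end VectorAction

end LoopKirwan

end

/-! ### The torus action on the quotient, and the geometry of the transversal. -/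

noncomputable section

namespace LoopKirwan

lemma contMDiff_comp_linearMap {V : Type*} [NormedAddCommGroup V] [NormedSpace ℝ V]
    [FiniteDimensional ℝ V] {F : Type*} [NormedAddCommGroup F] [NormedSpace ℝ F]
    {E : Type*} [NormedAddCommGroup E] [NormedSpace ℝ E]
    {N : Type*} [TopologicalSpace N] [ChartedSpace E N] (T : V →ₗ[ℝ] F) {f : F × N → N}
    (hf : ContMDiff (𝓘(ℝ, F).prod 𝓘(ℝ, E)) 𝓘(ℝ, E) ∞ f) :
    ContMDiff (𝓘(ℝ, V).prod 𝓘(ℝ, E)) 𝓘(ℝ, E) ∞ (fun p : V × N => f (T p.1, p.2)) :=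
  hf.comp ((T.toContinuousLinearMap.contDiff.contMDiff.comp contMDiff_fst).prodMk contMDiff_snd)

/-- The minimum of the form on the unit sphere bounds it below by a multiple of the squared norm. -/
lemma isCompact_quadratic_le {V : Type*} [NormedAddCommGroup V] [NormedSpace ℝ V]
    [FiniteDimensional ℝ V] (b : V →ₗ[ℝ] V →ₗ[ℝ] ℝ) (hb : ∀ v, v ≠ 0 → 0 < b v v) (r : ℝ) :
    IsCompact {v | b v v ≤ r} := by
  have : ProperSpace V := FiniteDimensional.proper ℝ V
  have hcont : Continuous fun v => b v v := by
    have h1 : Continuous fun v => LinearMap.toContinuousLinearMap (b v) :=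
      ((LinearMap.toContinuousLinearMap : (V →ₗ[ℝ] ℝ) ≃ₗ[ℝ] V →L[ℝ] ℝ).toLinearMap ∘ₗ
        b).continuous_of_finiteDimensional
    exact h1.clm_apply continuous_id
  refine Metric.isCompact_of_isClosed_isBounded (isClosed_le hcont continuous_const) ?_
  obtain ⟨c, hc, hbc⟩ : ∃ c > 0, ∀ v ∈ Metric.sphere (0 : V) 1, c ≤ b v v := by
    rcases (Metric.sphere (0 : V) 1).eq_empty_or_nonempty with hS | hS
    · exact ⟨1, one_pos, by simp [hS]⟩
    · obtain ⟨v, hv, hmin⟩ := (isCompact_sphere (0 : V) 1).exists_isMinOn hS hcont.continuousOn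
      exact ⟨b v v, hb v (ne_zero_of_mem_unit_sphere ⟨v, hv⟩), hmin⟩
  have hle : ∀ v, c * ‖v‖ ^ 2 ≤ b v v := fun v => by
    rcases eq_or_ne v 0 with rfl | hv
    · simp
    · have hn : 0 < ‖v‖ := norm_pos_iff.2 hv
      have h1 := hbc (‖v‖⁻¹ • v) (by simp [norm_smul, hn.ne'])
      rw [map_smul, map_smul, LinearMap.smul_apply, smul_eq_mul, smul_eq_mul] at h1
      have h2 := mul_le_mul_of_nonneg_right h1 (sq_nonneg ‖v‖)
      have h3 : ‖v‖⁻¹ * (‖v‖⁻¹ * b v v) * ‖v‖ ^ 2 = b v v := by field_simp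
      rwa [h3] at h2
  refine isBounded_iff_forall_norm_le.2 ⟨√(r / c), fun v hv => Real.le_sqrt_of_sq_le ?_⟩
  rw [le_div_iff₀ hc, mul_comm]
  exact (hle v).trans hv

variable {G : Type*} [Group G] [TopologicalSpace G] [IsTopologicalGroup G]
  [CompactSpace G] [SimplyConnectedSpace G] {n : ℕ} {D : LoopData G n}

/-- Constant `𝔱`-valued functions, as a linear map. -/
def LoopData.constFunₗ (D : LoopData G n) : D.tAlg →ₗ[ℝ] D.Lg where
  toFun := D.constFun
  map_add' a b := by
    refine Subtype.ext ?_
    show (lp.single 2 0 ((a + b : D.tAlg) : Mat n) : Sob n) =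
      lp.single 2 0 (a : Mat n) + lp.single 2 0 (b : Mat n)
    rw [← lp.single_add]
    rfl
  map_smul' c a := by
    refine Subtype.ext ?_
    show (lp.single 2 0 ((c • a : D.tAlg) : Mat n) : Sob n) = c • lp.single 2 0 (a : Mat n)
    rw [← lp.single_smul]
    rfl

lemma LoopData.conj_tAlg (D : LoopData G n) {c : G} (hc : c ∈ D.T) (a : D.tAlg) :
    D.mat c * (a : Mat n) * D.mat c⁻¹ = a := by
  rw [← (D.tAlg_commute_mat a hc).eq, mul_assoc, D.mat_mul_inv, mul_one]

lemma LoopData.conj_mem_gAlg (D : LoopData G n) (c : G) {X : Mat n} (hX : X ∈ D.gAlg) :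
    D.mat c * X * D.mat c⁻¹ ∈ D.gAlg := by
  refine Submodule.span_induction (p := fun X _ => D.mat c * X * D.mat c⁻¹ ∈ D.gAlg)
    ?_ ?_ ?_ ?_ hX
  · intro A hA
    refine Submodule.subset_span fun u => ?_
    obtain ⟨g, -, hg⟩ := hA u
    refine ⟨c * g * c⁻¹, trivial, ?_⟩
    have h1 : D.mat c⁻¹ = (D.mat c)⁻¹ :=
      (Matrix.inv_eq_right_inv (D.mat_mul_inv c)).symm
    have h2 := Matrix.exp_conj (D.mat c) (u • A) (D.isUnit_mat c)
    rw [← h1] at h2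
    rw [show u • (D.mat c * A * D.mat c⁻¹) = D.mat c * (u • A) * D.mat c⁻¹ by
      rw [mul_smul_comm, smul_mul_assoc], h2, ← hg]
    exact (D.mat_mul _ _).trans (by rw [D.mat_mul]; rfl)
  · simp
  · intro x y _ _ hx hy
    rw [mul_add, add_mul]
    exact D.gAlg.add_mem hx hy
  · intro r x _ hx
    rw [mul_smul_comm, smul_mul_assoc]
    exact D.gAlg.smul_mem r hx

lemma LoopData.conj_mem_tPerp (D : LoopData G n) {c : G} (hc : c ∈ D.T) {w : Mat n}
    (hw : w ∈ D.tPerp) : D.mat c * w * D.mat c⁻¹ ∈ D.tPerp := by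
  refine ⟨D.conj_mem_gAlg c hw.1, fun a ha => ?_⟩
  have h : D.B (D.mat c * a * D.mat c⁻¹) (D.mat c * w * D.mat c⁻¹) = D.B a w :=
    D.basic.invariant c a (D.tAlg_le ha) w hw.1
  rw [show D.mat c * a * D.mat c⁻¹ = a from D.conj_tAlg hc ⟨a, ha⟩] at h
  exact h.trans (hw.2 a ha)

variable {E : Type*} [NormedAddCommGroup E] [NormedSpace ℝ E]
  {N : Type*} [TopologicalSpace N] [ChartedSpace E N] [MulAction D.LG N]

/-- The action of the maximal torus on a loop group space, pulled back to the Lie algebra. -/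
def IsSmoothAction.torusAction (hact : IsSmoothAction D E N) : VectorAction D.tAlg E N where
  act β x := D.torusLoop β • x
  zero_act x := by rw [D.torusLoop_zero, one_smul]
  add_act a b x := by rw [D.torusLoop_add, mul_smul]
  smooth := contMDiff_comp_linearMap D.constFunₗ hact.smooth_exp

lemma IsSmoothAction.torusAction_act (hact : IsSmoothAction D E N) (β : D.tAlg) (x : N) :
    hact.torusAction.act β x = D.torusLoop β • x := rfl

lemma IsSmoothAction.torusAction_gen (hact : IsSmoothAction D E N) (β : D.tAlg) (x : N) :
    hact.torusAction.gen β x = generator D (D.constFun β) x := by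
  have hfun : (fun u : ℝ => D.expLoop (-(u • D.constFun β)) • x) =
      fun u : ℝ => hact.torusAction.act (-(u • β)) x := by
    funext u
    rw [D.expLoop_neg_smul_constFun]
    rfl
  rw [generator, hfun]
  rfl

variable [IsManifold 𝓘(ℝ, E) ∞ N] {d : ℕ} {M : Type*} [TopologicalSpace M]
  [ChartedSpace (EuclideanSpace ℝ (Fin d)) M]
  [IsManifold 𝓘(ℝ, EuclideanSpace ℝ (Fin d)) ∞ M]

namespace QuotientSpace

lemma hol_latticeLoop_smul (Q : QuotientSpace D E N d M) {η : D.tAlg} (hη : η ∈ D.lattice) (x : N) :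
    Q.hol (D.latticeLoop η • x) = Q.hol x :=
  ((Q.fibre _ _).2 ⟨_, D.latticeLoop_mem_OmegaG hη, rfl⟩).symm

/-- Conjugation by constant loops preserves `ΩG`, so the torus action descends to the quotient. -/
lemma hol_torusLoop_congr (Q : QuotientSpace D E N d M) (β : D.tAlg) (x y : N)
    (h : Q.hol x = Q.hol y) : Q.hol (D.torusLoop β • x) = Q.hol (D.torusLoop β • y) := by
  obtain ⟨γ, hγ, rfl⟩ := (Q.fibre x y).1 h
  obtain ⟨c, -, -, hc⟩ := D.exists_torusLoop_eq_constLoop β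
  refine (Q.fibre _ _).2 ⟨_, D.constLoop_conj_mem_OmegaG c hγ, ?_⟩
  rw [hc, smul_smul, smul_smul, inv_mul_cancel_right]

/-- The action of the maximal torus on the quotient. -/
def torusAction (Q : QuotientSpace D E N d M) (hact : IsSmoothAction D E N) :
    VectorAction D.tAlg (EuclideanSpace ℝ (Fin d)) M :=
  hact.torusAction.descend Q.hol Q.surjective Q.submersion Q.hol_torusLoop_congr

lemma torusAction_act (Q : QuotientSpace D E N d M) (hact : IsSmoothAction D E N) (β : D.tAlg)
    (x : N) : (Q.torusAction hact).act β (Q.hol x) = Q.hol (D.torusLoop β • x) :=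
  VectorAction.descend_act _ _

lemma torusAction_isIsometric (Q : QuotientSpace D E N d M) (hact : IsSmoothAction D E N) :
    (Q.torusAction hact).IsIsometric Q.g := by
  refine VectorAction.descend_isIsometric fun β x v w => ?_
  obtain ⟨c, -, -, hc⟩ := D.exists_torusLoop_eq_constLoop β
  have h : hact.torusAction.act β = fun x => D.constLoop c • x := by
    funext y
    rw [hact.torusAction_act, hc]
  rw [h]
  exact Q.invariant_g c x v w

lemma lattice_le_stab (Q : QuotientSpace D E N d M) (hact : IsSmoothAction D E N) (m : M) :
    D.latticeSubgroup ≤ (Q.torusAction hact).stab m := fun η hη => by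
  obtain ⟨x, rfl⟩ := Q.surjective m
  show (Q.torusAction hact).act η (Q.hol x) = Q.hol x
  rw [torusAction_act, D.torusLoop_of_mem_lattice hη, one_smul]

lemma length_kirwan (Q : QuotientSpace D E N d M) (hact : IsSmoothAction D E N) (β : D.tAlg)
    (x : N) : length Q x (generator D (D.constFun β) x) =
      √(Q.g.inner (Q.hol x) ((Q.torusAction hact).gen β (Q.hol x))
        ((Q.torusAction hact).gen β (Q.hol x))) := by
  have h := VectorAction.descend_gen (A := hact.torusAction) (hf := Q.surjective)
    (hsub := Q.submersion) (hcomp := Q.hol_torusLoop_congr) β x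
  rw [hact.torusAction_gen] at h
  rw [length]
  exact congrArg₂ (fun v w => √(Q.g.inner (Q.hol x) v w)) h.symm h.symm

end QuotientSpace

section Transversal

variable {t : Thickening D} {𝓗 : HamiltonianSpace D E N}

/-- Both sides are gauge transforms of the same form by the lattice loop, one by equivariance of `j`
and one by equivariance of `μ`. -/
lemma μ_latticeLoop_smul {η : D.tAlg} (hη : η ∈ D.lattice) {x : N} {a : D.tAlg} {w : D.tPerp}
    (hw : D.B w w ≤ t.ε ^ 2) (h : t.j (a, w) = 𝓗.μ x) :
    t.j (a + η, w) = 𝓗.μ (D.latticeLoop η • x) := by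
  have h2 := 𝓗.equivariant_μ (D.latticeLoop η) x
  rw [← h] at h2
  exact D.isGauge_latticeLoop_unique hη (t.equivariant_lattice η hη a w hw) h2

lemma latticeLoop_smul_mem_transversal {η : D.tAlg} (hη : η ∈ D.lattice) {x : N}
    (hx : x ∈ transversal 𝓗 t) : D.latticeLoop η • x ∈ transversal 𝓗 t := by
  obtain ⟨⟨a, w⟩, hw, e⟩ := hx
  exact ⟨(a + η, w), hw, μ_latticeLoop_smul hη hw e⟩

/-- The based gauge group acts freely on the transversal, so that the stabilizers of points of the
transversal and of their images in the quotient agree. -/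
lemma torusLoop_smul_eq_of_hol_eq (Q : QuotientSpace D E N d M) {β : D.tAlg} {x : N}
    (hx : x ∈ transversal 𝓗 t) (h : Q.hol (D.torusLoop β • x) = Q.hol x) :
    D.torusLoop β • x = x := by
  obtain ⟨γ, hγ, hγx⟩ := (Q.fibre _ _).1 h.symm
  obtain ⟨⟨a, w⟩, hw, e⟩ := hx
  obtain ⟨c, hcT, hcm, hc⟩ := D.exists_torusLoop_eq_constLoop β
  let w' : D.tPerp := ⟨D.mat c * w * D.mat c⁻¹, D.conj_mem_tPerp hcT w.2⟩
  have hw' : D.B w' w' = D.B w w := D.basic.invariant c w w.2.1 w w.2.1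
  have hwε : D.B w' w' ≤ t.ε ^ 2 := hw'.trans_le hw
  have hgauge := t.equivariant_normalizer c (Subgroup.le_normalizer hcT) (a, w) (a, w') hw
    (D.conj_tAlg hcT a).symm rfl
  have hμ := 𝓗.equivariant_μ (D.constLoop c) x
  rw [← e] at hμ
  have hq : t.j (a, w') = 𝓗.μ (D.constLoop c • x) := D.isGauge_constLoop_unique hgauge hμ
  have hγμ := 𝓗.equivariant_μ γ x
  rw [← hγx, hc, ← e, ← hq] at hγμ
  -- The torus element moves `j (a, w)` to `j (a, w')`, which `γ` also does. The orbit condition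
  -- forces `w' = w`; then `γ` fixes the smooth form `j (a, w)` and has to be trivial.
  obtain ⟨η, -, -, hww⟩ := (t.orbit (a, w) (a, w') hw hwε).1 ⟨γ, hγ, hγμ⟩
  rw [show w' = w from hww] at hγμ
  rw [hγx, D.eq_one_of_isGauge_self hγ (t.smooth_forms (a, w) hw 2) hγμ, one_smul]

/-- The lattice translates only the first factor of the thickening, where it is cocompact; the
second factor is a compact ball. Properness of `μ` lifts compactness to the transversal. -/
lemma exists_compact_fundamental_transversal (𝓗 : HamiltonianSpace D E N) (t : Thickening D) :
    ∃ K : Set N, IsCompact K ∧ K ⊆ transversal 𝓗 t ∧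
      ∀ x ∈ transversal 𝓗 t, ∃ η ∈ D.lattice, ∃ y ∈ K, x = D.latticeLoop η • y := by
  obtain ⟨F, hF, hFΛ⟩ := D.exists_compact_fundamental_lattice
  have hC : IsCompact (F ×ˢ {w : D.tPerp | D.B w w ≤ t.ε ^ 2}) :=
    hF.prod (isCompact_quadratic_le (V := D.tPerp)
      (D.B.compl₁₂ D.tPerp.subtype D.tPerp.subtype)
      (fun w hw => D.basic.pos w w.2.1 (by simpa using hw)) _)
  have hj : ContinuousOn t.j (F ×ˢ {w : D.tPerp | D.B w w ≤ t.ε ^ 2}) :=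
    t.smooth.continuousOn.mono fun p hp => hp.2
  refine ⟨𝓗.μ ⁻¹' (t.j '' (F ×ˢ {w : D.tPerp | D.B w w ≤ t.ε ^ 2})),
    𝓗.proper_μ.isCompact_preimage (hC.image_of_continuousOn hj), ?_, ?_⟩
  · rintro x ⟨p, hp, e⟩
    exact ⟨p, hp.2, e⟩
  · rintro x ⟨⟨a, w⟩, hw, e⟩
    obtain ⟨η, hη, hηF⟩ := hFΛ a
    have hη' : -η ∈ D.lattice := D.latticeSubgroup.neg_mem hη
    refine ⟨η, hη, D.latticeLoop (-η) • x, ⟨(a - η, w), ⟨hηF, hw⟩, ?_⟩, ?_⟩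
    · rw [sub_eq_add_neg]
      exact μ_latticeLoop_smul hη' hw e
    · rw [smul_smul, ← D.latticeLoop_add hη hη', add_neg_cancel, D.latticeLoop_zero, one_smul]

end Transversal

end LoopKirwan

end

/-! ### The central extension and the behaviour of the moment map under the lattice. -/

noncomputable section

namespace LoopKirwan

lemma pairing_const {n : ℕ} (β : Mat n →ₗ[ℝ] Mat n →ₗ[ℝ] ℝ) (s s' : ℝ) (X Y : Mat n) :
    pairing β (coef s (lp.single 2 0 X : Sob n)) (coef s' (lp.single 2 0 Y : Sob n)) = β X Y := by
  rw [pairing, tsum_eq_single 0]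
  · simp only [neg_zero, coef_single, if_true, sub_self, smul_zero, map_zero, add_zero]
    rw [← two_smul ℝ X, ← two_smul ℝ Y]
    simp only [map_smul, LinearMap.smul_apply, smul_eq_mul]
    ring
  · intro k hk
    simp [coef_single, hk]

/-- The square is there because the central circle acts on the anti-canonical bundle with weight
`2`; it produces the same factor `4πi` as in `IsMomentValue`. -/
lemma hasDerivAt_circle_exp_sq (c : ℝ) : HasDerivAt
    (fun u : ℝ => ((Circle.exp (2 * Real.pi * (u * c)) : Circle) : ℂ) ^ 2)
    (4 * (Real.pi : ℂ) * Complex.I * c) 0 := by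
  have h0 : HasDerivAt (fun u : ℝ => ((u * (4 * Real.pi * c) : ℝ) : ℂ) * Complex.I)
      (((1 * (4 * Real.pi * c) : ℝ) : ℂ) * Complex.I) 0 :=
    (((hasDerivAt_id (0 : ℝ)).mul_const (4 * Real.pi * c)).ofReal_comp).mul_const _
  have h1 := h0.cexp
  refine (h1.congr_deriv ?_).congr_of_eventuallyEq (Eventually.of_forall fun u => ?_)
  · simp
    ring
  · show ((Circle.exp _ : Circle) : ℂ) ^ 2 = _
    rw [Circle.coe_exp, ← Complex.exp_nat_mul]
    congr 1
    push_cast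
    ring

/-- Vectors in fibres over points that are equal only by a proof are compared in the total space;
this brings them into the desired fibre without casts. -/
lemma exists_mk_eq {B F : Type*} {S : B → Type*} (p : TotalSpace F S) {x : B} (h : p.1 = x) :
    ∃ v : S x, TotalSpace.mk' F x v = p := by
  subst h
  exact ⟨p.2, rfl⟩

lemma mk_injective {B F : Type*} {S : B → Type*} {x : B} {v w : S x}
    (h : TotalSpace.mk' F x v = TotalSpace.mk' F x w) : v = w :=
  eq_of_heq (TotalSpace.mk.inj h).2

variable {G : Type*} [Group G] [TopologicalSpace G] [IsTopologicalGroup G]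
  [CompactSpace G] [SimplyConnectedSpace G] {n : ℕ} {D : LoopData G n}

lemma IsSmoothAction.generator_smul_of_comm
    {E : Type*} [NormedAddCommGroup E] [NormedSpace ℝ E]
    {N : Type*} [TopologicalSpace N] [ChartedSpace E N] [MulAction D.LG N]
    (hact : IsSmoothAction D E N) {γ : D.LG} {β : D.tAlg}
    (hc : ∀ a : D.tAlg, D.torusLoop a * γ = γ * D.torusLoop a) (x : N) :
    (generator D (D.constFun β) (γ • x) : E) = dAct D γ x (generator D (D.constFun β) x) := by
  have h0 := hact.torusAction.hasMFDerivAt_curve_zero β x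
  have h1 : HasMFDerivAt 𝓘(ℝ, E) 𝓘(ℝ, E) (fun y : N => γ • y)
      (hact.torusAction.act (-((0 : ℝ) • β)) x) (dAct D γ x : E →L[ℝ] E) := by
    rw [show hact.torusAction.act (-((0 : ℝ) • β)) x = x by
      rw [zero_smul, neg_zero, VectorAction.zero_act]]
    exact ((hact.smooth_smul γ).mdifferentiable (by simp) x).hasMFDerivAt
  have h2 := HasMFDerivAt.comp (f := fun u : ℝ => hact.torusAction.act (-(u • β)) x) (0 : ℝ) h1 h0
  have hfun : ((fun y : N => γ • y) ∘ fun u : ℝ => hact.torusAction.act (-(u • β)) x) =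
      fun u : ℝ => hact.torusAction.act (-(u • β)) (γ • x) := by
    funext u
    simp only [Function.comp, hact.torusAction_act]
    rw [smul_smul, smul_smul, hc]
  rw [hfun] at h2
  have h3 := hasMFDerivAt_unique (hact.torusAction.hasMFDerivAt_curve_zero β (γ • x)) h2
  have h4 := congrArg (fun T : ℝ →L[ℝ] E => T 1) h3
  have h5 : (hact.torusAction.gen β (γ • x) : E) =
      (dAct D γ x : E →L[ℝ] E) (hact.torusAction.gen β x : E) :=
    (one_smul ℝ (hact.torusAction.gen β (γ • x) : E)).symm.trans (h4.trans
      (congrArg (dAct D γ x : E →L[ℝ] E) (one_smul ℝ (hact.torusAction.gen β x : E))))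
  rw [hact.torusAction_gen, hact.torusAction_gen] at h5
  exact h5

namespace CentralExtension

variable {Γ : Type*} [Group Γ] (Λ : CentralExtension D Γ)

lemma lift_zero : Λ.lift 0 = 1 := by
  have h := Λ.lift_add 0 0 0
  simpa using h

/-- A lattice loop commutes with constants in `𝔱`, so only the central term of the adjoint action
remains. It comes from the logarithmic derivative `-η` of the loop `exp (-sη)`, whence the sign. -/
lemma conj_lift {g : Γ} {η : D.tAlg} (hη : η ∈ D.lattice) (hg : Λ.proj g = D.latticeLoop η)
    (u : ℝ) (ξ : D.tAlg) : Λ.lift (u • D.constFun ξ) * g =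
      Λ.ι (Circle.exp (2 * Real.pi * (u * D.B (D.ℓ η) ξ))) * g * Λ.lift (u • D.constFun ξ) := by
  have hξ : u • D.constFun ξ = D.constFun (u • ξ) := (D.constFunₗ.map_smul u ξ).symm
  have h := Λ.adjoint g (u • D.constFun ξ) (u • D.constFun ξ) (D.constForm (-η))
    (by rw [hg, hξ]; exact D.isAd_latticeLoop hη _) (by rw [hg]; exact D.isLogDeriv_latticeLoop hη)
  have hp : pairing (D.B ∘ₗ D.ℓ) (coef (D.ς - 1) (D.constForm (-η)).1)
      (coef D.ς (u • D.constFun ξ).1) = -(u * D.B (D.ℓ η) ξ) := by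
    rw [hξ]
    refine (pairing_const _ _ _ _ _).trans ?_
    simp
  rw [hp, mul_neg, Circle.exp_neg, map_inv, mul_inv_eq_iff_eq_mul] at h
  rw [mul_assoc, h, ← mul_assoc, ← mul_assoc, Λ.central, mul_assoc _ (Λ.ι _), mul_inv_cancel,
    mul_one]

/-- The lift of `f` lies over the trivial loop, so it is central in `Γ`. The commutator phase of
`conj_lift` at `u = 1` is therefore trivial, which is integrality. -/
lemma exists_int_eq (Λ : CentralExtension D Γ) {η f : D.tAlg} (hη : η ∈ D.lattice) (hf : f ∈ D.lattice) :
    ∃ m : ℤ, D.B (D.ℓ η) f = m := by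
  obtain ⟨g, hg⟩ := Λ.proj_surjective (D.latticeLoop η)
  have h := Λ.conj_lift hη hg 1 f
  have h1 : Λ.proj (Λ.lift ((1 : ℝ) • D.constFun f)) = 1 := by
    rw [Λ.proj_lift, D.expLoop_smul_constFun, one_smul, D.torusLoop_of_mem_lattice hf]
  obtain ⟨z, hz⟩ := (Λ.ι_range _).1 h1
  rw [← hz, mul_assoc, ← Λ.central z, ← mul_assoc, ← mul_assoc, mul_left_inj, ← map_mul] at h
  have h2 := Λ.ι_injective h
  rw [right_eq_mul, Circle.exp_eq_one] at h2
  obtain ⟨m, hm⟩ := h2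
  refine ⟨m, ?_⟩
  have := Real.pi_pos
  field_simp at hm
  linarith

end CentralExtension

namespace LevelAction

variable {Γ : Type*} [Group Γ] {Λ : CentralExtension D Γ} {w : ℕ}
  {E : Type*} [NormedAddCommGroup E] [NormedSpace ℝ E]
  {N : Type*} [TopologicalSpace N] [ChartedSpace E N] [MulAction D.LG N]
  {F : Type*} [NormedAddCommGroup F] [NormedSpace ℝ F] {S : N → Type*}
  [TopologicalSpace (TotalSpace F S)] [∀ x, NormedAddCommGroup (S x)]
  [∀ x, InnerProductSpace ℂ (S x)] [FiberBundle F S] (𝓐 : LevelAction Λ w E F S)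

/-- The action on the total space. -/
def tot (g : Γ) (p : TotalSpace F S) : TotalSpace F S :=
  TotalSpace.mk' F (Λ.proj g • p.1) (𝓐.act g p.1 p.2)

lemma tot_mul (g h : Γ) (p : TotalSpace F S) : 𝓐.tot (g * h) p = 𝓐.tot g (𝓐.tot h p) :=
  𝓐.act_mul g h p.1 p.2

lemma tot_one (p : TotalSpace F S) : 𝓐.tot 1 p = p := 𝓐.act_one p.1 p.2

lemma tot_ι (z : Circle) (x : N) (v : S x) :
    𝓐.tot (Λ.ι z) (TotalSpace.mk' F x v) = TotalSpace.mk' F x ((z : ℂ) ^ w • v) :=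
  𝓐.act_ι z x v

/-- The image of a section under a group element. -/
lemma exists_section_smul (g : Γ) (σ : ∀ x, S x) : ∃ τ : ∀ x, S x,
    ∀ x, TotalSpace.mk' F (Λ.proj g • x) (τ (Λ.proj g • x)) = 𝓐.tot g (TotalSpace.mk' F x (σ x)) := by
  have h : ∀ y, ∃ v : S y, TotalSpace.mk' F y v =
      𝓐.tot g (TotalSpace.mk' F ((Λ.proj g)⁻¹ • y) (σ ((Λ.proj g)⁻¹ • y))) := fun y =>
    exists_mk_eq _ (smul_inv_smul (Λ.proj g) y)
  choose τ hτ using h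
  refine ⟨τ, fun x => ?_⟩
  rw [hτ, inv_smul_smul]

lemma exists_flow_section (ξ : D.tAlg) (x : N) (σ : ∀ x, S x) : ∃ f : ℝ → S x, ∀ u : ℝ,
    TotalSpace.mk' F x (f u) = 𝓐.tot (Λ.lift (u • D.constFun ξ))
      (TotalSpace.mk' F (D.expLoop (-(u • D.constFun ξ)) • x)
        (σ (D.expLoop (-(u • D.constFun ξ)) • x))) := by
  have h : ∀ u : ℝ, ∃ v : S x, TotalSpace.mk' F x v = 𝓐.tot (Λ.lift (u • D.constFun ξ))
      (TotalSpace.mk' F (D.expLoop (-(u • D.constFun ξ)) • x)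
        (σ (D.expLoop (-(u • D.constFun ξ)) • x))) := fun u =>
    exists_mk_eq _ (by
      show Λ.proj _ • D.expLoop _ • x = x
      rw [Λ.proj_lift, D.expLoop_smul_constFun, D.expLoop_neg_smul_constFun, smul_smul,
        ← D.torusLoop_add, add_neg_cancel, D.torusLoop_zero, one_smul])
  choose f hf using h
  exact ⟨f, hf⟩

lemma mdifferentiableAt_section_smul (hact : IsSmoothAction D E N) {g : Γ} {σ τ : ∀ x, S x}
    (h : ∀ x, TotalSpace.mk' F (Λ.proj g • x) (τ (Λ.proj g • x)) =
      𝓐.tot g (TotalSpace.mk' F x (σ x))) {x : N}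
    (hσ : MDifferentiableAt 𝓘(ℝ, E) (𝓘(ℝ, E).prod 𝓘(ℝ, F)) (fun y => TotalSpace.mk' F y (σ y)) x) :
    MDifferentiableAt 𝓘(ℝ, E) (𝓘(ℝ, E).prod 𝓘(ℝ, F)) (fun y => TotalSpace.mk' F y (τ y))
      (Λ.proj g • x) := by
  have e : (fun y => TotalSpace.mk' F y (τ y)) =
      𝓐.tot g ∘ (fun y => TotalSpace.mk' F y (σ y)) ∘ fun y => (Λ.proj g)⁻¹ • y := by
    funext y
    have := h ((Λ.proj g)⁻¹ • y)
    rw [smul_inv_smul] at this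
    exact this
  rw [e]
  have h1 : MDifferentiableAt 𝓘(ℝ, E) 𝓘(ℝ, E) (fun y : N => (Λ.proj g)⁻¹ • y) (Λ.proj g • x) :=
    (hact.smooth_smul _).mdifferentiable (by simp) _
  have h2 : MDifferentiableAt 𝓘(ℝ, E) (𝓘(ℝ, E).prod 𝓘(ℝ, F)) (fun y => TotalSpace.mk' F y (σ y))
      ((Λ.proj g)⁻¹ • Λ.proj g • x) := by
    rw [inv_smul_smul]
    exact hσ
  have h3 := (𝓐.smooth_act g).mdifferentiable (by simp)
    (TotalSpace.mk' F ((Λ.proj g)⁻¹ • Λ.proj g • x) (σ ((Λ.proj g)⁻¹ • Λ.proj g • x)))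
  exact MDifferentiableAt.comp _ h3 (MDifferentiableAt.comp _ h2 h1)

end LevelAction

section Shift

variable {Γ : Type*} [Group Γ] {Λ : CentralExtension D Γ}
  {E : Type*} [NormedAddCommGroup E] [NormedSpace ℝ E]
  {N : Type*} [TopologicalSpace N] [ChartedSpace E N]
  {L : N → Type*} [TopologicalSpace (TotalSpace ℂ L)] [∀ x, NormedAddCommGroup (L x)]
  [∀ x, InnerProductSpace ℂ (L x)] [FiberBundle ℂ L] [VectorBundle ℝ ℂ L]

lemma exists_section_eq_one [VectorBundle ℂ ℂ L] [ContMDiffVectorBundle ∞ ℂ L 𝓘(ℝ, E)] (x : N) :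
    ∃ σ : ∀ y, L y, (∀ y ∈ (trivializationAt ℂ L x).baseSet,
      trivializationAt ℂ L x (TotalSpace.mk' ℂ y (σ y)) = (y, 1)) ∧
      ContMDiffOn 𝓘(ℝ, E) (𝓘(ℝ, E).prod 𝓘(ℝ, ℂ)) ∞ (fun y => TotalSpace.mk' ℂ y (σ y))
        (trivializationAt ℂ L x).baseSet := by
  have h : ∀ y ∈ (trivializationAt ℂ L x).baseSet, trivializationAt ℂ L x
      (TotalSpace.mk' ℂ y ((trivializationAt ℂ L x).symm y 1)) = (y, 1) := fun y hy =>
    (trivializationAt ℂ L x).apply_mk_symm hy 1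
  refine ⟨fun y => (trivializationAt ℂ L x).symm y 1, h, ?_⟩
  rw [(trivializationAt ℂ L x).contMDiffOn_section_baseSet_iff]
  refine (contMDiffOn_const (c := (1 : ℂ))).congr fun y hy => ?_
  rw [h y hy]

/-- The `Spin_c` moment map transforms under the integral lattice by translations. -/
lemma moment_latticeLoop_smul [IsManifold 𝓘(ℝ, E) ∞ N] [MulAction D.LG N] [VectorBundle ℂ ℂ L] [ContMDiffVectorBundle ∞ ℂ L 𝓘(ℝ, E)]
    (hact : IsSmoothAction D E N) {𝓛 : LevelAction Λ 2 E ℂ L}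
    {nabla : CovariantDerivative 𝓘(ℝ, E) ℂ L} (hnabla : IsInvariantHermitianConnection Λ 𝓛 nabla)
    {φ : N → D.tAlg} (hφ : IsSpincMoment Λ 𝓛 nabla φ) {η : D.tAlg} (hη : η ∈ D.lattice)
    (ξ : D.tAlg) (x : N) :
    D.B (φ (D.latticeLoop η • x)) ξ = D.B (φ x) ξ + D.B (D.ℓ η) ξ := by
  obtain ⟨g, hg⟩ := Λ.proj_surjective (D.latticeLoop η)
  obtain ⟨σ, hσ1, hσ2⟩ := exists_section_eq_one (E := E) (L := L) x
  have hxb := FiberBundle.mem_baseSet_trivializationAt' (F := ℂ) (E := L) x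
  have hσ : MDifferentiableAt 𝓘(ℝ, E) (𝓘(ℝ, E).prod 𝓘(ℝ, ℂ))
      (fun y => TotalSpace.mk' ℂ y (σ y)) x :=
    (hσ2.contMDiffAt ((trivializationAt ℂ L x).open_baseSet.mem_nhds hxb)).mdifferentiableAt
      (by simp)
  have hσ0 : σ x ≠ 0 := by
    intro h0
    have h1 := hσ1 x hxb
    have h2 := congrArg Prod.snd h1
    rw [h0] at h2
    have h3 : (trivializationAt ℂ L x).linearMapAt ℂ x (0 : L x) = 1 := by
      rw [(trivializationAt ℂ L x).coe_linearMapAt_of_mem hxb]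
      exact h2
    simp at h3
  -- The moment map at the translated point is tested on the translate of a section that does not
  -- vanish at `x`.
  obtain ⟨τ, hτ⟩ := 𝓛.exists_section_smul g σ
  have hτσ : ∀ y, τ (Λ.proj g • y) = 𝓛.act g y (σ y) := fun y => mk_injective (hτ y)
  have hτd := 𝓛.mdifferentiableAt_section_smul hact hτ hσ
  obtain ⟨f, hf⟩ := 𝓛.exists_flow_section ξ x σ
  have hd := hφ x ξ σ f hσ hf
  -- The flow of `τ` is the translated flow of `σ`, up to the phase from exchanging `lift (u • ξ)`
  -- with `g`, squared since the bundle has weight `2`.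
  have hd' := hφ (Λ.proj g • x) ξ τ
    (fun u => ((Circle.exp (2 * Real.pi * (u * D.B (D.ℓ η) ξ)) : ℂ)) ^ 2 • 𝓛.act g x (f u)) hτd ?_
  swap
  · intro u
    have e1 : D.expLoop (-(u • D.constFun ξ)) • Λ.proj g • x =
        Λ.proj g • D.expLoop (-(u • D.constFun ξ)) • x := by
      rw [D.expLoop_neg_smul_constFun, hg, smul_smul, smul_smul, D.torusLoop_comm_latticeLoop _ hη]
    calc TotalSpace.mk' ℂ (Λ.proj g • x) (_ ^ 2 • 𝓛.act g x (f u))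
        = 𝓛.tot (Λ.ι (Circle.exp (2 * Real.pi * (u * D.B (D.ℓ η) ξ))))
            (𝓛.tot g (TotalSpace.mk' ℂ x (f u))) := (𝓛.tot_ι _ _ _).symm
      _ = 𝓛.tot (Λ.lift (u • D.constFun ξ) * g) (TotalSpace.mk' ℂ
            (D.expLoop (-(u • D.constFun ξ)) • x) (σ (D.expLoop (-(u • D.constFun ξ)) • x))) := by
          rw [hf, ← 𝓛.tot_mul, ← 𝓛.tot_mul, Λ.conj_lift hη hg, mul_assoc]
      _ = 𝓛.tot (Λ.lift (u • D.constFun ξ)) (TotalSpace.mk' ℂ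
            (Λ.proj g • D.expLoop (-(u • D.constFun ξ)) • x)
            (τ (Λ.proj g • D.expLoop (-(u • D.constFun ξ)) • x))) := by
          rw [𝓛.tot_mul, hτ]
      _ = 𝓛.tot (Λ.lift (u • D.constFun ξ)) (TotalSpace.mk' ℂ
            (D.expLoop (-(u • D.constFun ξ)) • Λ.proj g • x)
            (τ (D.expLoop (-(u • D.constFun ξ)) • Λ.proj g • x))) := by
          rw [e1]
  let A : L x →L[ℂ] L (Λ.proj g • x) :=
    (𝓛.act g x).mkContinuous 1 fun v => by rw [𝓛.norm_act, one_mul]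
  have hA : HasDerivAt (fun u => 𝓛.act g x (f u)) (𝓛.act g x (nabla.toFun σ x
      (generator D (D.constFun ξ) x) +
        (4 * (Real.pi : ℂ) * Complex.I * (D.B (φ x) ξ : ℂ)) • σ x)) 0 :=
    (A.restrictScalars ℝ).hasFDerivAt.comp_hasDerivAt (0 : ℝ) hd
  have hz := hasDerivAt_circle_exp_sq (D.B (D.ℓ η) ξ)
  -- By invariance of the connection the covariant derivatives on the two sides cancel. What remains
  -- compares multiples of a non-zero vector.
  have hu := (hz.smul hA).unique hd'
  have hf0 : f 0 = σ x := mk_injective (F := ℂ) (by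
    have h0 := D.expLoop_smul_constFun 0 ξ
    rw [zero_smul, zero_smul, D.torusLoop_zero] at h0
    rw [hf 0, zero_smul, neg_zero, Λ.lift_zero, 𝓛.tot_one, h0]
    exact congrArg (fun y => TotalSpace.mk' ℂ y (σ y)) (one_smul D.LG x))
  have hgen := congrArg (nabla.toFun τ (Λ.proj g • x) : E →L[ℝ] L (Λ.proj g • x))
    (hact.generator_smul_of_comm (γ := Λ.proj g) (β := ξ)
      (fun a => by rw [hg]; exact D.torusLoop_comm_latticeLoop a hη) x)
  have hinv := hnabla.invariant g σ τ x hσ hτσ (generator D (D.constFun ξ) x)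
  have hgen2 := hgen.trans hinv
  simp only [zero_mul, mul_zero, Circle.exp_zero, Circle.coe_one, one_pow, one_smul, hf0, map_add,
    map_smul] at hu
  rw [hτσ] at hu
  have h3 : (4 * (Real.pi : ℂ) * Complex.I * (D.B (φ x) ξ : ℂ) +
      4 * (Real.pi : ℂ) * Complex.I * (D.B (D.ℓ η) ξ : ℂ)) • 𝓛.act g x (σ x) =
      (4 * (Real.pi : ℂ) * Complex.I * (D.B (φ (Λ.proj g • x)) ξ : ℂ)) • 𝓛.act g x (σ x) := by
    have h4 := hu.trans (congrArg (· + _) hgen2)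
    rw [add_assoc] at h4
    rw [add_smul]
    exact add_left_cancel h4
  have h5 : 𝓛.act g x (σ x) ≠ 0 := fun h0 => hσ0 (by
    rw [← norm_eq_zero, ← 𝓛.norm_act g, h0, norm_zero])
  have h6 := smul_left_injective ℂ h5 h3
  rw [← mul_add] at h6
  have h7 : (4 * (Real.pi : ℂ) * Complex.I) ≠ 0 := by simp [Real.pi_ne_zero]
  have h8 := mul_left_cancel₀ h7 h6
  rw [hg] at h8
  exact_mod_cast h8.symm

end Shift

end LoopKirwan

end

/-! ### Continuity of the moment map. -/

noncomputable section

namespace LoopKirwan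

lemma contMDiff_comp_smul_const {F : Type*} [NormedAddCommGroup F] [NormedSpace ℝ F]
    {E H N E' H' N' : Type*} [NormedAddCommGroup E] [NormedSpace ℝ E] [TopologicalSpace H]
    [TopologicalSpace N] [ChartedSpace H N] {I : ModelWithCorners ℝ E H}
    [NormedAddCommGroup E'] [NormedSpace ℝ E'] [TopologicalSpace H']
    [TopologicalSpace N'] [ChartedSpace H' N'] {I' : ModelWithCorners ℝ E' H'} {f : F × N → N'}
    (hf : ContMDiff (𝓘(ℝ, F).prod I) I' ∞ f) (v : F) :
    ContMDiff (𝓘(ℝ, ℝ).prod I) I' ∞ (fun p : ℝ × N => f (p.1 • v, p.2)) := by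
  have h2 : ContMDiff 𝓘(ℝ, ℝ) 𝓘(ℝ, F) ∞ (fun u : ℝ => u • v) :=
    (contDiff_id.smul contDiff_const).contMDiff
  exact hf.comp ((h2.comp contMDiff_fst).prodMk contMDiff_snd)

/-- The generator is the tangent map of the flow, applied to the unit vector in time and the zero
vector in space. -/
lemma VectorAction.contMDiff_gen {V : Type*} [NormedAddCommGroup V] [NormedSpace ℝ V]
    {E : Type*} [NormedAddCommGroup E] [NormedSpace ℝ E]
    {N : Type*} [TopologicalSpace N] [ChartedSpace E N] [IsManifold 𝓘(ℝ, E) ∞ N]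
    (A : VectorAction V E N) (ξ : V) :
    ContMDiff 𝓘(ℝ, E) (𝓘(ℝ, E).prod 𝓘(ℝ, E)) ∞
      (fun y => TotalSpace.mk' E (E := TangentSpace 𝓘(ℝ, E)) y (A.gen ξ y)) := by
  have hM : IsManifold 𝓘(ℝ, E) 1 N := IsManifold.of_le (n := ∞) (by simp)
  have hM' : IsManifold 𝓘(ℝ, E) (∞ + 1) N := by
    simpa using (inferInstance : IsManifold 𝓘(ℝ, E) ∞ N)
  let F : ℝ × N → N := fun p => A.act (-(p.1 • ξ)) p.2
  have hF : ContMDiff (𝓘(ℝ, ℝ).prod 𝓘(ℝ, E)) 𝓘(ℝ, E) ∞ F := by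
    refine (contMDiff_comp_smul_const A.smooth (-ξ)).congr fun p => ?_
    show _ = A.act _ _
    rw [smul_neg]
  let z : N → TangentBundle 𝓘(ℝ, E) N := fun y => TotalSpace.mk' E y 0
  have hz : ContMDiff 𝓘(ℝ, E) (𝓘(ℝ, E).prod 𝓘(ℝ, E)) ∞ z := contMDiff_zeroSection _ _
  let v : N → TangentBundle 𝓘(ℝ, ℝ) ℝ := fun _ => TotalSpace.mk' ℝ 0 (1 : ℝ)
  have hv : ContMDiff 𝓘(ℝ, E) (𝓘(ℝ, ℝ).prod 𝓘(ℝ, ℝ)) ∞ v := contMDiff_const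
  have h3 := hF.contMDiff_tangentMap (m := ∞) le_rfl
  have h2 := contMDiff_equivTangentBundleProd_symm (I := 𝓘(ℝ, ℝ)) (M := ℝ) (I' := 𝓘(ℝ, E))
    (M' := N) (n := ∞)
  refine ((h3.comp h2).comp (hv.prodMk hz)).congr fun y => ?_
  have hd : HasMFDerivAt 𝓘(ℝ, ℝ) 𝓘(ℝ, E) (fun u : ℝ => A.act (-(u • ξ)) y) 0
      ((mfderiv (𝓘(ℝ, ℝ).prod 𝓘(ℝ, E)) 𝓘(ℝ, E) F (0, y) : ℝ × E →L[ℝ] E).comp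
        ((ContinuousLinearMap.id ℝ ℝ).prod (0 : ℝ →L[ℝ] E))) := by
    have h5 : HasMFDerivAt 𝓘(ℝ, ℝ) (𝓘(ℝ, ℝ).prod 𝓘(ℝ, E)) (fun u : ℝ => (u, y)) 0
        ((ContinuousLinearMap.id ℝ ℝ).prod (0 : ℝ →L[ℝ] E)) :=
      (hasMFDerivAt_id (0 : ℝ)).prodMk (hasMFDerivAt_const y (0 : ℝ))
    exact HasMFDerivAt.comp (f := fun u : ℝ => (u, y)) (g := F) (0 : ℝ)
      ((hF.mdifferentiable (by simp) (0, y)).hasMFDerivAt) h5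
  have h6 := congrArg (fun T : ℝ →L[ℝ] E => T 1)
    (hasMFDerivAt_unique (A.hasMFDerivAt_curve_zero ξ y) hd)
  have h7 : (A.gen ξ y : E) =
      (mfderiv (𝓘(ℝ, ℝ).prod 𝓘(ℝ, E)) 𝓘(ℝ, E) F (0, y) : ℝ × E →L[ℝ] E) (1, 0) :=
    (one_smul ℝ (A.gen ξ y : E)).symm.trans h6
  have h8 : F (0, y) = y := by
    show A.act (-((0 : ℝ) • ξ)) y = y
    rw [zero_smul, neg_zero, A.zero_act]
  have h9 : ∀ (a b : N) (s t : E), a = b → s = t →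
      (TotalSpace.mk' E (E := TangentSpace 𝓘(ℝ, E)) a s) = TotalSpace.mk' E b t := by
    rintro a b s t rfl rfl
    rfl
  exact h9 _ _ _ _ h8.symm h7

variable {G : Type*} [Group G] [TopologicalSpace G] [IsTopologicalGroup G]
  [CompactSpace G] [SimplyConnectedSpace G] {n : ℕ} {D : LoopData G n}
  {Γ : Type*} [Group Γ] {Λ : CentralExtension D Γ}
  {E : Type*} [NormedAddCommGroup E] [NormedSpace ℝ E]
  {N : Type*} [TopologicalSpace N] [ChartedSpace E N] [IsManifold 𝓘(ℝ, E) ∞ N] [MulAction D.LG N]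
  {L : N → Type*} [TopologicalSpace (TotalSpace ℂ L)] [∀ x, NormedAddCommGroup (L x)]
  [∀ x, InnerProductSpace ℂ (L x)] [FiberBundle ℂ L] [VectorBundle ℝ ℂ L]
  [VectorBundle ℂ ℂ L] [ContMDiffVectorBundle ∞ ℂ L 𝓘(ℝ, E)]

lemma continuousAt_deriv_param {f : N → ℝ → ℂ} {x : N}
    (hf : ContMDiffAt (𝓘(ℝ, E).prod 𝓘(ℝ, ℝ)) 𝓘(ℝ, ℂ) ∞ (Function.uncurry f) (x, 0)) :
    ContinuousAt (fun y => deriv (f y) 0) x := by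
  have hM : IsManifold 𝓘(ℝ, E) 1 N := IsManifold.of_le (n := ∞) (by simp)
  have h := (ContMDiffAt.mfderiv (m := 0) f (fun _ => (0 : ℝ)) hf contMDiffAt_const
    (by simp)).continuousAt
  have he := inTangentCoordinates_model_space (I := 𝓘(ℝ, ℝ)) (I' := 𝓘(ℝ, ℂ)) (fun _ : N => (0 : ℝ))
    (fun y => f y 0) (fun y => (mfderiv 𝓘(ℝ, ℝ) 𝓘(ℝ, ℂ) (f y) 0 : ℝ →L[ℝ] ℂ)) x
  let P : N → ℝ →L[ℝ] ℂ := fun y => mfderiv 𝓘(ℝ, ℝ) 𝓘(ℝ, ℂ) (f y) 0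
  have hP : ContinuousAt P x := (congrArg (fun F : N → ℝ →L[ℝ] ℂ => ContinuousAt F x) he).mp h
  have h2 : ContinuousAt (fun y => P y 1) x := hP.clm_apply continuousAt_const
  refine h2.congr (Eventually.of_forall fun y => ?_)
  show (mfderiv 𝓘(ℝ, ℝ) 𝓘(ℝ, ℂ) (f y) 0 : ℝ →L[ℝ] ℂ) 1 = _
  rw [mfderiv_eq_fderiv]
  rfl

/-- The components of the `Spin_c` moment map are continuous. -/
lemma continuous_moment (hact : IsSmoothAction D E N) {𝓛 : LevelAction Λ 2 E ℂ L}
    {nabla : CovariantDerivative 𝓘(ℝ, E) ℂ L} (hnabla : IsInvariantHermitianConnection Λ 𝓛 nabla)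
    {φ : N → D.tAlg} (hφ : IsSpincMoment Λ 𝓛 nabla φ) (ξ : D.tAlg) :
    Continuous fun x => D.B (φ x) ξ := by
  refine continuous_iff_continuousAt.2 fun x => ?_
  have hM : IsManifold 𝓘(ℝ, E) 1 N := IsManifold.of_le (n := ∞) (by simp)
  obtain ⟨σ, hσ1, hσ2⟩ := exists_section_eq_one (E := E) (L := L) x
  set e := trivializationAt ℂ L x with he
  have hxb : x ∈ e.baseSet := FiberBundle.mem_baseSet_trivializationAt' (F := ℂ) (E := L) x
  have hbx : e.baseSet ∈ 𝓝 x := e.open_baseSet.mem_nhds hxb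
  let flow : N → ℝ → N := fun y u => D.expLoop (-(u • D.constFun ξ)) • y
  let f : N → ℝ → ℂ := fun y u => (e (𝓛.tot (Λ.lift (u • D.constFun ξ))
    (TotalSpace.mk' ℂ (flow y u) (σ (flow y u))))).2
  have hf : ContMDiffAt (𝓘(ℝ, E).prod 𝓘(ℝ, ℝ)) 𝓘(ℝ, ℂ) ∞ (Function.uncurry f) (x, 0) := by
    have hflow : ContMDiff (𝓘(ℝ, ℝ).prod 𝓘(ℝ, E)) 𝓘(ℝ, E) ∞
        (fun p : ℝ × N => flow p.2 p.1) := by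
      refine (contMDiff_comp_smul_const hact.torusAction.smooth (-ξ)).congr fun p => ?_
      show D.expLoop (-(p.1 • D.constFun ξ)) • p.2 = D.torusLoop (p.1 • -ξ) • p.2
      rw [D.expLoop_neg_smul_constFun, smul_neg]
    have hx : flow x 0 = x := by
      show D.expLoop (-((0 : ℝ) • D.constFun ξ)) • x = x
      rw [D.expLoop_neg_smul_constFun, zero_smul, neg_zero, D.torusLoop_zero, one_smul]
    have h1 : ContMDiffAt (𝓘(ℝ, E).prod 𝓘(ℝ, ℝ)) (𝓘(ℝ, E).prod 𝓘(ℝ, ℂ)) ∞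
        (fun p : N × ℝ => TotalSpace.mk' ℂ (flow p.1 p.2) (σ (flow p.1 p.2))) (x, 0) :=
      ContMDiffAt.comp (g := fun y => TotalSpace.mk' ℂ y (σ y))
        (f := fun p : N × ℝ => flow p.1 p.2) (x, (0 : ℝ))
        (by rw [hx]; exact hσ2.contMDiffAt hbx)
        (hflow.comp (contMDiff_snd.prodMk contMDiff_fst)).contMDiffAt
    have h2 : ContMDiff (𝓘(ℝ, ℝ).prod (𝓘(ℝ, E).prod 𝓘(ℝ, ℂ))) (𝓘(ℝ, E).prod 𝓘(ℝ, ℂ)) ∞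
        (fun p : ℝ × TotalSpace ℂ L => 𝓛.tot (Λ.lift (p.1 • D.constFun ξ)) p.2) :=
      contMDiff_comp_smul_const 𝓛.smooth_exp (D.constFun ξ)
    have h3 : ContMDiffAt (𝓘(ℝ, E).prod 𝓘(ℝ, ℝ)) (𝓘(ℝ, E).prod 𝓘(ℝ, ℂ)) ∞
        (fun p : N × ℝ => 𝓛.tot (Λ.lift (p.2 • D.constFun ξ))
          (TotalSpace.mk' ℂ (flow p.1 p.2) (σ (flow p.1 p.2)))) (x, 0) :=
      ContMDiffAt.comp (f := fun p : N × ℝ => (p.2,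
          TotalSpace.mk' ℂ (flow p.1 p.2) (σ (flow p.1 p.2)))) (x, (0 : ℝ))
        h2.contMDiffAt (contMDiffAt_snd.prodMk h1)
    refine ((e.contMDiffAt_iff ?_).1 h3).2
    rw [e.mem_source]
    show Λ.proj (Λ.lift ((0 : ℝ) • D.constFun ξ)) • flow x 0 ∈ e.baseSet
    rwa [zero_smul, Λ.lift_zero, map_one, one_smul, hx]
  have hcov : ContinuousAt (fun y => (e (TotalSpace.mk' ℂ y
      (nabla.toFun σ y (generator D (D.constFun ξ) y)))).2) x := by
    have h1 := ((hnabla.smooth _ e.open_baseSet).contMDiff (σ := σ)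
      (by simpa using hσ2)).contMDiffAt hbx
    have h2 := (hact.torusAction.contMDiff_gen ξ).contMDiffAt (x := x)
    have h3 := ContMDiffAt.clm_bundle_apply h1 h2
    have h4 := ((e.contMDiffAt_section_iff hxb).1 h3).continuousAt
    refine h4.congr (Eventually.of_forall fun y => ?_)
    show (e (TotalSpace.mk' ℂ y (nabla.toFun σ y (hact.torusAction.gen ξ y)))).2 = _
    rw [hact.torusAction_gen]
  -- In a trivialization where `σ` is the constant `1`, the moment map is the difference of the Lie
  -- derivative and the covariant derivative of `σ`, both continuous in the base point.
  have hval : ∀ y ∈ e.baseSet, ((D.B (φ y) ξ : ℝ) : ℂ) = (4 * (Real.pi : ℂ) * Complex.I)⁻¹ *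
      (deriv (f y) 0 - (e (TotalSpace.mk' ℂ y
        (nabla.toFun σ y (generator D (D.constFun ξ) y)))).2) := by
    intro y hy
    obtain ⟨w, hw⟩ := 𝓛.exists_flow_section ξ y σ
    have hd := hφ y ξ σ w ((hσ2.contMDiffAt (e.open_baseSet.mem_nhds hy)).mdifferentiableAt
      (by simp)) hw
    let T : L y →L[ℂ] ℂ := e.continuousLinearMapAt ℂ y
    have hT : ∀ v : L y, T v = (e (TotalSpace.mk' ℂ y v)).2 := fun v => by
      show e.continuousLinearMapAt ℂ y v = _
      rw [Trivialization.continuousLinearMapAt_apply ℂ e, e.coe_linearMapAt_of_mem hy]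
    have h1 : HasDerivAt (fun u => T (w u)) (T (nabla.toFun σ y (generator D (D.constFun ξ) y) +
      (4 * (Real.pi : ℂ) * Complex.I * (D.B (φ y) ξ : ℂ)) • σ y)) 0 :=
      (T.restrictScalars ℝ).hasFDerivAt.comp_hasDerivAt (0 : ℝ) hd
    have h2 : (fun u => T (w u)) = f y := by
      funext u
      rw [hT, hw]
    rw [h2] at h1
    rw [h1.deriv, map_add, map_smul, hT, hT (σ y), hσ1 y hy, add_sub_cancel_left, smul_eq_mul]
    have : (4 * (Real.pi : ℂ) * Complex.I) ≠ 0 := by simp [Real.pi_ne_zero]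
    field_simp
  have hc : ContinuousAt (fun y => ((D.B (φ y) ξ : ℝ) : ℂ)) x :=
    ((continuousAt_const.mul ((continuousAt_deriv_param hf).sub hcov)).congr
      (eventually_of_mem hbx fun y hy => (hval y hy).symm))
  exact (Complex.continuous_re.continuousAt.comp hc)

end LoopKirwan

end

/-! ### Integrality: approaching a rational subspace along integral translates. -/

noncomputable section

namespace LoopKirwan

section FiniteDimensional

variable {V : Type*} [NormedAddCommGroup V] [NormedSpace ℝ V]
  {b : V →ₗ[ℝ] V →ₗ[ℝ] ℝ}

lemma eq_of_forall_apply_eq (hb : ∀ v, v ≠ 0 → 0 < b v v) {Λ : Set V}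
    (hΛ : Submodule.span ℝ Λ = ⊤) {p q : V} (h : ∀ f ∈ Λ, b p f = b q f) : p = q := by
  by_contra hne
  have h1 : ∀ f ∈ Submodule.span ℝ Λ, b (p - q) f = 0 := fun f hf => by
    induction hf using Submodule.span_induction with
    | mem x hx => rw [map_sub, LinearMap.sub_apply, h x hx, sub_self]
    | zero => simp
    | add x y _ _ hx hy => rw [map_add, hx, hy, add_zero]
    | smul c x _ hx => rw [map_smul, hx, smul_zero]
  have h2 := hb (p - q) (sub_ne_zero.2 hne)
  rw [h1 _ (by rw [hΛ]; trivial)] at h2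
  exact lt_irrefl _ h2

/-- By positivity, pairing with a basis is injective, so `f` is recovered linearly from finitely
many of its components. -/
lemma continuous_of_continuous_apply [FiniteDimensional ℝ V] (hb : ∀ v, v ≠ 0 → 0 < b v v) {N : Type*} [TopologicalSpace N]
    {f : N → V} (hf : ∀ v, Continuous fun x => b (f x) v) : Continuous f := by
  let e := Module.finBasis ℝ V
  let T : V →ₗ[ℝ] (Fin (Module.finrank ℝ V) → ℝ) := LinearMap.pi fun i => b.flip (e i)
  have hT : LinearMap.ker T = ⊥ := by
    refine LinearMap.ker_eq_bot.2 fun p q hpq => ?_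
    exact eq_of_forall_apply_eq hb (Λ := Set.range e) e.span_eq (by
      rintro _ ⟨i, rfl⟩
      exact congrFun hpq i)
  obtain ⟨g, hg⟩ := T.exists_leftInverse_of_injective hT
  have h1 : f = fun x => g (T (f x)) := by
    funext x
    exact (LinearMap.congr_fun hg (f x)).symm
  rw [h1]
  exact (LinearMap.continuous_of_finiteDimensional g).comp (continuous_pi fun i => hf (e i))

/-- Integral translates of a convergent family that approach the linear part of a closed group
containing the lattice eventually have their limits in it. -/
lemma eventually_add_mem_lineSubmodule [FiniteDimensional ℝ V] (hb : ∀ v, v ≠ 0 → 0 < b v v) {P Λ : AddSubgroup V}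
    (hΛs : Submodule.span ℝ (Λ : Set V) = ⊤) (hP : IsClosed (P : Set V)) (hΛ : Λ ≤ P) {F : Set V}
    (hF : IsCompact F) (hFΛ : ∀ w : V, ∃ s ∈ Λ, w - s ∈ F)
    (hint : ∀ s ∈ Λ, ∀ f ∈ Λ, ∃ m : ℤ, b s f = m) {ι : Type*} {l : Ultrafilter ι} {ψ v : ι → V}
    {a : V} (hψ : Tendsto ψ l (𝓝 a)) (hv : ∀ i, ∀ f ∈ Λ, ∃ m : ℤ, b (v i) f = m)
    (hd : Tendsto (fun i => Metric.infDist (ψ i + v i) (lineSubmodule P)) l (𝓝 0)) :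
    ∀ᶠ i in (l : Filter ι), a + v i ∈ lineSubmodule P := by
  obtain ⟨F', hF', hF'P, hred⟩ := exists_compact_fundamental_lineSubmodule hP hΛ hF hFΛ
  have h1 : ∀ i, ∃ s ∈ lineSubmodule P, ‖ψ i + v i - s‖ =
      Metric.infDist (ψ i + v i) (lineSubmodule P) := fun i => VectorAction.exists_infDist_eq_norm _
  choose s hs hsd using h1
  -- Subtracting lattice vectors `t i` of the linear part from the nearest points `s i` makes these
  -- converge. Then `v i - t i` converges to `k - a`, even if `v i` is unbounded.
  choose t htΛ htP htF using fun i => hred (s i) (hs i)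
  have hr : Tendsto (fun i => ψ i + v i - s i) l (𝓝 0) := by
    refine tendsto_zero_iff_norm_tendsto_zero.2 ?_
    simpa only [hsd] using hd
  obtain ⟨k, hk, hlk⟩ := hF'.ultrafilter_le_nhds (l.map fun i => s i - t i)
    (le_principal_iff.2 (Ultrafilter.mem_map.2 (univ_mem' htF)))
  have hkt : Tendsto (fun i => s i - t i) l (𝓝 k) := hlk
  have hlim : Tendsto (fun i => v i - t i) l (𝓝 (k - a)) := by
    have h2 := (hr.add hkt).sub hψ
    rw [zero_add] at h2
    refine h2.congr fun i => ?_
    abel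
  obtain ⟨S, hSΛ, hS⟩ := (Submodule.fg_span_iff_fg_span_finset_subset (Λ : Set V)).1
    (IsNoetherian.noetherian (Submodule.span ℝ (Λ : Set V)))
  have hev : ∀ f ∈ S, ∀ᶠ i in (l : Filter ι), b (v i - t i) f = b (k - a) f := fun f hf => by
    have hcont : Continuous (b.flip f) := LinearMap.continuous_of_finiteDimensional _
    have h3 : Tendsto (fun i => b (v i - t i) f) l (𝓝 (b (k - a) f)) := (hcont.tendsto _).comp hlim
    have h4 : ∀ i, ∃ m : ℤ, b (v i - t i) f = m := fun i => by
      obtain ⟨m, hm⟩ := hv i f (hSΛ hf)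
      obtain ⟨m', hm'⟩ := hint (t i) (htΛ i) f (hSΛ hf)
      exact ⟨m - m', by rw [map_sub, LinearMap.sub_apply, hm, hm']; push_cast; rfl⟩
    choose m hm using h4
    -- A convergent family of integers has an integral limit and is eventually equal to it. Finitely
    -- many `f` spanning the space suffice to conclude that `v i - t i` is eventually constant.
    have h5 : b (k - a) f ∈ Set.range ((↑) : ℤ → ℝ) :=
      Int.isClosedEmbedding_coe_real.isClosed_range.mem_of_tendsto h3
        (Eventually.of_forall fun i => ⟨m i, (hm i).symm⟩)
    obtain ⟨m0, hm0⟩ := h5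
    have h6 := h3.eventually (Metric.ball_mem_nhds _ one_pos)
    filter_upwards [h6] with i hi
    rw [hm, ← hm0, Real.dist_eq, ← Int.cast_sub, ← Int.cast_abs] at hi
    have h7 : |m i - m0| < 1 := by exact_mod_cast hi
    rw [hm, ← hm0, sub_eq_zero.1 (Int.abs_lt_one_iff.1 h7)]
  filter_upwards [(eventually_all_finset S).2 hev] with i hi
  have h8 : v i - t i = k - a := eq_of_forall_apply_eq hb (Λ := (S : Set V)) (hS ▸ hΛs) hi
  have h9 : a + v i = t i + k := by
    rw [← sub_eq_zero] at h8 ⊢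
    rw [← h8]
    abel
  rw [h9]
  exact Submodule.add_mem _ (htP i) (hF'P hk)

end FiniteDimensional

end LoopKirwan

end

/-! ### Stabilizer algebras along the transversal. -/

noncomputable section

namespace LoopKirwan

variable {G : Type*} [Group G] [TopologicalSpace G] [IsTopologicalGroup G]
  [CompactSpace G] [SimplyConnectedSpace G] {n : ℕ}

namespace LoopData

variable (D : LoopData G n)

/-- The basic inner product on `𝔱`. -/
def tForm : D.tAlg →ₗ[ℝ] D.tAlg →ₗ[ℝ] ℝ := D.B.compl₁₂ D.tAlg.subtype D.tAlg.subtype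

lemma tForm_apply (a b : D.tAlg) : D.tForm a b = D.B a b := rfl

lemma tForm_pos (a : D.tAlg) (ha : a ≠ 0) : 0 < D.tForm a a :=
  D.basic.pos a (D.tAlg_le a.2) (by simpa using ha)

lemma tForm_ext {a b : D.tAlg} (h : ∀ ξ : D.tAlg, D.B a ξ = D.B b ξ) : a = b :=
  eq_of_forall_apply_eq D.tForm_pos (Λ := univ) (by simp) fun f _ => h f

lemma isClosed_latticeSubgroup : IsClosed (D.latticeSubgroup : Set D.tAlg) := by
  have h : Continuous fun a : D.tAlg => NormedSpace.exp (a : Mat n) :=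
    continuous_matrix_exp.comp continuous_subtype_val
  exact isClosed_singleton.preimage h

end LoopData

variable {D : LoopData G n} {E : Type*} [NormedAddCommGroup E] [NormedSpace ℝ E]
  {N : Type*} [TopologicalSpace N] [ChartedSpace E N] [IsManifold 𝓘(ℝ, E) ∞ N] [MulAction D.LG N]
  {𝓗 : HamiltonianSpace D E N} {t : Thickening D}
  {d : ℕ} {M : Type*} [TopologicalSpace M]
  [ChartedSpace (EuclideanSpace ℝ (Fin d)) M]
  [IsManifold 𝓘(ℝ, EuclideanSpace ℝ (Fin d)) ∞ M] {Q : QuotientSpace D E N d M}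

/-- Freeness of `ΩG` on the transversal lets stabilizers be studied in the finite dimensional
manifold `M`. -/
lemma stabAlg_hol (hact : IsSmoothAction D E N) {x : N} (hx : x ∈ transversal 𝓗 t) :
    (Q.torusAction hact).stabAlg (Q.hol x) = hact.torusAction.stabAlg x := by
  ext β
  refine forall_congr' fun u => ?_
  rw [VectorAction.mem_stab, VectorAction.mem_stab, Q.torusAction_act, hact.torusAction_act]
  exact ⟨torusLoop_smul_eq_of_hol_eq Q hx, fun h => by rw [h]⟩

lemma mem_ZSet_iff (Q : QuotientSpace D E N d M) (hact : IsSmoothAction D E N) {φ : N → D.tAlg}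
    {β : D.tAlg} {x : N} : x ∈ ZSet E (transversal 𝓗 t) φ β ↔
      x ∈ transversal 𝓗 t ∧ β ∈ (Q.torusAction hact).stabAlg (Q.hol x) ∧ φ x = β := by
  refine and_congr_right fun hx => and_congr_left fun _ => ?_
  rw [stabAlg_hol hact hx, ← hact.torusAction_gen, VectorAction.gen_eq_zero_iff]

/-- Compactness turns the local finiteness of `exists_nhds_finite_stabAlg` into a global statement.
-/
lemma finite_stabAlg_image [T2Space M] (Q : QuotientSpace D E N d M) (hact : IsSmoothAction D E N)
    {K : Set N} (hK : IsCompact K) :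
    ((fun x => (Q.torusAction hact).stabAlg (Q.hol x)) '' K).Finite := by
  obtain ⟨F, hF, hFΛ⟩ := D.exists_compact_fundamental_lattice
  have hhol : Continuous Q.hol := Q.submersion.contMDiff.continuous
  refine hK.induction_on (p := fun s =>
    ((fun x => (Q.torusAction hact).stabAlg (Q.hol x)) '' s).Finite) ?_ ?_ ?_ ?_
  · simp
  · exact fun s t hst ht => ht.subset (image_mono hst)
  · intro s t hs ht
    rw [image_union]
    exact hs.union ht
  · intro x _
    obtain ⟨O, hO, hfin⟩ := (Q.torusAction_isIsometric hact).exists_nhds_finite_stabAlg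
      D.isClosed_latticeSubgroup (Q.lattice_le_stab hact) hF hFΛ (Q.hol x)
    refine ⟨Q.hol ⁻¹' O, mem_nhdsWithin_of_mem_nhds (hhol.continuousAt hO), hfin.subset ?_⟩
    rintro _ ⟨y, hy, rfl⟩
    exact ⟨Q.hol y, hy, rfl⟩

end LoopKirwan

end

/-! ### The lower bound. -/

noncomputable section

namespace LoopKirwan

variable {G : Type*} [Group G] [TopologicalSpace G] [IsTopologicalGroup G]
  [CompactSpace G] [SimplyConnectedSpace G] {n : ℕ} {D : LoopData G n}

lemma LoopData.latticeLoop_sub_smul {N : Type*} [MulAction D.LG N] {η ζ : D.tAlg}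
    (hη : η ∈ D.lattice) (hζ : ζ ∈ D.lattice) (x : N) :
    D.latticeLoop (η - ζ) • D.latticeLoop ζ • x = D.latticeLoop η • x := by
  rw [smul_smul, ← D.latticeLoop_add (D.latticeSubgroup.sub_mem hη hζ) hζ, sub_add_cancel]

/-- A vector field of Kirwan type on the transversal is bounded below away from the translates of
its zero set, as soon as the map generating it is continuous and is translated by the integral
lattice through an integral linear map. -/
theorem exists_le_length_kirwan
    {E : Type*} [NormedAddCommGroup E] [NormedSpace ℝ E]
    {N : Type*} [TopologicalSpace N] [ChartedSpace E N] [IsManifold 𝓘(ℝ, E) ∞ N]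
    [MulAction D.LG N] (𝓗 : HamiltonianSpace D E N) (t : Thickening D)
    {d : ℕ} {M : Type*} [TopologicalSpace M] [T2Space M]
    [ChartedSpace (EuclideanSpace ℝ (Fin d)) M]
    [IsManifold 𝓘(ℝ, EuclideanSpace ℝ (Fin d)) ∞ M] (Q : QuotientSpace D E N d M)
    {φ : N → D.tAlg} (hφ : Continuous φ)
    (hshift : ∀ η ∈ D.lattice, ∀ (ξ : D.tAlg) (x : N),
      D.B (φ (D.latticeLoop η • x)) ξ = D.B (φ x) ξ + D.B (D.ℓ η) ξ)
    (hint : ∀ η ∈ D.lattice, ∀ f ∈ D.lattice, ∃ m : ℤ, D.B (D.ℓ η) f = m)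
    {Bstar : Set D.tAlg} (hBstar : ∀ β ∈ BSet E (transversal 𝓗 t) φ, ∃ β' ∈ Bstar,
      ∃ η ∈ D.lattice, ZSet E (transversal 𝓗 t) φ β =
        D.latticeLoop η • ZSet E (transversal 𝓗 t) φ β')
    {U : D.tAlg → Set N} (hU : ∀ β ∈ Bstar, ∃ O : Set N, IsOpen O ∧
      U β = O ∩ transversal 𝓗 t ∧ ZSet E (transversal 𝓗 t) φ β ⊆ U β) :
    ∃ c : ℝ, 0 < c ∧ ∀ x ∈ transversal 𝓗 t \ USet E (transversal 𝓗 t) φ Bstar U,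
      c ≤ length Q x (kirwan E φ x) := by
  by_contra! hcon
  have hact := 𝓗.smooth_action
  set X := transversal 𝓗 t with hX
  choose x hxX hxc using fun k : ℕ => hcon (1 / ((k : ℝ) + 1)) (by positivity)
  obtain ⟨K, hK, hKX, hKη⟩ := exists_compact_fundamental_transversal 𝓗 t
  choose η hη y hyK hxy using fun k => hKη (x k) (hxX k).1
  -- An ultrafilter replaces repeated passage to subsequences: limits in compact sets exist along
  -- it, and it decides each membership in a stabilizer algebra.
  let l : Ultrafilter ℕ := hyperfilter ℕ
  have hlim : Tendsto (fun k : ℕ => 1 / ((k : ℝ) + 1)) l (𝓝 0) :=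
    tendsto_one_div_add_atTop_nhds_zero_nat.mono_left Nat.hyperfilter_le_atTop
  obtain ⟨z, hzK, hlz⟩ := hK.ultrafilter_le_nhds (l.map y)
    (le_principal_iff.2 (Ultrafilter.mem_map.2 (univ_mem' hyK)))
  have hyz : Tendsto y l (𝓝 z) := hlz
  let A := Q.torusAction hact
  have hA := Q.torusAction_isIsometric hact
  have hhol : Continuous Q.hol := Q.submersion.contMDiff.continuous
  have hholx : ∀ k, Q.hol (x k) = Q.hol (y k) := fun k => by
    rw [hxy, Q.hol_latticeLoop_smul (hη k)]
  obtain ⟨F, hF, hFΛ⟩ := D.exists_compact_fundamental_lattice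
  -- the value of the moment map approaches the stabilizer algebra
  have hdist : Tendsto (fun k => Metric.infDist (φ (x k)) (A.stabAlg (Q.hol z))) l (𝓝 0) := by
    refine Metric.tendsto_nhds.2 fun δ hδ => ?_
    obtain ⟨O, hO, r, hr, hOr⟩ := hA.exists_nhds_infDist_lt (Q.lattice_le_stab hact) hF hFΛ
      (Q.hol z) hδ
    filter_upwards [((hhol.tendsto z).comp hyz).eventually hO,
      hlim.eventually (gt_mem_nhds (Real.sqrt_pos.2 hr))] with k hk hkr
    have h1 : Q.hol (x k) ∈ O := by
      rw [hholx]
      exact hk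
    have h2 := (hxc k).trans hkr
    rw [kirwan, Q.length_kirwan hact] at h2
    have h3 := hOr _ h1 (φ (x k)) (lt_of_not_ge fun h => h2.not_ge (Real.sqrt_le_sqrt h))
    rwa [Real.dist_eq, sub_zero, abs_of_nonneg Metric.infDist_nonneg]
  -- This stands for `ℓ η_k`: it is in `𝔱` by construction and has the same pairings with `𝔱`.
  let v : ℕ → D.tAlg := fun k => φ (x k) - φ (y k)
  have hv : ∀ k (ξ : D.tAlg), D.B (v k) ξ = D.B (D.ℓ (η k)) ξ := fun k ξ => by
    have h1 := hshift (η k) (hη k) ξ (y k)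
    rw [← hxy] at h1
    show D.B ((φ (x k) : Mat n) - φ (y k)) ξ = _
    rw [map_sub, LinearMap.sub_apply, h1, add_sub_cancel_left]
  have hmem : ∀ᶠ k in (l : Filter ℕ), φ z + v k ∈ A.stabAlg (Q.hol z) := by
    refine eventually_add_mem_lineSubmodule D.tForm_pos D.span_lattice
      (A.isClosed_stab (Q.hol z)) (Q.lattice_le_stab hact _) hF hFΛ ?_
      ((hφ.tendsto z).comp hyz) ?_ ?_
    · exact fun s hs f hf => D.basic.integral s s.2 f f.2 hs hf
    · intro k f hf
      rw [D.tForm_apply, hv]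
      exact hint _ (hη k) f hf
    · refine hdist.congr fun k => ?_
      simp only [Function.comp, v, add_sub_cancel]
      rfl
  -- the stabilizer algebras containing the shifted value are eventually constant
  have hconst : ∀ᶠ k in (l : Filter ℕ), ∀ S ∈ (fun w => A.stabAlg (Q.hol w)) '' K,
      (φ z + v k ∈ S ↔ ∀ᶠ j in (l : Filter ℕ), φ z + v j ∈ S) := by
    refine (finite_stabAlg_image Q hact hK).eventually_all.2 fun S _ => ?_
    by_cases hS : ∀ᶠ j in (l : Filter ℕ), φ z + v j ∈ S
    · filter_upwards [hS] with k hk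
      exact iff_of_true hk hS
    · filter_upwards [Ultrafilter.eventually_not.2 hS] with k hk
      exact iff_of_false hk hS
  let good : ℕ → Prop := fun k => ∀ S ∈ (fun w => A.stabAlg (Q.hol w)) '' K,
      (φ z + v k ∈ S ↔ ∀ᶠ j in (l : Filter ℕ), φ z + v j ∈ S)
  have hzX : z ∈ X := hKX hzK
  have hstab : ∀ w ∈ X, A.stabAlg (Q.hol w) ∈ (fun w => A.stabAlg (Q.hol w)) '' K := by
    intro w hw
    obtain ⟨ν, hν, k, hk, rfl⟩ := hKη w hw
    exact ⟨k, hk, by rw [Q.hol_latticeLoop_smul hν]⟩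
  -- Stabilizer algebras are unchanged by `Π`, and for good indices the vectors `φ z + v j` and `φ z
  -- + v k` belong to the same ones. Translation by `η k - η j` changes `φ` by exactly `v k - v j`.
  have hmove : ∀ j k, good j → good k → ∀ w ∈ ZSet E X φ (φ z + v j),
      D.latticeLoop (η k - η j) • w ∈ ZSet E X φ (φ z + v k) := by
    intro j k hj hk w hw
    have hsub := D.latticeSubgroup.sub_mem (hη k) (hη j)
    obtain ⟨hwX, hws, hwφ⟩ := (mem_ZSet_iff Q hact).1 hw
    refine (mem_ZSet_iff Q hact).2 ⟨latticeLoop_smul_mem_transversal hsub hwX, ?_, ?_⟩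
    · rw [Q.hol_latticeLoop_smul hsub]
      exact (hk _ (hstab w hwX)).2 ((hj _ (hstab w hwX)).1 hws)
    · refine D.tForm_ext fun ξ => ?_
      rw [hshift _ hsub, hwφ]
      simp only [Submodule.coe_add, Submodule.coe_sub, map_add, map_sub, LinearMap.add_apply,
        LinearMap.sub_apply, hv]
      ring
  have hcancel : ∀ j k (w : N), D.latticeLoop (η k - η j) • D.latticeLoop (η j - η k) • w = w := by
    intro j k w
    rw [smul_smul, ← D.latticeLoop_add (D.latticeSubgroup.sub_mem (hη k) (hη j))
      (D.latticeSubgroup.sub_mem (hη j) (hη k)), sub_add_sub_cancel, sub_self, D.latticeLoop_zero,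
      one_smul]
  have hZ : ∀ j k, good j → good k → ZSet E X φ (φ z + v k) =
      D.latticeLoop (η k - η j) • ZSet E X φ (φ z + v j) := by
    intro j k hj hk
    refine Subset.antisymm (fun w hw => ?_) ?_
    · exact ⟨_, hmove k j hk hj w hw, hcancel j k w⟩
    · rintro _ ⟨w, hw, rfl⟩
      exact hmove j k hj hk w hw
  have hzZ : ∀ k, φ z + v k ∈ A.stabAlg (Q.hol z) →
      D.latticeLoop (η k) • z ∈ ZSet E X φ (φ z + v k) := by
    intro k hk
    refine (mem_ZSet_iff Q hact).2 ⟨latticeLoop_smul_mem_transversal (hη k) hzX, ?_, ?_⟩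
    · rwa [Q.hol_latticeLoop_smul (hη k)]
    · refine D.tForm_ext fun ξ => ?_
      rw [hshift _ (hη k), Submodule.coe_add, map_add, LinearMap.add_apply, hv]
  -- One reference index `j` fixes the representative `β'` and the translation `η'`, which then
  -- serve for all good indices.
  obtain ⟨j, hjmem, hj⟩ := (hmem.and hconst).exists
  obtain ⟨β', hβ', η', hη', hZβ⟩ := hBstar (φ z + v j) ⟨_, hzZ j hjmem⟩
  obtain ⟨O, hO, hUO, hZU⟩ := hU β' hβ'
  have hsub : η j - η' ∈ D.lattice := D.latticeSubgroup.sub_mem (hη j) hη'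
  have hzO : D.latticeLoop (η j - η') • z ∈ O := by
    have h1 := hzZ j hjmem
    rw [hZβ] at h1
    obtain ⟨w, hw, hwz⟩ := h1
    have h2 : D.latticeLoop (η j - η') • z = w := by
      have h3 : D.latticeLoop η' • w = D.latticeLoop η' • D.latticeLoop (η j - η') • z := by
        rw [smul_smul (D.latticeLoop η'), ← D.latticeLoop_add hη' hsub, add_sub_cancel]
        exact hwz
      exact (MulAction.injective (D.latticeLoop η') h3).symm
    rw [h2]
    exact (hUO ▸ hZU hw : w ∈ O ∩ X).1
  have hyO : ∀ᶠ k in (l : Filter ℕ), D.latticeLoop (η j - η') • y k ∈ O :=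
    (((hact.smooth_smul _).continuous.tendsto z).comp hyz).eventually (hO.mem_nhds hzO)
  obtain ⟨k, ⟨hkmem, hk⟩, hkO⟩ := ((hmem.and hconst).and hyO).exists
  -- The translation is the one carrying `𝒵_{β'}` to the critical set at `φ z + v k` by way of the
  -- reference index. It also carries `(η j - η') · y k`, a point of `U β'`, to `x k`.
  refine (hxX k).2 ⟨φ z + v k, ⟨_, hzZ k hkmem⟩, β', hβ', η k - η j + η', ?_, ?_, ?_⟩
  · exact D.latticeSubgroup.add_mem (D.latticeSubgroup.sub_mem (hη k) (hη j)) hη'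
  · rw [hZ j k hj hk, hZβ, D.latticeLoop_add (D.latticeSubgroup.sub_mem (hη k) (hη j)) hη',
      mul_smul]
  · refine ⟨D.latticeLoop (η j - η') • y k, ?_, ?_⟩
    · rw [hUO]
      exact ⟨hkO, latticeLoop_smul_mem_transversal hsub (hKX (hyK k))⟩
    · rw [hxy k]
      show D.latticeLoop _ • D.latticeLoop _ • y k = _
      rw [show η k - η j + η' = η k - (η j - η') by abel]
      exact D.latticeLoop_sub_smul (hη k) hsub (y k)

end LoopKirwan

end

theorem mainTheorem12
    {G : Type*} [Group G] [TopologicalSpace G] [IsTopologicalGroup G] [CompactSpace G]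
    [SimplyConnectedSpace G] {n : ℕ} (D : LoopKirwan.LoopData G n)
    -- the proper Hamiltonian loop group space
    {E : Type*} [NormedAddCommGroup E] [NormedSpace ℝ E] [CompleteSpace E]
    {N : Type*} [TopologicalSpace N] [T2Space N] [ChartedSpace E N] [IsManifold 𝓘(ℝ, E) ∞ N]
    [MulAction D.LG N] (𝓗 : LoopKirwan.HamiltonianSpace D E N)
    -- its quotient by the based loop group, with an invariant Riemannian metric
    {k : ℕ} {M : Type*} [TopologicalSpace M] [T2Space M]
    [ChartedSpace (EuclideanSpace ℝ (Fin (2 * k))) M]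
    [IsManifold 𝓘(ℝ, EuclideanSpace ℝ (Fin (2 * k))) ∞ M]
    (Q : LoopKirwan.QuotientSpace D E N (2 * k) M)
    -- the level `ℓ` central extension
    {Γ : Type*} [Group Γ] (Λ : LoopKirwan.CentralExtension D Γ)
    -- the spinor bundle
    (S : N → Type*) [TopologicalSpace (TotalSpace (LoopKirwan.SpinorFibre k) S)]
    [∀ x, NormedAddCommGroup (S x)] [∀ x, InnerProductSpace ℂ (S x)]
    [FiberBundle (LoopKirwan.SpinorFibre k) S]
    [VectorBundle ℂ (LoopKirwan.SpinorFibre k) S] [VectorBundle ℝ (LoopKirwan.SpinorFibre k) S]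
    [ContMDiffVectorBundle ∞ (LoopKirwan.SpinorFibre k) S 𝓘(ℝ, E)]
    (𝓢 : LoopKirwan.SpinorBundle Λ Q S)
    -- its anti-canonical line bundle, with an invariant Hermitian connection
    (L : N → Type*) [TopologicalSpace (TotalSpace ℂ L)]
    [∀ x, NormedAddCommGroup (L x)] [∀ x, InnerProductSpace ℂ (L x)]
    [FiberBundle ℂ L] [VectorBundle ℂ ℂ L] [VectorBundle ℝ ℂ L]
    [ContMDiffVectorBundle ∞ ℂ L 𝓘(ℝ, E)]
    (𝓛 : LoopKirwan.AnticanonicalBundle Λ 𝓢 L)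
    (nabla : CovariantDerivative 𝓘(ℝ, E) ℂ L)
    (hnabla : LoopKirwan.IsInvariantHermitianConnection Λ 𝓛.toLevelAction nabla)
    -- the `𝔱`-component of the `Spin_c` moment map
    (φ : N → D.tAlg) (hφ : LoopKirwan.IsSpincMoment Λ 𝓛.toLevelAction nabla φ)
    -- the global transversal and the neighborhoods
    (t : LoopKirwan.Thickening D) (X : Set N) (hX : X = LoopKirwan.transversal 𝓗 t)
    (Bstar : Set D.tAlg) (hBstar : LoopKirwan.IsRepresentatives E X φ Bstar)
    (U : D.tAlg → Set N)
    (hU : ∀ β ∈ Bstar, LoopKirwan.IsInvariantNhd (D := D) X (LoopKirwan.ZSet E X φ β) (U β)) :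
    ∃ c : ℝ, 0 < c ∧ ∀ x ∈ X \ LoopKirwan.USet E X φ Bstar U,
      c ≤ LoopKirwan.length Q x (LoopKirwan.kirwan E φ x) := by
  obtain rfl := hX
  have hact := 𝓗.smooth_action
  refine LoopKirwan.exists_le_length_kirwan 𝓗 t Q ?_ ?_ ?_ hBstar.prop.2 ?_
  · exact LoopKirwan.continuous_of_continuous_apply D.tForm_pos
      fun ξ => LoopKirwan.continuous_moment hact hnabla hφ ξ
  · exact fun η hη ξ x => LoopKirwan.moment_latticeLoop_smul hact hnabla hφ hη ξ x
  · exact fun η hη f hf => Λ.exists_int_eq hη hf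
  · intro β hβ
    obtain ⟨O, hO, hUO⟩ := (hU β hβ).isOpen
    exact ⟨O, hO, hUO, (hU β hβ).subset⟩
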